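/- There are a randomized query algorithm $\mathcal A$ and an absolute constant $C>0$ with the following property. Let $0<\varepsilon\le 2$, and let $G=(V,E)$ be a finite, nonempty, undirected simple graph without isolated vertices, with adjacency matrix $A$, diagonal degree matrix $D$, and normalized Laplacian $L=I-D^{-1/2}AD^{-1/2}$, whose eigenvalues (with multiplicity) are $\lambda_1,\dots,\lambda_{|V|}\in[0,2]$. The algorithm receives the accuracy $\varepsilon$ (through the integer $\lceil 1/\varepsilon\rceil$) and accesses $G$ only through two kinds of unit-cost queries: one returns a uniformly random vertex of $G$, the other returns, for a vertex already obtained, a uniformly random neighbour of that vertex. All queries have independent answers. It is not told $|V|$; vertex names can only be stored, copied, and compared for equality. Otherwise it is a program of a random access machine whose steps (addition, truncated subtraction, memory access, tests, output, etc.) have unit cost. Then $\mathcal A$ always halts within $\exp(C/\varepsilon)$ steps and makes at most $\exp(C/\varepsilon)$ queries, independently of $|V|$. With probability at least $2/3$ it outputs a discrete probability distribution $q$ on $[0,2]$, given as a list of at most $C/\varepsilon$ weighted point masses with rational locations and weights, such that $$W_1\Big(\frac1{|V|}\sum_{i=1}^{|V|}\delta_{\lambda_i},\; q\Big)\le\varepsilon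 ,$$ where $W_1(\mu,\nu)=\inf_\pi\int|x-y|\,d\pi(x,y)$, the infimum over all couplings $\pi$ of $\mu$ and $\nu$, is the earth mover (Wasserstein-1) distance. -/

import Mathlib

open MeasureTheory
open scoped ENNReal

namespace GraphSpectrum

/-! ### The normalized Laplacian and its spectral distribution -/

section Laplacian

variable {V : Type*} [Fintype V] [DecidableEq V] (G : SimpleGraph V) [DecidableRel G.Adj]

/-- The diagonal matrix `D ^ (-1/2)`, where `D` is the diagonal matrix of vertex degrees. -/
noncomputable def invSqrtDegree : Matrix V V ℝ :=
  Matrix.diagonal fun v => (Real.sqrt (G.degree v))⁻¹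

/-- The normalized Laplacian `I - D ^ (-1/2) A D ^ (-1/2)`. -/
noncomputable def normLaplacian : Matrix V V ℝ :=
  1 - invSqrtDegree G * G.adjMatrix ℝ * invSqrtDegree G

theorem normLaplacian_isHermitian : (normLaplacian G).IsHermitian := by
  have h : (invSqrtDegree G).IsHermitian := Matrix.isHermitian_diagonal _
  have hA : (G.adjMatrix ℝ).IsHermitian := by
    rw [Matrix.IsHermitian, Matrix.conjTranspose_eq_transpose_of_trivial,
      SimpleGraph.transpose_adjMatrix]
  refine Matrix.isHermitian_one.sub ?_
  simp only [Matrix.IsHermitian, Matrix.conjTranspose_mul, h.eq, hA.eq, Matrix.mul_assoc]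

/-- The spectral distribution of the normalized Laplacian: `|V|` equally weighted point masses
at its eigenvalues, listed with multiplicity. -/
noncomputable def spectralMeasure : Measure ℝ :=
  ∑ i : V, ((Fintype.card V : ℝ≥0∞)⁻¹) • Measure.dirac ((normLaplacian_isHermitian G).eigenvalues i)

end Laplacian

/-- Earth mover (Wasserstein-1) distance on the real line: the infimum of the transport cost
over all couplings of `μ` and `ν` (it is `⊤` if there is no coupling). -/
noncomputable def W1 (μ ν : Measure ℝ) : ℝ≥0∞ :=
  ⨅ (π : Measure (ℝ × ℝ)) (_ : π.map Prod.fst = μ) (_ : π.map Prod.snd = ν),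
    ∫⁻ p, ENNReal.ofReal |p.1 - p.2| ∂π

/-! ### Output format: finitely supported distributions with rational data -/

/-- An atom at the rational location `num / den` with unnormalized mass `mass`. -/
structure Atom where
  num : ℕ
  den : ℕ
  mass : ℕ

/-- The location of an atom. -/
noncomputable def Atom.loc (a : Atom) : ℝ := (a.num : ℝ) / (a.den : ℝ)

/-- The total unnormalized mass of a list of atoms. -/
def totalMass (l : List Atom) : ℕ := (l.map Atom.mass).sum

/-- The probability distribution described by a list of atoms, where each atom receives its
share of the total mass. -/
noncomputable def outputMeasure (l : List Atom) : Measure ℝ :=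
  (l.map fun a => ((a.mass : ℝ≥0∞) / (totalMass l : ℝ≥0∞)) • Measure.dirac a.loc).sum

/-- The list describes a genuine probability distribution supported in `[0, 2]`. -/
def IsDistribution (l : List Atom) : Prop :=
  0 < totalMass l ∧ ∀ a ∈ l, 0 < a.den ∧ a.loc ≤ 2

/-! ### The machine model

A random access machine with natural number registers, an indirectly addressed memory, a write-only
output, and registers for vertices. Vertex names are atomic: a vertex register can only be
filled by a query, copied, and compared with another one. Arithmetic is limited to addition and
(truncated) subtraction, so that in `t` steps numbers grow by at most `t` bits.
The only source of randomness is the answers of the two kinds of queries. -/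

/-- Programs. All arguments of type `ℕ`, except for the constant `c` of `const`, are indices
of registers. -/
inductive Prog : Type
  /-- `r_x := c` -/
  | const (x c : ℕ)
  /-- `r_x := r_y + r_z` -/
  | add (x y z : ℕ)
  /-- `r_x := r_y - r_z`, truncated at zero -/
  | sub (x y z : ℕ)
  /-- `r_x := mem[r_y]` -/
  | load (x y : ℕ)
  /-- `mem[r_x] := r_y` -/
  | store (x y : ℕ)
  /-- append the atom `(r_x, r_y, r_z)` to the output -/
  | emit (x y z : ℕ)
  /-- query: `v_a :=` a uniformly random vertex -/
  | randVertex (a : ℕ)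
  /-- query: `v_a :=` a uniformly random neighbour of `v_b` -/
  | randNeighbor (a b : ℕ)
  /-- `v_a := v_b` -/
  | copyVertex (a b : ℕ)
  /-- sequential composition -/
  | seq (p q : Prog)
  /-- if `r_x ≠ 0` then `p` else `q` -/
  | cond (x : ℕ) (p q : Prog)
  /-- if `v_a = v_b` then `p` else `q` -/
  | condVertex (a b : ℕ) (p q : Prog)
  /-- while `r_x ≠ 0` do `p` -/
  | loop (x : ℕ) (p : Prog)

/-- The state of the machine; `queries` counts the queries made so far. A vertex register that
has not been filled yet holds `none`. -/
structure State (V : Type*) where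
  reg : ℕ → ℕ
  mem : ℕ → ℕ
  vtx : ℕ → Option V
  out : List Atom
  queries : ℕ

/-- The initial state: the input is in register `0`, everything else is empty. -/
def State.init (V : Type*) (input : ℕ) : State V where
  reg := Function.update (fun _ => 0) 0 input
  mem := fun _ => 0
  vtx := fun _ => none
  out := []
  queries := 0

/-- A configuration: the stack of programs still to be executed, and the state. -/
structure Config (V : Type*) where
  todo : List Prog
  state : State V

/-- A configuration has halted if nothing is left to be executed. -/
def Config.Halted {V : Type*} (c : Config V) : Prop := c.todo = []

section Semantics

variable {V : Type*} [Fintype V] [DecidableEq V] [Nonempty V]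
  (G : SimpleGraph V) [DecidableRel G.Adj]

/-- The distribution of the answer to a neighbour query: uniform on the neighbours of the given
vertex. The answer is `none` if no vertex is given, or if it has no neighbour. -/
noncomputable def neighborDist : Option V → PMF (Option V)
  | none => PMF.pure none
  | some v =>
    if h : (G.neighborFinset v).Nonempty then (PMF.uniformOfFinset (G.neighborFinset v) h).map some
    else PMF.pure none

/-- One step of the machine. Every elementary instruction, every query, every evaluation of a
test and the unfolding of a sequential composition is one step; a halted configuration does not change any more. -/
noncomputable def step : Config V → PMF (Config V)
  | ⟨[], s⟩ => PMF.pure ⟨[], s⟩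
  | ⟨.const x c :: k, s⟩ => PMF.pure ⟨k, { s with reg := Function.update s.reg x c }⟩
  | ⟨.add x y z :: k, s⟩ =>
      PMF.pure ⟨k, { s with reg := Function.update s.reg x (s.reg y + s.reg z) }⟩
  | ⟨.sub x y z :: k, s⟩ =>
      PMF.pure ⟨k, { s with reg := Function.update s.reg x (s.reg y - s.reg z) }⟩
  | ⟨.load x y :: k, s⟩ =>
      PMF.pure ⟨k, { s with reg := Function.update s.reg x (s.mem (s.reg y)) }⟩
  | ⟨.store x y :: k, s⟩ =>
      PMF.pure ⟨k, { s with mem := Function.update s.mem (s.reg x) (s.reg y) }⟩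
  | ⟨.emit x y z :: k, s⟩ =>
      PMF.pure ⟨k, { s with out := s.out ++ [⟨s.reg x, s.reg y, s.reg z⟩] }⟩
  | ⟨.randVertex a :: k, s⟩ =>
      (PMF.uniformOfFintype V).map fun v =>
        ⟨k, { s with vtx := Function.update s.vtx a (some v), queries := s.queries + 1 }⟩
  | ⟨.randNeighbor a b :: k, s⟩ =>
      (neighborDist G (s.vtx b)).map fun v =>
        ⟨k, { s with vtx := Function.update s.vtx a v, queries := s.queries + 1 }⟩
  | ⟨.copyVertex a b :: k, s⟩ =>
      PMF.pure ⟨k, { s with vtx := Function.update s.vtx a (s.vtx b) }⟩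
  | ⟨.seq p q :: k, s⟩ => PMF.pure ⟨p :: q :: k, s⟩
  | ⟨.cond x p q :: k, s⟩ => PMF.pure ⟨(if s.reg x ≠ 0 then p else q) :: k, s⟩
  | ⟨.condVertex a b p q :: k, s⟩ => PMF.pure ⟨(if s.vtx a = s.vtx b then p else q) :: k, s⟩
  | ⟨.loop x p :: k, s⟩ =>
      PMF.pure ⟨if s.reg x ≠ 0 then p :: .loop x p :: k else k, s⟩

/-- The distribution of the configuration after `t` steps. -/
noncomputable def runFrom (c : Config V) : ℕ → PMF (Config V)
  | 0 => PMF.pure c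
  | t + 1 => (runFrom c t).bind (step G)

/-- The distribution of the configuration of the machine with program `P` after `t` steps, when
it is started on the given input with query access to `G`. -/
noncomputable def run (P : Prog) (input t : ℕ) : PMF (Config V) :=
  runFrom G ⟨[P], State.init V input⟩ t

end Semantics

end GraphSpectrum

namespace GraphSpectrum

/-!
The return probability of a `j`-step random walk from a uniformly random vertex is the `j`-th moment
of `1 - λ` under the spectral distribution. Smooth this distribution with the kernel
`U_k (1 - v ^ 2 / 8) ^ 4`, a polynomial of degree `8 * k` in the displacement `v` that has mean
displacement `O(1 / k)` on `[-3, 3]`. The smoothed masses are linear combinations of `8 * k + 1`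
moments with coefficients of size `exp (O(k))`, so moments known up to `4096 ^ (-k)` suffice. By
Chebyshev's inequality, `2 ^ (32 * k)` walks of each length give that precision. Summing the
smoothed masses over blocks of grid points leaves `4 * k` atoms at distance `O(1 / k)` from the
spectral distribution, and `k = 8192 * n` makes this distance at most `1 / n`.

On the machine, the kernel is evaluated by the Chebyshev recurrence, which acts on sequences of
integer moments. The program is written in a language of structured commands, and a compiler takes
it to machine programs that do at least as well for weakest pre-expectations.
-/

/-! ### Runs of the machine -/

section Expect

variable {α β : Type*}

/-- The expectation of a nonnegative function. -/
noncomputable def expect (p : PMF α) (f : α → ℝ≥0∞) : ℝ≥0∞ := ∑' a, p a * f a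

theorem expect_pure (a : α) (f : α → ℝ≥0∞) : expect (PMF.pure a) f = f a := by
  classical
  rw [expect, tsum_eq_single a]
  · simp
  · intro b hb
    simp [PMF.pure_apply, hb]

theorem expect_bind (p : PMF α) (q : α → PMF β) (f : β → ℝ≥0∞) :
    expect (p.bind q) f = expect p fun a => expect (q a) f := by
  simp only [expect, PMF.bind_apply, ← ENNReal.tsum_mul_right, ← ENNReal.tsum_mul_left]
  rw [ENNReal.tsum_comm]
  simp only [mul_assoc]

theorem expect_map (p : PMF α) (φ : α → β) (f : β → ℝ≥0∞) :
    expect (p.map φ) f = expect p (f ∘ φ) := by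
  simp only [PMF.map, expect_bind, Function.comp_apply, expect_pure]
  rfl

theorem expect_mono {p : PMF α} {f g : α → ℝ≥0∞} (h : ∀ a ∈ p.support, f a ≤ g a) :
    expect p f ≤ expect p g := by
  refine ENNReal.tsum_le_tsum fun a => ?_
  by_cases ha : p a = 0
  · simp [ha]
  · exact mul_le_mul_right (h a ((PMF.mem_support_iff _ _).2 ha)) _

theorem expect_const (p : PMF α) (c : ℝ≥0∞) : expect p (fun _ => c) = c := by
  rw [expect, ENNReal.tsum_mul_right, p.tsum_coe, one_mul]

theorem le_expect {p : PMF α} {f : α → ℝ≥0∞} {c : ℝ≥0∞} (h : ∀ a, c ≤ f a) :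
    c ≤ expect p f :=
  (expect_const p c).symm.le.trans (expect_mono fun a _ => h a)

theorem expect_add (p : PMF α) (f g : α → ℝ≥0∞) :
    expect p (fun a => f a + g a) = expect p f + expect p g := by
  simp only [expect, mul_add, ENNReal.tsum_add]

open Classical in
theorem toOuterMeasure_eq_expect (p : PMF α) (s : Set α) :
    p.toOuterMeasure s = expect p (fun a => if a ∈ s then 1 else 0) := by
  rw [PMF.toOuterMeasure_apply, expect]
  refine tsum_congr fun a => ?_
  by_cases h : a ∈ s <;> simp [h]

end Expect

/-- The state with other contents of the registers. -/
def State.withReg {V : Type*} (s : State V) (ρ : ℕ → ℕ) : State V := { s with reg := ρ }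

/-- The state with other contents of the memory. -/
def State.withMem {V : Type*} (s : State V) (m : ℕ → ℕ) : State V := { s with mem := m }

section HaltValue

variable {V : Type*} [Fintype V] [DecidableEq V] [Nonempty V]
  (G : SimpleGraph V) [DecidableRel G.Adj]

/-- A function of states as a function of configurations, vanishing unless the machine has
halted. -/
def haltWeight {V : Type*} (g : State V → ℝ≥0∞) : Config V → ℝ≥0∞
  | ⟨[], s⟩ => g s
  | ⟨_ :: _, _⟩ => 0

/-- The expectation of `g` at the final state, over the runs that halt within `T` steps. -/
noncomputable def haltValue (g : State V → ℝ≥0∞) (c : Config V) (T : ℕ) : ℝ≥0∞ :=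
  expect (runFrom G c T) (haltWeight g)

theorem runFrom_succ' (c : Config V) (T : ℕ) :
    runFrom G c (T + 1) = (step G c).bind fun c' => runFrom G c' T := by
  induction T with
  | zero => simp [runFrom]
  | succ T ih =>
    rw [runFrom, ih, PMF.bind_bind]
    rfl

theorem haltValue_zero (g : State V → ℝ≥0∞) (c : Config V) :
    haltValue G g c 0 = haltWeight g c := by
  rw [haltValue, runFrom, expect_pure]

theorem haltValue_succ (g : State V → ℝ≥0∞) (c : Config V) (T : ℕ) :
    haltValue G g c (T + 1) = expect (step G c) fun c' => haltValue G g c' T := by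
  rw [haltValue, runFrom_succ', expect_bind]
  rfl

theorem haltValue_succ_of_step {c c' : Config V} (h : step G c = PMF.pure c')
    (g : State V → ℝ≥0∞) (T : ℕ) : haltValue G g c (T + 1) = haltValue G g c' T := by
  rw [haltValue_succ, h, expect_pure]

theorem haltValue_mono (g : State V → ℝ≥0∞) (c : Config V) : Monotone (haltValue G g c) := by
  refine monotone_nat_of_le_succ fun T => ?_
  rw [haltValue, haltValue, runFrom, expect_bind]
  refine expect_mono fun c' _ => ?_
  rcases c' with ⟨_ | ⟨p, k⟩, s⟩
  · simp [step, expect_pure]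
  · simp [haltWeight]

/-- The program `p` leads from the state `s` to the state `s'` within `t` steps. It is stated in
terms of what the runs yield when some continuation is executed after `p`. -/
structure Leads (p : Prog) (t : ℕ) (s s' : State V) : Prop where
  haltValue_le : ∀ g k T, haltValue G g ⟨k, s'⟩ T ≤ haltValue G g ⟨p :: k, s⟩ (T + t)

variable {G}

theorem Leads.of_step {p : Prog} {s s' : State V}
    (h : ∀ k, step G ⟨p :: k, s⟩ = PMF.pure ⟨k, s'⟩) : Leads G p 1 s s' where
  haltValue_le g k T := by rw [haltValue_succ_of_step G (h k)]

theorem Leads.mono {p : Prog} {t u : ℕ} {s s' : State V} (h : Leads G p t s s') (htu : t ≤ u) :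
    Leads G p u s s' where
  haltValue_le g k T :=
    (h.haltValue_le g k T).trans (haltValue_mono G g _ (Nat.add_le_add_left htu T))

theorem Leads.seq {p q : Prog} {t u : ℕ} {s₁ s₂ s₃ : State V} (hp : Leads G p t s₁ s₂)
    (hq : Leads G q u s₂ s₃) : Leads G (.seq p q) (t + u + 1) s₁ s₃ where
  haltValue_le g k T := by
    rw [← add_assoc, haltValue_succ_of_step G (c' := ⟨p :: q :: k, s₁⟩) rfl, add_comm t,
      ← add_assoc]
    exact (hq.haltValue_le g k T).trans (hp.haltValue_le g (q :: k) (T + u))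

theorem Leads.const {x c : ℕ} {s : State V} {ρ : ℕ → ℕ} :
    Leads G (.const x c) 1 (s.withReg ρ) (s.withReg (Function.update ρ x c)) :=
  .of_step fun _ => rfl

theorem Leads.add {x y z : ℕ} {s : State V} {ρ : ℕ → ℕ} :
    Leads G (.add x y z) 1 (s.withReg ρ) (s.withReg (Function.update ρ x (ρ y + ρ z))) :=
  .of_step fun _ => rfl

theorem Leads.sub {x y z : ℕ} {s : State V} {ρ : ℕ → ℕ} :
    Leads G (.sub x y z) 1 (s.withReg ρ) (s.withReg (Function.update ρ x (ρ y - ρ z))) :=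
  .of_step fun _ => rfl

theorem Leads.load {x y : ℕ} {s : State V} {ρ : ℕ → ℕ} :
    Leads G (.load x y) 1 (s.withReg ρ) (s.withReg (Function.update ρ x (s.mem (ρ y)))) :=
  .of_step fun _ => rfl

theorem Leads.store {x y : ℕ} {s : State V} {ρ m : ℕ → ℕ} :
    Leads G (.store x y) 1 ((s.withMem m).withReg ρ)
      ((s.withMem (Function.update m (ρ x) (ρ y))).withReg ρ) :=
  .of_step fun _ => rfl

theorem Leads.emit {x y z : ℕ} {s : State V} :
    Leads G (.emit x y z) 1 s { s with out := s.out ++ [⟨s.reg x, s.reg y, s.reg z⟩] } :=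
  .of_step fun _ => rfl

end HaltValue

/-! ### A structured language and its compiler -/

section Language

/-- The integer variables of the source language. The machine receives its input in register `0`,
the first register of the first variable. -/
inductive Var
  | input | order | block | scale | len | hits | index | grid | offset | mass
  | coeff₀ | coeff₁ | coeff₂ | coeff₃ | pos | next
  deriving DecidableEq

/-- The integer arrays of the source language. -/
inductive Arr
  | moments | cur | prev
  deriving DecidableEq

/-- Integer expressions of the source language; `pos e` is the positive part of `e`, and
`read a e` the entry of the array `a` at the positive part of `e`. -/
inductive Expr
  | const (c : ℕ)
  | var (x : Var)
  | read (a : Arr) (e : Expr)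
  | add (e f : Expr)
  | sub (e f : Expr)
  | pos (e : Expr)

instance : Coe Var Expr := ⟨.var⟩

instance (c : ℕ) : OfNat Expr c := ⟨.const c⟩

instance : Add Expr := ⟨.add⟩

instance : Sub Expr := ⟨.sub⟩

/-- The multiple of an expression by a numeral, as an iterated sum. -/
def Expr.nsmul : ℕ → Expr → Expr
  | 0, _ => 0
  | n + 1, e => nsmul n e + e

instance : SMul ℕ Expr := ⟨.nsmul⟩

/-- Commands of the source language. There are two vertices: `pick` fills the first one by a
vertex query, `restart` copies it to the second one, `move` replaces the second one by a random
neighbour, and `ifReturned c` executes `c` if both coincide. In `rep e c` the number of repetitions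
is the value of `e` at the beginning. -/
inductive Cmd
  | assign (x : Var) (e : Expr)
  | store (a : Arr) (i e : Expr)
  | emit (num den mass : Expr)
  | pick
  | restart
  | move
  | ifReturned (c : Cmd)
  | seq (c d : Cmd)
  | rep (e : Expr) (c : Cmd)

infixr:60 " ;; " => Cmd.seq

infix:62 " ::= " => Cmd.assign

/-- The states of the source language. -/
structure Store (V : Type*) where
  var : Var → ℤ
  arr : Arr → ℕ → ℤ
  start : Option V
  current : Option V
  out : List Atom

variable {V : Type*}

/-- The value of an expression. -/
def Expr.eval (h : Store V) : Expr → ℤ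
  | .const c => c
  | .var x => h.var x
  | .read a e => h.arr a (e.eval h).toNat
  | .add e f => e.eval h + f.eval h
  | .sub e f => e.eval h - f.eval h
  | .pos e => max (e.eval h) 0

@[simp]
theorem eval_ofNat (h : Store V) (c : ℕ) : Expr.eval h ofNat(c) = OfNat.ofNat c := rfl

@[simp]
theorem eval_var (h : Store V) (x : Var) : Expr.eval h x = h.var x := rfl

@[simp]
theorem eval_add (h : Store V) (e f : Expr) : (e + f).eval h = e.eval h + f.eval h := rfl

@[simp]
theorem eval_sub (h : Store V) (e f : Expr) : (e - f).eval h = e.eval h - f.eval h := rfl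

@[simp]
theorem eval_pos (h : Store V) (e : Expr) : (Expr.pos e).eval h = max (e.eval h) 0 := rfl

@[simp]
theorem eval_nsmul (h : Store V) (n : ℕ) (e : Expr) : (n • e).eval h = n * e.eval h := by
  induction n with
  | zero => rw [Nat.cast_zero, zero_mul]; rfl
  | succ n ih =>
    rw [Nat.cast_succ, add_one_mul, ← ih]
    rfl

/-- The state after setting the variable `x` to `v`. -/
def Store.setVar (h : Store V) (x : Var) (v : ℤ) : Store V :=
  { h with var := Function.update h.var x v }

/-- The state after setting the entry `j` of the array `a` to `v`. -/
def Store.setArr (h : Store V) (a : Arr) (j : ℕ) (v : ℤ) : Store V :=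
  { h with arr := Function.update h.arr a (Function.update (h.arr a) j v) }

/-- The atom produced by `emit`. -/
def Store.atom (h : Store V) (num den mass : Expr) : Atom :=
  ⟨(num.eval h).toNat, (den.eval h).toNat, (mass.eval h).toNat⟩

section Wp

variable [Fintype V] [DecidableEq V] [Nonempty V] (G : SimpleGraph V) [DecidableRel G.Adj] (K : ℕ)

/-- The weakest pre-expectation: `wp G K c Φ h` is the expectation of `Φ` at the end of the
execution of `c` from `h`, where executions in which some loop is repeated more than `K` times
contribute `0`. -/
noncomputable def wp : Cmd → (Store V → ℝ≥0∞) → Store V → ℝ≥0∞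
  | .assign x e, Φ, h => Φ (h.setVar x (e.eval h))
  | .store a i e, Φ, h => Φ (h.setArr a (i.eval h).toNat (e.eval h))
  | .emit num den mass, Φ, h => Φ { h with out := h.out ++ [h.atom num den mass] }
  | .pick, Φ, h => expect (PMF.uniformOfFintype V) fun v => Φ { h with start := some v }
  | .restart, Φ, h => Φ { h with current := h.start }
  | .move, Φ, h => expect (neighborDist G h.current) fun v => Φ { h with current := v }
  | .ifReturned c, Φ, h => if h.current = h.start then wp c Φ h else Φ h
  | .seq c d, Φ, h => wp c (wp d Φ) h
  | .rep e c, Φ, h =>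
    if (e.eval h).toNat ≤ K then (wp c)^[(e.eval h).toNat] Φ h else 0

end Wp

end Language

section Compiler

/-- The first of the two registers of a variable. The value of the variable is their difference;
the registers from `32` on are scratch space. -/
def Var.reg (x : Var) : ℕ := 2 * x.ctorIdx

/-- The first of the two memory cells of an array entry. -/
def Arr.cell (a : Arr) (j : ℕ) : ℕ := 8 * j + 2 * a.ctorIdx

theorem Var.reg_lt (x : Var) : x.reg + 1 < 32 := by
  cases x <;> decide

theorem Var.eq_of_ctorIdx_eq {x y : Var} (h : x.ctorIdx = y.ctorIdx) : x = y := by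
  cases x <;> cases y <;> first | rfl | cases h

theorem Arr.ctorIdx_lt (a : Arr) : a.ctorIdx < 4 := by
  cases a <;> decide

theorem Arr.eq_of_ctorIdx_eq {a b : Arr} (h : a.ctorIdx = b.ctorIdx) : a = b := by
  cases a <;> cases b <;> first | rfl | cases h

/-- Replaces the register `d`, which contains an index, by the first cell of the entry of `a`. -/
def Arr.locate (a : Arr) (d : ℕ) : Prog :=
  .seq (.add d d d) <| .seq (.add d d d) <| .seq (.add d d d) <|
    .seq (.const (d + 1) (2 * a.ctorIdx)) <| .add d d (d + 1)

/-- Loads the value stored at the index given by the difference of the registers `d` and `d + 1`. -/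
def Arr.fetch (a : Arr) (d : ℕ) : Prog :=
  .seq (.sub d d (d + 1)) <| .seq (a.locate d) <| .seq (.const (d + 1) 1) <|
    .seq (.add (d + 1) d (d + 1)) <| .seq (.load d d) <| .load (d + 1) (d + 1)

/-- Evaluates an expression to the difference of the registers `d` and `d + 1`, using only the
registers from `d` on. -/
def Expr.prog : Expr → ℕ → Prog
  | .const c, d => .seq (.const d c) (.const (d + 1) 0)
  | .var x, d => .seq (.sub d x.reg (x.reg + 1)) (.sub (d + 1) (x.reg + 1) x.reg)
  | .read a e, d => .seq (e.prog d) (a.fetch d)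
  | .add e f, d => .seq (e.prog d) <| .seq (f.prog (d + 2)) <|
      .seq (.add d d (d + 2)) (.add (d + 1) (d + 1) (d + 3))
  | .sub e f, d => .seq (e.prog d) <| .seq (f.prog (d + 2)) <|
      .seq (.add d d (d + 3)) (.add (d + 1) (d + 1) (d + 2))
  | .pos e, d => .seq (e.prog d) <| .seq (.sub d d (d + 1)) (.const (d + 1) 0)

/-- Evaluates the positive part of an expression to the register `d`. -/
def Expr.progNat (e : Expr) (d : ℕ) : Prog := .seq (e.prog d) (.sub d d (d + 1))

/-- The machine program that repeats `p`, with register `d` as a countdown. -/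
def countdown (d : ℕ) (p : Prog) : Prog :=
  .loop d (.seq p <| .seq (.const (d + 1) 1) (.sub d d (d + 1)))

/-- The machine program of a command; it uses only the scratch registers from `d` on. -/
def Cmd.prog : Cmd → ℕ → Prog
  | .assign x e, d => .seq (e.prog d) <| .seq (.sub x.reg d (d + 1)) (.sub (x.reg + 1) (d + 1) d)
  | .store a i e, d => .seq (i.progNat d) <| .seq (e.prog (d + 2)) <| .seq (a.locate d) <|
      .seq (.store d (d + 2)) <| .seq (.const (d + 1) 1) <| .seq (.add d d (d + 1)) <|
      .store d (d + 3)
  | .emit num den mass, d => .seq (num.progNat d) <| .seq (den.progNat (d + 1)) <|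
      .seq (mass.progNat (d + 2)) <| .emit d (d + 1) (d + 2)
  | .pick, _ => .randVertex 0
  | .restart, _ => .copyVertex 1 0
  | .move, _ => .randNeighbor 1 1
  | .ifReturned c, d => .condVertex 1 0 (c.prog d) (.const d 0)
  | .seq c e, d => .seq (c.prog d) (e.prog d)
  | .rep e c, d => .seq (e.progNat d) (countdown d (c.prog (d + 2)))

/-- The number of steps of the evaluation of an expression. -/
def Expr.cost : Expr → ℕ
  | .const _ | .var _ => 3
  | .read _ e => e.cost + 20
  | .add e f | .sub e f => e.cost + f.cost + 5
  | .pos e => e.cost + 4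

/-- A bound for the number of steps of a command if no loop is repeated more than `K` times. -/
def Cmd.cost (K : ℕ) : Cmd → ℕ
  | .assign _ e => e.cost + 4
  | .store _ i e => i.cost + e.cost + 22
  | .emit num den mass => num.cost + den.cost + mass.cost + 10
  | .pick | .restart | .move => 1
  | .ifReturned c => c.cost K + 2
  | .seq c e => c.cost K + e.cost K + 1
  | .rep e c => e.cost + K * (c.cost K + 6) + 4

theorem Cmd.exists_cost_le (c : Cmd) : ∃ a m : ℕ, ∀ K, c.cost K ≤ a * (K + 1) ^ m := by
  induction c with
  | ifReturned c ih =>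
    obtain ⟨a, m, h⟩ := ih
    refine ⟨a + 2, m, fun K => ?_⟩
    have := Nat.one_le_pow m (K + 1) K.succ_pos
    simp only [Cmd.cost]
    linarith [h K]
  | seq c d hc hd =>
    obtain ⟨a, m, h⟩ := hc
    obtain ⟨b, n, h'⟩ := hd
    refine ⟨a + b + 1, m + n, fun K => ?_⟩
    have hm := Nat.one_le_pow m (K + 1) K.succ_pos
    have hn := Nat.one_le_pow n (K + 1) K.succ_pos
    simp only [Cmd.cost, pow_add]
    nlinarith [h K, h' K, Nat.mul_le_mul_left (a * (K + 1) ^ m) hn,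
      Nat.mul_le_mul_right (b * (K + 1) ^ n) hm, Nat.mul_le_mul hm hn]
  | rep e c ih =>
    obtain ⟨a, m, h⟩ := ih
    refine ⟨e.cost + a + 10, m + 1, fun K => ?_⟩
    have hm := Nat.one_le_pow (m + 1) (K + 1) K.succ_pos
    calc (Cmd.rep e c).cost K ≤ e.cost + (K + 1) * (a * (K + 1) ^ m + 6) + 4 := by
          have : K * (c.cost K + 6) ≤ (K + 1) * (a * (K + 1) ^ m + 6) :=
            Nat.mul_le_mul K.le_succ (Nat.add_le_add_right (h K) 6)
          simp only [Cmd.cost]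
          omega
      _ = e.cost + a * (K + 1) ^ (m + 1) + 6 * (K + 1) + 4 := by ring
      _ ≤ (e.cost + a + 10) * (K + 1) ^ (m + 1) := by
          have : K + 1 ≤ (K + 1) ^ (m + 1) := Nat.le_self_pow m.succ_ne_zero _
          nlinarith [Nat.mul_le_mul_left e.cost hm]
  | _ => exact ⟨_, 0, fun K => by rw [pow_zero, mul_one, Cmd.cost]⟩

end Compiler

section Soundness

variable {V : Type*}

/-- A machine state represents a state of the source language, with integers as differences of
adjacent registers or memory cells. -/
structure State.Represents (s : State V) (h : Store V) : Prop where
  var : ∀ x : Var, (s.reg x.reg : ℤ) - s.reg (x.reg + 1) = h.var x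
  arr : ∀ (a : Arr) (j : ℕ), (s.mem (a.cell j) : ℤ) - s.mem (a.cell j + 1) = h.arr a j
  start : s.vtx 0 = h.start
  current : s.vtx 1 = h.current
  out : s.out = h.out

theorem State.Represents.congr_reg {s : State V} {h : Store V} {ρ σ : ℕ → ℕ} {d : ℕ}
    (hs : (s.withReg ρ).Represents h) (hd : 32 ≤ d) (hσ : ∀ r < d, σ r = ρ r) :
    (s.withReg σ).Represents h :=
  { hs with
    var := fun x => by
      have := x.reg_lt
      change (σ x.reg : ℤ) - σ (x.reg + 1) = _
      rw [← hs.var x, hσ _ (by omega), hσ _ (by omega)]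
      rfl }

theorem State.Represents.setVar {s : State V} {h : Store V} {ρ : ℕ → ℕ}
    (hs : (s.withReg ρ).Represents h) (x : Var) {v : ℤ} {p n : ℕ} (hv : (p : ℤ) - n = v) :
    (s.withReg (Function.update (Function.update ρ x.reg p) (x.reg + 1) n)).Represents
      (h.setVar x v) :=
  { hs with
    var := fun y => by
      rcases eq_or_ne y x with rfl | hyx
      · simp [Store.setVar, State.withReg, hv]
      · have : y.ctorIdx ≠ x.ctorIdx := fun h => hyx (Var.eq_of_ctorIdx_eq h)
        have h₀ := hs.var y
        simp only [Var.reg, State.withReg, Store.setVar, Function.update_of_ne hyx] at h₀ ⊢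
        rw [Function.update_of_ne (by omega), Function.update_of_ne (by omega),
          Function.update_of_ne (by omega), Function.update_of_ne (by omega), h₀] }

theorem State.Represents.setArr {s : State V} {h : Store V} {m : ℕ → ℕ}
    (hs : (s.withMem m).Represents h) (a : Arr) (j : ℕ) {v : ℤ} {p n : ℕ} (hv : (p : ℤ) - n = v) :
    (s.withMem (Function.update (Function.update m (a.cell j) p) (a.cell j + 1) n)).Represents
      (h.setArr a j v) :=
  { hs with
    arr := fun b i => by
      by_cases hab : a = b ∧ j = i
      · obtain ⟨rfl, rfl⟩ := hab
        simp [Store.setArr, State.withMem, hv]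
      · have hne : a.cell j ≠ b.cell i ∧ a.cell j ≠ b.cell i + 1 ∧ a.cell j + 1 ≠ b.cell i := by
          have ha := a.ctorIdx_lt
          have hb := b.ctorIdx_lt
          have : ¬(a.ctorIdx = b.ctorIdx ∧ j = i) := fun h =>
            hab ⟨Arr.eq_of_ctorIdx_eq h.1, h.2⟩
          simp only [Arr.cell]
          omega
        have : (h.setArr a j v).arr b i = h.arr b i := by
          clear hne
          rcases eq_or_ne b a with rfl | hba
          · simp [Store.setArr, Ne.symm (show j ≠ i by tauto)]
          · simp [Store.setArr, hba]
        rw [this, ← hs.arr b i]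
        simp only [State.withMem, Function.update_apply]
        rw [if_neg (by omega), if_neg (by omega), if_neg (by omega), if_neg (by omega)] }

variable [Fintype V] [DecidableEq V] [Nonempty V] {G : SimpleGraph V} [DecidableRel G.Adj]

theorem Arr.locate_leads (a : Arr) (d : ℕ) (s : State V) (ρ : ℕ → ℕ) :
    ∃ σ : ℕ → ℕ, Leads G (a.locate d) 9 (s.withReg ρ) (s.withReg σ) ∧
      (∀ r, r ≠ d → r ≠ d + 1 → σ r = ρ r) ∧ σ d = a.cell (ρ d) := by
  refine ⟨_, Leads.add.seq <| Leads.add.seq <| Leads.add.seq <| Leads.const.seq Leads.add,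
    fun r h₀ h₁ => ?_, ?_⟩
  · simp [h₀, h₁]
  · simp only [Function.update_self, Function.update_idem, ne_eq, Nat.left_eq_add, one_ne_zero,
      not_false_eq_true, Function.update_of_ne, Arr.cell]
    ring

theorem Arr.fetch_leads (a : Arr) (d : ℕ) {s : State V} {ρ : ℕ → ℕ} {h : Store V}
    (hs : (s.withReg ρ).Represents h) (σ : ℕ → ℕ) :
    ∃ τ : ℕ → ℕ, Leads G (a.fetch d) 19 (s.withReg σ) (s.withReg τ) ∧
      (∀ r, r ≠ d → r ≠ d + 1 → τ r = σ r) ∧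
      (τ d : ℤ) - τ (d + 1) = h.arr a (σ d - σ (d + 1)) := by
  obtain ⟨τ, hτ, hne, hcell⟩ := a.locate_leads (G := G) d s (Function.update σ d (σ d - σ (d + 1)))
  refine ⟨_, Leads.sub.seq <| hτ.seq <| Leads.const.seq <| Leads.add.seq <|
    Leads.load.seq Leads.load, fun r h₀ h₁ => ?_, ?_⟩
  · simp [h₀, h₁, hne r h₀ h₁]
  · simp [hcell, ← hs.arr a, State.withReg]

theorem Expr.prog_leads (e : Expr) {s : State V} {ρ : ℕ → ℕ} {h : Store V}
    (hs : (s.withReg ρ).Represents h) {d : ℕ} (hd : 32 ≤ d) :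
    ∃ σ : ℕ → ℕ, Leads G (e.prog d) e.cost (s.withReg ρ) (s.withReg σ) ∧
      (∀ r < d, σ r = ρ r) ∧ (σ d : ℤ) - σ (d + 1) = e.eval h := by
  induction e generalizing ρ d with
  | const c =>
    refine ⟨_, Leads.const.seq Leads.const, fun r hr => ?_, by simp [Expr.eval]⟩
    simp [hr.ne, (show r ≠ d + 1 by omega)]
  | var x =>
    have hx := x.reg_lt
    refine ⟨_, Leads.sub.seq Leads.sub, fun r hr => ?_, ?_⟩
    · simp [hr.ne, (show r ≠ d + 1 by omega)]
    · simp only [Expr.eval, ← hs.var x, Function.update_self, Function.update_apply, State.withReg]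
      rw [if_neg (by omega), if_neg (by omega), if_neg (by omega)]
      omega
  | read a e ih =>
    simp only [Expr.prog, Expr.cost]
    obtain ⟨σ, hσ, hlt, hv⟩ := ih hs hd
    obtain ⟨τ, hτ, hne, harr⟩ := a.fetch_leads (G := G) d hs σ
    refine ⟨τ, hσ.seq hτ, fun r hr => (hne r hr.ne (by omega)).trans (hlt r hr), ?_⟩
    rw [harr, show σ d - σ (d + 1) = (e.eval h).toNat by omega]
    rfl
  | add e f he hf | sub e f he hf =>
    simp only [Expr.prog, Expr.cost]
    obtain ⟨σ, hσ, hlt, hv⟩ := he hs hd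
    obtain ⟨τ, hτ, hlt', hv'⟩ := hf (hs.congr_reg hd hlt) (d := d + 2) (by omega)
    refine ⟨_, (hσ.seq <| hτ.seq <| Leads.add.seq Leads.add).mono (by omega), fun r hr => ?_, ?_⟩
    · simp [hr.ne, (show r ≠ d + 1 by omega), (hlt' r (by omega)).trans (hlt r hr)]
    · simp only [hlt' d (by omega), ne_eq, Nat.add_eq_left, one_ne_zero, not_false_eq_true,
        Function.update_of_ne, hlt' (d + 1) (by omega), OfNat.ofNat_ne_zero, Nat.left_eq_add,
        Function.update_self, Nat.cast_add, Expr.eval, ← hv, ← hv']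
      ring
  | pos e ih =>
    simp only [Expr.prog, Expr.cost]
    obtain ⟨σ, hσ, hlt, hv⟩ := ih hs hd
    refine ⟨_, (hσ.seq <| Leads.sub.seq Leads.const).mono (by omega),
      fun r hr => ?_, ?_⟩
    · simp [hr.ne, (show r ≠ d + 1 by omega), hlt r hr]
    · simp only [ne_eq, Nat.left_eq_add, one_ne_zero, not_false_eq_true, Function.update_of_ne,
        Function.update_self, CharP.cast_eq_zero, sub_zero, Expr.eval, ← hv]
      omega

theorem Expr.progNat_leads (e : Expr) {s : State V} {ρ : ℕ → ℕ} {h : Store V}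
    (hs : (s.withReg ρ).Represents h) {d : ℕ} (hd : 32 ≤ d) :
    ∃ σ : ℕ → ℕ, Leads G (e.progNat d) (e.cost + 2) (s.withReg ρ) (s.withReg σ) ∧
      (∀ r < d, σ r = ρ r) ∧ σ d = (e.eval h).toNat := by
  obtain ⟨σ, hσ, hlt, hv⟩ := e.prog_leads (G := G) hs hd
  refine ⟨_, hσ.seq Leads.sub, fun r hr => ?_, ?_⟩
  · simp [hr.ne, hlt r hr]
  · simp [← hv]

end Soundness

section Simulation

variable {V : Type*} [Fintype V] [DecidableEq V] [Nonempty V]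
  (G : SimpleGraph V) [DecidableRel G.Adj]

/-- Within `t` steps and without changing the scratch registers below `d`, the machine program `p`
does what a piece of the source language with pre-expectation transformer `F` does. -/
structure Simulates (d : ℕ) (p : Prog) (t : ℕ) (F : (Store V → ℝ≥0∞) → Store V → ℝ≥0∞) :
    Prop where
  le_haltValue : ∀ (g : State V → ℝ≥0∞) (k : List Prog) (T : ℕ) (Φ : Store V → ℝ≥0∞) (h : Store V)
    (s : State V), s.Represents h →
    (∀ h' s', s'.Represents h' → (∀ r, 32 ≤ r → r < d → s'.reg r = s.reg r) →
      Φ h' ≤ haltValue G g ⟨k, s'⟩ T) →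
    F Φ h ≤ haltValue G g ⟨p :: k, s⟩ (T + t)

variable {G} {d t u : ℕ} {p q : Prog} {E F : (Store V → ℝ≥0∞) → Store V → ℝ≥0∞}

theorem Simulates.of_leads {f : Store V → Store V}
    (hp : ∀ h s, s.Represents h → ∃ s', Leads G p t s s' ∧ s'.Represents (f h) ∧
      ∀ r, 32 ≤ r → r < d → s'.reg r = s.reg r) :
    Simulates G d p t fun Φ h => Φ (f h) where
  le_haltValue g k T Φ h s hs hΦ := by
    obtain ⟨s', hlead, hs', hreg⟩ := hp h s hs
    exact (hΦ _ _ hs' hreg).trans (hlead.haltValue_le g k T)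

theorem Simulates.seq (hp : Simulates G d p t E) (hq : Simulates G d q u F) :
    Simulates G d (.seq p q) (t + u + 1) fun Φ => E (F Φ) where
  le_haltValue g k T Φ h s hs hΦ := by
    rw [add_comm t, ← add_assoc, ← add_assoc,
      haltValue_succ_of_step G (c' := ⟨p :: q :: k, s⟩) rfl]
    refine hp.le_haltValue g (q :: k) (T + u) (F Φ) h s hs fun h' s' hs' hreg => ?_
    exact hq.le_haltValue g k T Φ h' s' hs' fun h'' s'' hs'' hreg' =>
      hΦ h'' s'' hs'' fun r hr hrd => (hreg' r hr hrd).trans (hreg r hr hrd)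

theorem Simulates.iterate (hp : Simulates G (d + 2) p t F) (hd : 32 ≤ d) {g : State V → ℝ≥0∞}
    {k : List Prog} {T n : ℕ} {Φ : Store V → ℝ≥0∞} {h : Store V} {s : State V} (hs : s.Represents h)
    (hn : s.reg d = n) (hΦ : ∀ h' s', s'.Represents h' →
      (∀ r, 32 ≤ r → r < d → s'.reg r = s.reg r) → Φ h' ≤ haltValue G g ⟨k, s'⟩ T) :
    F^[n] Φ h ≤ haltValue G g ⟨countdown d p :: k, s⟩ (T + n * (t + 6) + 1) := by
  induction n generalizing h s with
  | zero =>
    rw [haltValue_succ_of_step G (c' := ⟨k, s⟩) (by simp [countdown, step, hn])]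
    simpa using hΦ h s hs fun _ _ _ => rfl
  | succ n ih =>
    set decr : Prog := .seq (.const (d + 1) 1) (.sub d d (d + 1)) with hdecr
    rw [Function.iterate_succ_apply',
      show T + (n + 1) * (t + 6) + 1 = T + n * (t + 6) + 1 + 3 + 1 + t + 1 + 1 by ring,
      haltValue_succ_of_step G (c' := ⟨.seq p decr :: countdown d p :: k, s⟩)
        (by simp [countdown, step, hn, hdecr]),
      haltValue_succ_of_step G (c' := ⟨p :: decr :: countdown d p :: k, s⟩) rfl]
    refine hp.le_haltValue g _ _ _ h s hs fun h' s' hs' hreg => ?_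
    have hlead : Leads G decr 3 s' _ := (Leads.const (ρ := s'.reg)).seq Leads.sub
    refine le_trans (ih (State.Represents.congr_reg (ρ := s'.reg) hs' hd fun r hr => ?_) ?_
      fun h'' s'' hs'' hreg' => hΦ h'' s'' hs'' fun r hr hrd => ?_)
        ((hlead.haltValue_le g _ _).trans (haltValue_mono G g _ (by omega)))
    · simp [hr.ne, (show r ≠ d + 1 by omega)]
    · simp [State.withReg, hreg d hd (by omega), hn]
    · rw [hreg' r hr hrd, ← hreg r hr (by omega)]
      simp [State.withReg, hrd.ne, (show r ≠ d + 1 by omega)]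

theorem Simulates.assign (x : Var) (e : Expr) (hd : 32 ≤ d) :
    Simulates G d ((x ::= e).prog d) (e.cost + 4) fun Φ h => Φ (h.setVar x (e.eval h)) :=
  .of_leads fun h s hs => by
    have hx := x.reg_lt
    obtain ⟨σ, hσ, hlt, hv⟩ := e.prog_leads (G := G) (ρ := s.reg) hs hd
    refine ⟨_, hσ.seq (Leads.sub.seq Leads.sub),
      (State.Represents.congr_reg (ρ := s.reg) hs hd hlt).setVar x ?_, fun r hr hrd => ?_⟩
    · rw [Function.update_of_ne (by omega), Function.update_of_ne (by omega)]
      omega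
    · simp [State.withReg, (show r ≠ x.reg by omega), (show r ≠ x.reg + 1 by omega), hlt r hrd]

theorem Simulates.store (a : Arr) (i e : Expr) (hd : 32 ≤ d) :
    Simulates G d ((Cmd.store a i e).prog d) (i.cost + e.cost + 22)
      fun Φ h => Φ (h.setArr a (i.eval h).toNat (e.eval h)) :=
  .of_leads fun h s hs => by
    obtain ⟨σ, hσ, hlt, hi⟩ := i.progNat_leads (G := G) (ρ := s.reg) hs hd
    obtain ⟨τ, hτ, hlt', hv⟩ := e.prog_leads (G := G)
      (State.Represents.congr_reg (ρ := s.reg) hs hd hlt) (d := d + 2) (by omega)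
    obtain ⟨υ, hυ, hne, hcell⟩ := a.locate_leads (G := G) d s τ
    have hreg : ∀ r < d, υ r = s.reg r := fun r hr =>
      (hne r hr.ne (by omega)).trans ((hlt' r (by omega)).trans (hlt r hr))
    refine ⟨_, (hσ.seq <| hτ.seq <| hυ.seq <| (Leads.store (s := s) (m := s.mem)).seq <|
      Leads.const.seq <| Leads.add.seq Leads.store).mono (by omega), ?_, fun r _ hrd => ?_⟩
    · have hs' := State.Represents.congr_reg (ρ := s.reg) hs hd hreg
      have hd₀ : υ d = a.cell (i.eval h).toNat := by
        rw [hcell, hlt' d (by omega), hi]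
      have hval : (υ (d + 2) : ℤ) - υ (d + 3) = e.eval h := by
        rw [hne _ (by omega) (by omega), hne _ (by omega) (by omega)]
        exact hv
      refine State.Represents.congr_reg (ρ := υ) ?_ hd fun r hr => ?_
      · have := State.Represents.setArr (s := s.withReg υ) (m := s.mem) hs' a (i.eval h).toNat hval
        simpa [hd₀] using! this
      · simp [hr.ne, (show r ≠ d + 1 by omega)]
    · simp [State.withReg, hrd.ne, (show r ≠ d + 1 by omega), hreg r hrd]

theorem Simulates.emit (num den mass : Expr) (hd : 32 ≤ d) :
    Simulates G d ((Cmd.emit num den mass).prog d) (num.cost + den.cost + mass.cost + 10)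
      fun Φ h => Φ { h with out := h.out ++ [h.atom num den mass] } :=
  .of_leads fun h s hs => by
    obtain ⟨σ, hσ, hlt₁, hnum⟩ := num.progNat_leads (G := G) (ρ := s.reg) hs hd
    obtain ⟨τ, hτ, hlt₂, hden⟩ := den.progNat_leads (G := G)
      (State.Represents.congr_reg (ρ := s.reg) hs hd hlt₁) (d := d + 1) (by omega)
    have hτs : ∀ r < d, τ r = s.reg r := fun r hr => (hlt₂ r (by omega)).trans (hlt₁ r hr)
    obtain ⟨υ, hυ, hlt₃, hmass⟩ := mass.progNat_leads (G := G)
      (State.Represents.congr_reg (ρ := s.reg) hs hd hτs) (d := d + 2) (by omega)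
    have hυs : ∀ r < d, υ r = s.reg r := fun r hr => (hlt₃ r (by omega)).trans (hτs r hr)
    have hs' := State.Represents.congr_reg (ρ := s.reg) hs hd hυs
    refine ⟨_, (hσ.seq <| hτ.seq <| hυ.seq Leads.emit).mono (by omega),
      { hs' with out := ?_ }, fun r _ hrd => hυs r hrd⟩
    have hd₀ : υ d = (num.eval h).toNat := by
      rw [hlt₃ d (by omega), hlt₂ d (by omega), hnum]
    have hd₁ : υ (d + 1) = (den.eval h).toNat := by
      rw [hlt₃ (d + 1) (by omega), hden]
    rw [← hs'.out, Store.atom, ← hd₀, ← hd₁, ← hmass]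
    rfl

theorem Simulates.rep {K : ℕ} {e : Expr} {c : Cmd} (hd : 32 ≤ d)
    (hc : Simulates G (d + 2) (c.prog (d + 2)) (c.cost K) (wp G K c)) :
    Simulates G d ((Cmd.rep e c).prog d) ((Cmd.rep e c).cost K) (wp G K (.rep e c)) where
  le_haltValue g k T Φ h s hs hΦ := by
    rw [wp]
    split_ifs with hK
    · obtain ⟨σ, hσ, hlt, hv⟩ := e.progNat_leads (G := G) (ρ := s.reg) hs hd
      have := hc.iterate hd (g := g) (k := k) (T := T) (Φ := Φ)
        (State.Represents.congr_reg (ρ := s.reg) hs hd hlt) hv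
        fun h' s' hs' hreg => hΦ h' s' hs' fun r hr hrd => (hreg r hr hrd).trans (hlt r hrd)
      have hcost := Nat.mul_le_mul_right (c.cost K + 6) hK
      calc (wp G K c)^[(e.eval h).toNat] Φ h
          ≤ haltValue G g ⟨e.progNat d :: countdown d (c.prog (d + 2)) :: k, s⟩ _ :=
            this.trans (hσ.haltValue_le g _ _)
        _ = haltValue G g ⟨(Cmd.rep e c).prog d :: k, s⟩ (_ + 1) :=
            (haltValue_succ_of_step G rfl g _).symm
        _ ≤ _ := haltValue_mono G g _ (by simp only [Cmd.cost]; omega)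
    · exact zero_le

theorem Cmd.simulates (c : Cmd) (K : ℕ) (hd : 32 ≤ d) :
    Simulates G d (c.prog d) (c.cost K) (wp G K c) := by
  induction c generalizing d with
  | assign x e => exact .assign x e hd
  | store a i e => exact .store a i e hd
  | emit num den mass => exact .emit num den mass hd
  | pick =>
    refine ⟨fun g k T Φ h s hs hΦ => ?_⟩
    rw [Cmd.cost, haltValue_succ, Cmd.prog, step, expect_map]
    exact expect_mono fun v _ => hΦ _ _ { hs with start := rfl } fun _ _ _ => rfl
  | restart =>
    exact .of_leads fun h s hs => ⟨_, .of_step fun _ => rfl, { hs with current := hs.start },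
      fun _ _ _ => rfl⟩
  | move =>
    refine ⟨fun g k T Φ h s hs hΦ => ?_⟩
    rw [Cmd.cost, haltValue_succ, Cmd.prog, step, expect_map, wp, hs.current]
    exact expect_mono fun v _ => hΦ _ _ { hs with current := rfl } fun _ _ _ => rfl
  | ifReturned c ih =>
    refine ⟨fun g k T Φ h s hs hΦ => ?_⟩
    rw [Cmd.cost, ← add_assoc, haltValue_succ_of_step G rfl, wp, ← hs.current, ← hs.start]
    split_ifs with hv
    · exact ((ih hd).le_haltValue g k T Φ h s hs hΦ).trans (haltValue_mono G g _ (by omega))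
    · refine (hΦ _ _ (State.Represents.congr_reg (ρ := s.reg) hs hd fun r hr => ?_)
        fun r _ hrd => ?_).trans
          ((Leads.const.haltValue_le g k T).trans (haltValue_mono G g _ (by omega)))
      · exact Function.update_of_ne hr.ne _ _
      · exact Function.update_of_ne hrd.ne _ _
  | seq c e hc he => exact (hc hd).seq (he hd)
  | rep e c ih => exact .rep hd (ih (by omega))

end Simulation

/-! ### Guarantees for the outcome of a command -/

section Frame

/-- The places a command can write to: the variables, the arrays, and the output. -/
inductive Loc
  | var (x : Var)
  | arr (a : Arr)
  | out
  deriving DecidableEq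

/-- The places a command can change. -/
def Cmd.writes : Cmd → List Loc
  | .assign x _ => [.var x]
  | .store a _ _ => [.arr a]
  | .emit _ _ _ => [.out]
  | .pick | .restart | .move => []
  | .ifReturned c | .rep _ c => c.writes
  | .seq c d => c.writes ++ d.writes

variable {V : Type*}

/-- The state `h'` differs from `h` at most in the places `l` and in the two vertices. -/
structure Store.EqOff (l : List Loc) (h h' : Store V) : Prop where
  var : ∀ x, Loc.var x ∉ l → h'.var x = h.var x
  arr : ∀ a, Loc.arr a ∉ l → h'.arr a = h.arr a
  out : Loc.out ∉ l → h'.out = h.out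

theorem Store.EqOff.refl (l : List Loc) (h : Store V) : h.EqOff l h :=
  ⟨fun _ _ => rfl, fun _ _ => rfl, fun _ => rfl⟩

theorem Store.EqOff.trans {l : List Loc} {h₁ h₂ h₃ : Store V} (h₁₂ : h₁.EqOff l h₂)
    (h₂₃ : h₂.EqOff l h₃) : h₁.EqOff l h₃ where
  var x hx := (h₂₃.var x hx).trans (h₁₂.var x hx)
  arr a ha := (h₂₃.arr a ha).trans (h₁₂.arr a ha)
  out ho := (h₂₃.out ho).trans (h₁₂.out ho)

theorem Store.EqOff.mono {l l' : List Loc} {h h' : Store V} (hh : h.EqOff l h') (hl : l ⊆ l') :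
    h.EqOff l' h' where
  var x hx := hh.var x fun hm => hx (hl hm)
  arr a ha := hh.arr a fun hm => ha (hl hm)
  out ho := hh.out fun hm => ho (hl hm)

theorem Store.EqOff.setVar (h : Store V) (x : Var) (v : ℤ) : h.EqOff [.var x] (h.setVar x v) where
  var y hy := Function.update_of_ne (by simpa using hy) _ _
  arr _ _ := rfl
  out _ := rfl

theorem Store.EqOff.setArr (h : Store V) (a : Arr) (j : ℕ) (v : ℤ) :
    h.EqOff [.arr a] (h.setArr a j v) where
  var _ _ := rfl
  arr b hb := Function.update_of_ne (by simpa using hb) _ _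
  out _ := rfl

@[simp]
theorem Store.setVar_setVar (h : Store V) (x : Var) (v w : ℤ) :
    (h.setVar x v).setVar x w = h.setVar x w := by
  rw [setVar, setVar, setVar, Function.update_idem]

theorem Store.setVar_self (h : Store V) (x : Var) : h.setVar x (h.var x) = h := by
  rw [setVar, Function.update_eq_self]

theorem Store.var_setVar_self (h : Store V) (x : Var) (v : ℤ) : (h.setVar x v).var x = v :=
  Function.update_self ..

theorem Store.arr_setArr_self (h : Store V) (a : Arr) (j : ℕ) (v : ℤ) :
    (h.setArr a j v).arr a = Function.update (h.arr a) j v :=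
  Function.update_self ..

variable [Fintype V] [DecidableEq V] [Nonempty V] {G : SimpleGraph V} [DecidableRel G.Adj] {K : ℕ}

theorem Cmd.wp_congr (c : Cmd) {Φ Ψ : Store V → ℝ≥0∞} {h : Store V}
    (hΦ : ∀ h', h.EqOff c.writes h' → Φ h' = Ψ h') : wp G K c Φ h = wp G K c Ψ h := by
  induction c generalizing Φ Ψ h with
  | assign x e => exact hΦ _ (.setVar ..)
  | store a i e => exact hΦ _ (.setArr ..)
  | emit num den mass =>
    exact hΦ _ ⟨fun _ _ => rfl, fun _ _ => rfl, fun ho => absurd (List.mem_singleton_self _) ho⟩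
  | restart => exact hΦ _ ⟨fun _ _ => rfl, fun _ _ => rfl, fun _ => rfl⟩
  | pick | move =>
    rw [wp, wp]
    congr 1 with v
    exact hΦ _ ⟨fun _ _ => rfl, fun _ _ => rfl, fun _ => rfl⟩
  | ifReturned c ih =>
    rw [wp, wp, ih hΦ, hΦ h (.refl _ h)]
  | seq c d hc hd =>
    refine hc fun h₁ h₁' => hd fun h₂ h₂' => hΦ h₂ ?_
    exact (h₁'.mono (List.subset_append_left _ _)).trans
      (h₂'.mono (List.subset_append_right _ _))
  | rep e c ih =>
    rw [wp, wp]
    congr 1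
    generalize (e.eval h).toNat = n
    induction n generalizing h with
    | zero => exact hΦ h (.refl _ h)
    | succ n ihn =>
      rw [Function.iterate_succ_apply', Function.iterate_succ_apply']
      exact ih fun h₁ h₁' => ihn fun h₂ h₂' => hΦ h₂ (h₁'.trans h₂')

end Frame

section Ensures

variable {V : Type*} [Fintype V] [DecidableEq V] [Nonempty V]
  (G : SimpleGraph V) [DecidableRel G.Adj] (K : ℕ)

/-- Started in `h`, the command `c` ends in a state with `Q` except with probability `δ`. The
quantification over `a` makes the exceptional probabilities of consecutive commands add up. -/
structure Ensures (δ : ℝ≥0∞) (c : Cmd) (h : Store V) (Q : Store V → Prop) : Prop where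
  le_wp_add : ∀ (Φ : Store V → ℝ≥0∞) (a : ℝ≥0∞), a ≤ 1 → (∀ h', Q h' → a ≤ Φ h') →
    a ≤ wp G K c Φ h + δ

variable {G K} {δ δ' : ℝ≥0∞} {c d : Cmd} {h : Store V} {Q R : Store V → Prop}

theorem Ensures.mono (hc : Ensures G K δ c h Q) (hQ : ∀ h', h.EqOff c.writes h' → Q h' → R h') :
    Ensures G K δ c h R where
  le_wp_add Φ a ha hΦ := by
    classical
    rw [c.wp_congr (Ψ := fun h' => if h.EqOff c.writes h' then Φ h' else a) fun h' hh' => by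
      rw [if_pos hh']]
    refine hc.le_wp_add _ a ha fun h' hh' => ?_
    split_ifs with hoff
    · exact hΦ h' (hQ h' hoff hh')
    · exact le_rfl

theorem Ensures.mono_error (hc : Ensures G K δ c h Q) (hδ : δ ≤ δ') : Ensures G K δ' c h Q :=
  ⟨fun Φ a ha hΦ => (hc.le_wp_add Φ a ha hΦ).trans (by gcongr)⟩

theorem Ensures.seq (hc : Ensures G K δ c h Q)
    (hd : ∀ h', h.EqOff c.writes h' → Q h' → Ensures G K δ' d h' R) :
    Ensures G K (δ + δ') (c ;; d) h R where
  le_wp_add Φ a ha hΦ := by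
    have hc' := hc.mono fun h' hoff hQ => And.intro hoff hQ
    have := hc'.le_wp_add (wp G K d Φ) (a - δ') (tsub_le_self.trans ha) fun h' hh' =>
      tsub_le_iff_right.2 ((hd h' hh'.1 hh'.2).le_wp_add Φ a ha hΦ)
    rw [← add_assoc]
    exact tsub_le_iff_right.1 this

theorem Ensures.seq_zero (hc : Ensures G K 0 c h Q)
    (hd : ∀ h', h.EqOff c.writes h' → Q h' → Ensures G K δ d h' R) : Ensures G K δ (c ;; d) h R :=
  zero_add δ ▸ hc.seq hd

theorem Ensures.assign {x : Var} {e : Expr} (hQ : Q (h.setVar x (e.eval h))) :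
    Ensures G K 0 (x ::= e) h Q :=
  ⟨fun _ _ _ hΦ => (hΦ _ hQ).trans (add_zero _).ge⟩

theorem Ensures.assign_seq {x : Var} {e : Expr} (hc : Ensures G K δ c (h.setVar x (e.eval h)) Q) :
    Ensures G K δ (x ::= e ;; c) h Q :=
  ⟨hc.le_wp_add⟩

theorem Ensures.store_seq {a : Arr} {i e : Expr}
    (hc : Ensures G K δ c (h.setArr a (i.eval h).toNat (e.eval h)) Q) :
    Ensures G K δ (.store a i e ;; c) h Q :=
  ⟨hc.le_wp_add⟩

theorem Ensures.emit_seq {num den mass : Expr}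
    (hc : Ensures G K δ c { h with out := h.out ++ [h.atom num den mass] } Q) :
    Ensures G K δ (.emit num den mass ;; c) h Q :=
  ⟨hc.le_wp_add⟩

theorem Ensures.rep {e : Expr} {n : ℕ} (I : ℕ → Store V → Prop) (he : e.eval h = n) (hn : n ≤ K)
    (h₀ : I 0 h)
    (hI : ∀ i < n, ∀ h', h.EqOff c.writes h' → I i h' → Ensures G K δ c h' (I (i + 1))) :
    Ensures G K (n * δ) (.rep e c) h (I n) where
  le_wp_add Φ a ha hΦ := by
    rw [wp, he, Int.toNat_natCast, if_pos hn]
    suffices hiter : ∀ m ≤ n, ∀ h', h.EqOff c.writes h' → I (n - m) h' →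
        a ≤ (wp G K c)^[m] Φ h' + m * δ from
      hiter n le_rfl h (.refl _ h) (by rwa [Nat.sub_self])
    intro m hm
    induction m with
    | zero => exact fun h' _ hh' => by simpa using hΦ h' hh'
    | succ m ih =>
      intro h' hoff hh'
      rw [Function.iterate_succ_apply', Nat.cast_succ, add_one_mul, ← add_assoc, add_right_comm]
      have hstep := (hI _ (by omega) h' hoff hh').mono fun _ => And.intro
      refine tsub_le_iff_right.1 (hstep.le_wp_add _ _ (tsub_le_self.trans ha) fun h'' hh'' => ?_)
      refine tsub_le_iff_right.2 (ih (by omega) h'' (hoff.trans hh''.1) ?_)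
      rw [show n - m = n - (m + 1) + 1 by omega]
      exact hh''.2

theorem Ensures.rep_zero {e : Expr} {n : ℕ} (I : ℕ → Store V → Prop) (he : e.eval h = n)
    (hn : n ≤ K) (h₀ : I 0 h)
    (hI : ∀ i < n, ∀ h', h.EqOff c.writes h' → I i h' → Ensures G K 0 c h' (I (i + 1))) :
    Ensures G K 0 (.rep e c) h (I n) :=
  mul_zero (n : ℝ≥0∞) ▸ Ensures.rep I he hn h₀ hI

theorem wp_iterate_assign {x : Var} {e : Expr} {a : ℤ} (n : ℕ) (Φ : Store V → ℝ≥0∞) (h : Store V)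
    (he : ∀ v, e.eval (h.setVar x v) = v + a) :
    (wp G K (x ::= e))^[n] Φ h = Φ (h.setVar x (h.var x + n * a)) := by
  induction n generalizing h with
  | zero => rw [Nat.cast_zero, zero_mul, add_zero, Store.setVar_self]; rfl
  | succ n ih =>
    have heval : e.eval h = h.var x + a := by rw [← he, Store.setVar_self]
    rw [Function.iterate_succ_apply', wp, heval,
      ih _ fun v => by rw [Store.setVar_setVar, he], Store.setVar_setVar, Store.var_setVar_self,
      Nat.cast_succ, add_one_mul, add_assoc, add_comm a]

/-- Adds the product of two expressions to a variable, by repeated addition or subtraction. -/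
def Var.addMul (x : Var) (e f : Expr) : Cmd :=
  .rep f (x ::= x + e) ;; .rep (0 - f) (x ::= x - e)

theorem wp_addMul {x : Var} {e f : Expr} (he : ∀ v, e.eval (h.setVar x v) = e.eval h)
    (hf : ∀ v, f.eval (h.setVar x v) = f.eval h) (hK : |f.eval h| ≤ K) (Φ : Store V → ℝ≥0∞) :
    wp G K (x.addMul e f) Φ h = Φ (h.setVar x (h.var x + e.eval h * f.eval h)) := by
  obtain ⟨hpos, hneg⟩ := abs_le.1 hK
  have hsplit : ((f.eval h).toNat : ℤ) - ((0 - f.eval h).toNat : ℤ) = f.eval h := by omega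
  rw [Var.addMul, wp, wp, if_pos (by omega), wp_iterate_assign (a := e.eval h) _ _ _ fun v => by
      rw [eval_add, he, eval_var, Store.var_setVar_self],
    wp, eval_sub, hf, eval_ofNat, if_pos (by omega),
    wp_iterate_assign (a := - e.eval h) _ _ _ fun v => by
      rw [Store.setVar_setVar, eval_sub, he, eval_var, Store.var_setVar_self, sub_eq_add_neg],
    Store.setVar_setVar, Store.var_setVar_self]
  congr 2
  linear_combination e.eval h * hsplit

theorem Ensures.addMul_seq {x : Var} {e f : Expr} (he : ∀ v, e.eval (h.setVar x v) = e.eval h)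
    (hf : ∀ v, f.eval (h.setVar x v) = f.eval h) (hK : |f.eval h| ≤ K)
    (hc : Ensures G K δ c (h.setVar x (h.var x + e.eval h * f.eval h)) Q) :
    Ensures G K δ (x.addMul e f ;; c) h Q where
  le_wp_add Φ a ha hΦ := by
    rw [wp, wp_addMul he hf hK]
    exact hc.le_wp_add Φ a ha hΦ

/-- Sets a variable to the product of two expressions. -/
def Var.setMul (x : Var) (e f : Expr) : Cmd := x ::= 0 ;; x.addMul e f

theorem Ensures.setMul_seq {x : Var} {e f : Expr} (u v : ℤ)
    (he : ∀ w, e.eval (h.setVar x w) = u) (hf : ∀ w, f.eval (h.setVar x w) = v) (hK : |v| ≤ K)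
    (hc : Ensures G K δ c (h.setVar x (u * v)) Q) : Ensures G K δ (x.setMul e f ;; c) h Q where
  le_wp_add Φ a ha hΦ := by
    rw [wp, Var.setMul, wp, wp, eval_ofNat, wp_addMul (fun w => by simp [he])
      (fun w => by simp [hf]) (by rwa [hf]), he, hf, Store.var_setVar_self, Store.setVar_setVar]
    simpa using hc.le_wp_add Φ a ha hΦ

end Ensures

/-! ### Sampling return probabilities -/

section Sampling

variable {V : Type*} [Fintype V] [DecidableEq V] [Nonempty V]
  (G : SimpleGraph V) [DecidableRel G.Adj]

/-- The distribution of the position of the simple random walk after `t` steps. -/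
noncomputable def walkDist : ℕ → Option V → PMF (Option V)
  | 0, o => PMF.pure o
  | t + 1, o => (neighborDist G o).bind (walkDist t)

/-- The distribution of the event that the walk from a uniformly random vertex is back at its
starting point after `t` steps. -/
noncomputable def returnDist (t : ℕ) : PMF Bool :=
  (PMF.uniformOfFintype V).bind fun v => (walkDist G t (some v)).map fun w => decide (w = some v)

/-- The return probability of the walk from a uniformly random vertex after `t` steps. -/
noncomputable def returnProb (t : ℕ) : ℝ := (returnDist G t true).toReal

variable {G} {K : ℕ}

theorem returnProb_nonneg (t : ℕ) : 0 ≤ returnProb G t := ENNReal.toReal_nonneg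

theorem returnProb_le_one (t : ℕ) : returnProb G t ≤ 1 :=
  ENNReal.toReal_le_of_le_ofReal zero_le_one (by simpa using PMF.coe_le_one _ true)

theorem expect_returnDist_ofReal (t : ℕ) {f : Bool → ℝ} (hf : ∀ b, 0 ≤ f b) :
    expect (returnDist G t) (fun b => ENNReal.ofReal (f b)) =
      ENNReal.ofReal (returnProb G t * f true + (1 - returnProb G t) * f false) := by
  have htrue : returnDist G t true = ENNReal.ofReal (returnProb G t) :=
    (ENNReal.ofReal_toReal (PMF.apply_ne_top _ _)).symm
  have hfalse : returnDist G t false = ENNReal.ofReal (1 - returnProb G t) := by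
    have hsum := (returnDist G t).tsum_coe
    rw [tsum_bool, htrue] at hsum
    rw [ENNReal.ofReal_sub _ (returnProb_nonneg t), ENNReal.ofReal_one]
    exact ENNReal.eq_sub_of_add_eq ENNReal.ofReal_ne_top hsum
  have h₁ := sub_nonneg.2 (returnProb_le_one (G := G) t)
  rw [expect, tsum_bool, htrue, hfalse, ← ENNReal.ofReal_mul h₁,
    ← ENNReal.ofReal_mul (returnProb_nonneg t),
    ← ENNReal.ofReal_add (mul_nonneg h₁ (hf _)) (mul_nonneg (returnProb_nonneg t) (hf _)), add_comm]

/-- Runs the walk for `len` steps from a random vertex, and counts whether it returns. -/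
def sampleReturn : Cmd :=
  .pick ;; .restart ;; .rep Var.len .move ;; .ifReturned (.hits ::= Var.hits + 1)

theorem wp_iterate_move (n : ℕ) (Φ : Store V → ℝ≥0∞) (h : Store V) :
    (wp G K .move)^[n] Φ h =
      expect (walkDist G n h.current) fun v => Φ { h with current := v } := by
  induction n generalizing h with
  | zero => rw [walkDist, expect_pure]; rfl
  | succ n ih =>
    rw [Function.iterate_succ_apply', walkDist, expect_bind, wp]
    simp only [ih]

theorem wp_sampleReturn {t : ℕ} {h : Store V} (hlen : h.var .len = t) (ht : t ≤ K)
    (Φ : Store V → ℝ≥0∞) :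
    wp G K sampleReturn Φ h = expect (PMF.uniformOfFintype V) fun v =>
      expect (walkDist G t (some v)) fun w =>
        let h' := { h with start := some v, current := w }
        if w = some v then Φ (h'.setVar .hits (h.var .hits + 1)) else Φ h' := by
  refine congrArg _ (funext fun v => ?_)
  change wp G K (.rep Var.len .move) _ _ = _
  rw [wp, if_pos (by simp [hlen, ht])]
  simp only [eval_var, hlen, Int.toNat_natCast, wp_iterate_move]
  rfl

theorem le_wp_sampleReturn_add {t : ℕ} {h : Store V} (hlen : h.var .len = t) (ht : t ≤ K)
    {Φ : Store V → ℝ≥0∞} {a : ℝ≥0∞} {f : Bool → ℝ≥0∞}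
    (hΦ : ∀ h' : Store V, h'.var .len = t → ∀ b, h'.var .hits = h.var .hits + cond b 1 0 →
      a ≤ Φ h' + f b) :
    a ≤ wp G K sampleReturn Φ h + expect (returnDist G t) f := by
  rw [wp_sampleReturn hlen ht, returnDist, expect_bind, ← expect_add]
  refine le_expect fun v => ?_
  rw [expect_map, ← expect_add]
  refine le_expect fun w => ?_
  by_cases hw : w = some v
  · simpa [hw] using hΦ (.setVar ⟨h.var, h.arr, some v, some v, h.out⟩ .hits (h.var .hits + 1))
      hlen true rfl
  · simpa [hw] using hΦ ⟨h.var, h.arr, some v, w, h.out⟩ hlen false (add_zero _).symm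

/-- Chebyshev's inequality: the expected square of `hits + n * p - m`, where `n` samples remain,
increases by at most `1` with each sample. -/
theorem le_iterate_sampleReturn_add {t : ℕ} (ht : t ≤ K) {m c : ℝ} (hc : 0 < c) {a : ℝ≥0∞}
    (ha : a ≤ 1) {Φ : Store V → ℝ≥0∞} (hΦ : ∀ h, |h.var .hits - m| ≤ c → a ≤ Φ h) (n : ℕ)
    {h : Store V} (hlen : h.var .len = t) :
    a ≤ (wp G K sampleReturn)^[n] Φ h +
      ENNReal.ofReal (((h.var .hits + n * returnProb G t - m) ^ 2 + n) / c ^ 2) := by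
  induction n generalizing h with
  | zero =>
    by_cases hh : |h.var .hits - m| ≤ c
    · exact (hΦ h hh).trans le_self_add
    · refine ha.trans (le_add_left (ENNReal.one_le_ofReal.2 ?_))
      rw [Nat.cast_zero, zero_mul, add_zero, add_zero, one_le_div (by positivity), ← sq_abs (_ - m)]
      exact pow_le_pow_left₀ hc.le (le_of_not_ge hh) 2
  | succ n ih =>
    set p := returnProb G t
    let f (b : Bool) : ℝ := ((h.var .hits + cond b 1 0 + n * p - m) ^ 2 + n) / c ^ 2
    have hstep := le_wp_sampleReturn_add (G := G) (Φ := (wp G K sampleReturn)^[n] Φ) (a := a)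
      (f := fun b => ENNReal.ofReal (f b)) hlen ht fun h' hlen' b hb => by
        convert ih hlen' using 4
        rw [hb]
        cases b <;> simp
    rw [expect_returnDist_ofReal t fun b => by positivity] at hstep
    rw [Function.iterate_succ_apply']
    refine hstep.trans (add_le_add_right (ENNReal.ofReal_le_ofReal ?_) _)
    have hvar : p * (1 - p) ≤ 1 := by
      nlinarith [sq_nonneg p, returnProb_le_one (G := G) t]
    simp only [f, cond_true, cond_false, ← mul_div_assoc, ← add_div]
    refine div_le_div_of_nonneg_right ?_ (sq_nonneg c)
    push_cast
    linarith

theorem Ensures.rep_sampleReturn {t n : ℕ} (ht : t ≤ K) (hn : n ≤ K) {c : ℝ} (hc : 0 < c)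
    {e : Expr} {h : Store V} (he : e.eval h = n) (hlen : h.var .len = t)
    (hhits : h.var .hits = 0) :
    Ensures G K (ENNReal.ofReal (n / c ^ 2)) (.rep e sampleReturn) h
      fun h' : Store V => |h'.var .hits - n * returnProb G t| ≤ c where
  le_wp_add Φ a ha hΦ := by
    rw [wp, he, Int.toNat_natCast, if_pos hn]
    simpa [hhits] using le_iterate_sampleReturn_add (G := G) ht hc ha hΦ n hlen

theorem Ensures.rep_sampleReturn_zero {t n : ℕ} (ht : t ≤ K) (hn : n ≤ K)
    {e : Expr} {h : Store V} (he : e.eval h = n) (hlen : h.var .len = t) :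
    Ensures G K 0 (.rep e sampleReturn) h fun _ => True := by
  refine (Ensures.rep_zero (fun _ h' => h'.var .len = t) he hn hlen fun i _ h' _ hlen' =>
    ⟨fun Φ a _ hΦ => ?_⟩).mono fun _ _ _ => trivial
  have := le_wp_sampleReturn_add (G := G) hlen' ht (f := fun _ => 0) fun h'' hlen'' _ _ =>
    (hΦ h'' hlen'').trans (add_zero _).ge
  rwa [expect_const] at this

/-- Stores in `moments` at each index up to `8 * order` how many of `block` walks of that
length return. -/
def estimateMoments : Cmd :=
  .len ::= 0 ;; .rep (8 • Expr.var .order + 1)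
    (.hits ::= 0 ;; .rep Var.block sampleReturn ;; .store .moments Var.len Var.hits ;;
      .len ::= Var.len + 1)

theorem Ensures.estimateMoments {k n : ℕ} (hk : 8 * k + 1 ≤ K) {δ : ℝ≥0∞}
    {Close : ℕ → ℤ → Prop} {h : Store V} (horder : h.var .order = k) (hblock : h.var .block = n)
    (hmoments : h.arr .moments = 0)
    (hsample : ∀ t ≤ 8 * k, ∀ h' : Store V, h'.var .block = n → h'.var .len = t →
      h'.var .hits = 0 →
      Ensures G K δ (.rep Var.block sampleReturn) h' fun h'' => Close t (h''.var .hits)) :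
    Ensures G K ((8 * k + 1 : ℕ) * δ) estimateMoments h fun h' =>
      (∀ t ≤ 8 * k, Close t (h'.arr .moments t)) ∧ ∀ t > 8 * k, h'.arr .moments t = 0 := by
  let I (l : ℕ) (h' : Store V) : Prop := h'.var .len = l ∧
    (∀ t < l, Close t (h'.arr .moments t)) ∧ ∀ t ≥ l, h'.arr .moments t = 0
  refine .assign_seq ((Ensures.rep I ?_ hk ?_ fun l hl h₁ hoff₁ hI => ?_).mono ?_)
  · simp [Store.setVar, horder]
  · exact ⟨rfl, fun t ht => absurd ht t.not_lt_zero, fun t _ => congrFun hmoments t⟩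
  · obtain ⟨hlen, hclose, hzero⟩ := hI
    refine .assign_seq (add_zero δ ▸ (hsample l (by omega) (h₁.setVar .hits 0)
      ((hoff₁.var .block (by decide)).trans hblock) hlen rfl).seq fun h₂ hoff₂ hh₂ =>
      .store_seq (.assign ?_))
    have hlen₂ : h₂.var .len = l := (hoff₂.var .len (by decide)).trans hlen
    have harr : (h₂.setArr .moments (Expr.eval h₂ Var.len).toNat (h₂.var .hits)).arr .moments =
        Function.update (h₁.arr .moments) l (h₂.var .hits) := by
      rw [Store.arr_setArr_self, eval_var, hlen₂, Int.toNat_natCast,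
        hoff₂.arr .moments (by decide)]
      rfl
    refine ⟨?_, fun t ht => (congrArg (Close t) (congrFun harr t)).mpr ?_,
      fun t ht => (congrFun harr t).trans ?_⟩
    · simpa [Store.setVar, Store.setArr] using hlen₂
    · rcases Nat.lt_succ_iff_lt_or_eq.1 ht with ht | rfl
      · rw [Function.update_of_ne ht.ne]
        exact hclose t ht
      · rwa [Function.update_self]
    · rw [Function.update_of_ne (Nat.lt_of_succ_le ht).ne']
      exact hzero t (Nat.le_of_succ_le ht)
  · rintro h' - ⟨-, hclose, hzero⟩
    exact ⟨fun t ht => hclose t (by omega), fun t ht => hzero t ht⟩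

end Sampling

/-! ### Computing the smoothed masses -/

section Recurrence

variable {R : Type*} [CommRing R]

/-- One step of a recurrence for a pair of consecutive sequences: the new sequence is a combination
of three shifts of the last one and of the one before. -/
def recurStep (e : Fin 4 → R) (s : (ℕ → R) × (ℕ → R)) : (ℕ → R) × (ℕ → R) :=
  (fun j => e 0 * s.1 j + e 1 * s.1 (j + 1) + e 2 * s.1 (j + 2) + e 3 * s.2 j, s.1)

/-- The sequence reached after `k` steps of the recurrence from `f` and the zero sequence. -/
def recur (e : Fin 4 → R) (k : ℕ) (f : ℕ → R) : ℕ → R := ((recurStep e)^[k] (f, 0)).1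

/-- The coefficients for which the recurrence for moments with respect to powers of `y` amounts to
the Chebyshev recurrence at `1 - (A / M - 2 + y) ^ 2 / 8`, scaled by `4 * M ^ 2` in each step. -/
def coeff (M A : R) : Fin 4 → R :=
  ![8 * M ^ 2 - (A - 2 * M) ^ 2, -(2 * (A - 2 * M) * M), -M ^ 2, -(16 * M ^ 4)]

/-- The integral of the scaled kernel centred at `2 - A / M`, computed from the moments `f`. -/
def kernelValue (k : ℕ) (M A : R) (f : ℕ → R) : R := (recur (coeff M A) k)^[4] f 0

/-- The unnormalized mass of the `i`-th atom: the sum over a block of `B` grid points. -/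
def atomMass (k B : ℕ) (f : ℕ → ℤ) (i : ℕ) : ℤ :=
  ∑ b ∈ Finset.range B, kernelValue k ((B * k : ℕ) : ℤ) ((i * B + b : ℕ) : ℤ) f

/-- The `i`-th atom of the output. It is located at `i / k - 1`, moved to `[0, 2]`. -/
def outputAtom (k B : ℕ) (f : ℕ → ℤ) (i : ℕ) : Atom :=
  ⟨min (i - k) (2 * k), k, (atomMass k B f i).toNat⟩

theorem abs_coeff_le [LinearOrder R] [IsStrictOrderedRing R] {M A : R} (hA : 0 ≤ A)
    (hAM : A ≤ 4 * M) (i : Fin 4) :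
    |coeff M A i| ≤ ![8 * M ^ 2, 4 * M ^ 2, M ^ 2, 16 * M ^ 4] i := by
  have hM : 0 ≤ M := by linarith
  have hoff : |A - 2 * M| ≤ 2 * M := abs_le.2 ⟨by linarith, by linarith⟩
  have hsq : (A - 2 * M) ^ 2 ≤ (2 * M) ^ 2 := sq_le_sq' (abs_le.1 hoff).1 (abs_le.1 hoff).2
  fin_cases i
  · change |8 * M ^ 2 - (A - 2 * M) ^ 2| ≤ 8 * M ^ 2
    exact abs_le.2 ⟨by nlinarith, by linarith [sq_nonneg (A - 2 * M)]⟩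
  · change |-(2 * (A - 2 * M) * M)| ≤ 4 * M ^ 2
    rw [abs_neg, abs_mul, abs_mul, abs_two, abs_of_nonneg hM]
    nlinarith
  · simp [coeff]
  · simp [coeff, abs_of_nonneg hM]

theorem recurStep_eq_zero {e : Fin 4 → R} {s : (ℕ → R) × (ℕ → R)} {L : ℕ}
    (hs : ∀ j > L, s.1 j = 0 ∧ s.2 j = 0) :
    ∀ j > L, (recurStep e s).1 j = 0 ∧ (recurStep e s).2 j = 0 := fun j hj =>
  ⟨by simp [recurStep, (hs j hj).1, (hs j hj).2, (hs (j + 1) (by omega)).1,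
    (hs (j + 2) (by omega)).1], (hs j hj).1⟩

theorem iterate_recurStep_eq_zero {e : Fin 4 → R} {f : ℕ → R} {L : ℕ} (hf : ∀ j > L, f j = 0)
    (t : ℕ) : ∀ j > L, ((recurStep e)^[t] (f, 0)).1 j = 0 ∧ ((recurStep e)^[t] (f, 0)).2 j = 0 := by
  induction t with
  | zero => exact fun j hj => ⟨hf j hj, rfl⟩
  | succ t ih =>
    rw [Function.iterate_succ_apply']
    exact recurStep_eq_zero ih

end Recurrence

section Output

/-- The coefficients of the recurrence which are stored in the variables. -/
def Store.coeffs {V : Type*} (h : Store V) : Fin 4 → ℤ :=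
  ![h.var .coeff₀, h.var .coeff₁, h.var .coeff₂, h.var .coeff₃]

theorem Store.EqOff.coeffs {V : Type*} {l : List Loc} {h h' : Store V} (hh : h.EqOff l h')
    (hl : ∀ x ∈ [Var.coeff₀, .coeff₁, .coeff₂, .coeff₃], Loc.var x ∉ l) :
    h'.coeffs = h.coeffs := by
  simp only [List.forall_mem_cons] at hl
  rw [Store.coeffs, hh.var _ hl.1, hh.var _ hl.2.1, hh.var _ hl.2.2.1, hh.var _ hl.2.2.2.1]
  rfl

variable {V : Type*} [Fintype V] [DecidableEq V] [Nonempty V]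
  {G : SimpleGraph V} [DecidableRel G.Adj] {K : ℕ}

/-- Fills the array `a` up to the index `8 * order` with the values of `e` for the positions
`pos`. -/
def fill (a : Arr) (e : Expr) : Cmd :=
  .pos ::= 0 ;; .rep (8 • Expr.var .order + 1) (.store a Var.pos e ;; .pos ::= Var.pos + 1)

theorem Ensures.fill {a : Arr} {e : Expr} {k : ℕ} (hk : 8 * k + 1 ≤ K) {f : ℕ → ℤ} {h : Store V}
    (horder : h.var .order = k) (hf : ∀ j > 8 * k, f j = 0) (ha : ∀ j > 8 * k, h.arr a j = 0)
    (he : ∀ (h' : Store V) (j : ℕ), h.EqOff [.var .pos, .arr a] h' → h'.var .pos = j →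
      e.eval h' = f j) :
    Ensures G K 0 (fill a e) h fun h' => h'.arr a = f := by
  let I (p : ℕ) (h' : Store V) : Prop :=
    h'.var .pos = p ∧ h'.arr a = fun j => if j < p then f j else h.arr a j
  refine .assign_seq ((Ensures.rep_zero I ?_ hk ?_ fun p _ h₁ hoff₁ hI => ?_).mono ?_)
  · simp [Store.setVar, horder]
  · exact ⟨rfl, by simp [Store.setVar]⟩
  · obtain ⟨hpos, harr⟩ := hI
    have heval : e.eval h₁ = f p := he h₁ p
      (((Store.EqOff.setVar ..).mono (by simp)).trans (hoff₁.mono (by simp [Cmd.writes]))) hpos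
    refine .store_seq (.assign ⟨?_, funext fun j => ?_⟩)
    · simp [Store.setVar, Store.setArr, hpos]
    · change (h₁.setArr a _ _).arr a j = _
      rw [Store.arr_setArr_self, heval, eval_var, hpos, Int.toNat_natCast, Function.update_apply,
        harr]
      grind
  · rintro h' - ⟨-, harr⟩
    rw [harr]
    exact funext fun j => by grind

/-- Performs one step of the recurrence on the arrays `cur` and `prev`. -/
def stepArrays : Cmd :=
  .pos ::= 0 ;; .rep (8 • Expr.var .order + 1)
    (.next ::= 0 ;;
      Var.next.addMul (.read .cur Var.pos) Var.coeff₀ ;;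
      Var.next.addMul (.read .cur (Var.pos + 1)) Var.coeff₁ ;;
      Var.next.addMul (.read .cur (Var.pos + 2)) Var.coeff₂ ;;
      Var.next.addMul (.read .prev Var.pos) Var.coeff₃ ;;
      .store .prev Var.pos (.read .cur Var.pos) ;;
      .store .cur Var.pos Var.next ;;
      .pos ::= Var.pos + 1)

theorem Ensures.stepArrays {k : ℕ} (hk : 8 * k + 1 ≤ K) {h : Store V}
    (horder : h.var .order = k) (hK : ∀ i, |h.coeffs i| ≤ K)
    (hzero : ∀ j > 8 * k, h.arr .cur j = 0 ∧ h.arr .prev j = 0) :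
    Ensures G K 0 stepArrays h fun h' =>
      (h'.arr .cur, h'.arr .prev) = recurStep h.coeffs (h.arr .cur, h.arr .prev) := by
  set X := h.arr .cur
  set Y := h.arr .prev
  let I (p : ℕ) (h' : Store V) : Prop := h'.var .pos = p ∧
    (h'.arr .cur = fun j => if j < p then (recurStep h.coeffs (X, Y)).1 j else X j) ∧
    h'.arr .prev = fun j => if j < p then X j else Y j
  refine .assign_seq ((Ensures.rep_zero I ?_ hk ?_ fun p _ h₁ hoff₁ hI => ?_).mono ?_)
  · simp [Store.setVar, horder]
  · exact ⟨rfl, by simp [Store.setVar, X], by simp [Store.setVar, Y]⟩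
  · obtain ⟨hpos, hcur, hprev⟩ := hI
    have hcoeffs : h₁.coeffs = h.coeffs := hoff₁.coeffs (by decide)
    have hstep : (recurStep h₁.coeffs (h₁.arr .cur, h₁.arr .prev)).1 p =
        (recurStep h.coeffs (X, Y)).1 p := by
      simp [recurStep, hcoeffs, hcur, hprev]
    have hp₂ : ((p : ℤ) + 2).toNat = p + 2 := by omega
    have hK₁ (i : Fin 4) : |h₁.coeffs i| ≤ K := hcoeffs ▸ hK i
    refine .assign_seq <| .addMul_seq (fun _ => rfl) (fun _ => rfl) (hK₁ 0) <|
      .addMul_seq (fun _ => rfl) (fun _ => rfl) (hK₁ 1) <|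
      .addMul_seq (fun _ => rfl) (fun _ => rfl) (hK₁ 2) <|
      .addMul_seq (fun _ => rfl) (fun _ => rfl) (hK₁ 3) <|
      .store_seq <| .store_seq <| .assign ⟨?_, funext fun j => ?_, funext fun j => ?_⟩
    · simp [Store.setVar, Store.setArr, hpos]
    · trans Function.update (h₁.arr .cur) p
        ((recurStep h₁.coeffs (h₁.arr .cur, h₁.arr .prev)).1 p) j
      · simp [Store.setVar, Store.setArr, Expr.eval, hpos, recurStep, Store.coeffs, hp₂, mul_comm]
      · rw [Function.update_apply, hstep, hcur]
        grind
    · trans Function.update (h₁.arr .prev) p (h₁.arr .cur p) j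
      · simp [Store.setVar, Store.setArr, Expr.eval, hpos]
      · grind [Function.update_apply]
  · rintro h' - ⟨-, hcur, hprev⟩
    rw [hcur, hprev]
    have hzero' := recurStep_eq_zero (e := h.coeffs) (s := (X, Y)) hzero
    refine Prod.ext (funext fun j => ?_) (funext fun j => ?_)
    · grind
    · change _ = X j
      grind

/-- Stores the coefficients of the recurrence for the grid point `grid`. -/
def setCoeffs : Cmd :=
  .offset ::= Var.grid - 2 • Expr.var .scale ;;
    Var.coeff₂.setMul Var.scale Var.scale ;;
    Var.coeff₃.setMul (0 - 16 • Expr.var .coeff₂) Var.coeff₂ ;;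
    Var.coeff₁.setMul (0 - 2 • Expr.var .offset) Var.scale ;;
    Var.coeff₀.setMul (0 - Var.offset) Var.offset ;;
    .coeff₀ ::= Var.coeff₀ + 8 • Expr.var .coeff₂ ;;
    .coeff₂ ::= 0 - Var.coeff₂

theorem Ensures.setCoeffs {M A : ℕ} (hA : A ≤ 4 * M) (hK : 2 * M ≤ K) (hK₂ : M ^ 2 ≤ K)
    {h : Store V} (hscale : h.var .scale = M) (hgrid : h.var .grid = A) :
    Ensures G K 0 setCoeffs h fun h' => h'.coeffs = coeff (M : ℤ) A := by
  have hoffset : |(A - 2 * M : ℤ)| ≤ K := abs_le.2 (by omega)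
  have hM : |(M : ℤ)| ≤ K := abs_le.2 (by omega)
  have hsq : |(M * M : ℤ)| ≤ K := by
    rw [abs_of_nonneg (by positivity), ← sq]
    exact_mod_cast hK₂
  refine .assign_seq <| .setMul_seq M M ?_ ?_ hM <|
    .setMul_seq (-16 * (M * M)) (M * M) ?_ ?_ hsq <|
    .setMul_seq (-2 * (A - 2 * M)) M ?_ ?_ hM <|
    .setMul_seq (-(A - 2 * M)) (A - 2 * M) ?_ ?_ hoffset <| .assign_seq <|
    .assign ?result
  case result =>
    funext i
    fin_cases i <;> simp [Store.setVar, Store.coeffs, coeff] <;> ring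
  all_goals simp [Store.setVar, hscale, hgrid]

/-- Performs `order` steps of the recurrence on the array `cur`. -/
def runRecur : Cmd := fill .prev 0 ;; .rep Var.order stepArrays

/-- All entries of the arrays beyond the index `L` vanish. -/
def Store.Supported (h : Store V) (L : ℕ) : Prop := ∀ a, ∀ j > L, h.arr a j = 0

theorem Ensures.runRecur {k : ℕ} (hk : 8 * k + 1 ≤ K) {h : Store V} (horder : h.var .order = k)
    (hK : ∀ i, |h.coeffs i| ≤ K) (hzero : h.Supported (8 * k)) :
    Ensures G K 0 runRecur h fun h' =>
      h'.arr .cur = recur h.coeffs k (h.arr .cur) ∧ h'.Supported (8 * k) := by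
  set X := h.arr .cur
  refine (Ensures.fill hk horder (fun _ _ => rfl) (hzero .prev) fun _ _ _ _ => rfl).seq_zero
    fun h₁ hoff₁ hprev₁ => ?_
  have hcur₁ : h₁.arr .cur = X := hoff₁.arr .cur (by decide)
  have horder₁ : h₁.var .order = k := (hoff₁.var .order (by decide)).trans horder
  refine (Ensures.rep_zero (e := Var.order) (fun t h' => (h'.arr .cur, h'.arr .prev) =
    (recurStep h.coeffs)^[t] (X, 0)) horder₁ (by omega) (Prod.ext hcur₁ hprev₁)
    fun t _ h₂ hoff₂ h₂s => ?_).mono fun h₂ hoff₂ h₂s => ?_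
  · have hcoeffs : h₂.coeffs = h.coeffs :=
      (hoff₂.coeffs (by decide)).trans (hoff₁.coeffs (by decide))
    have hzero₂ := iterate_recurStep_eq_zero (e := h.coeffs) (hzero .cur) t
    rw [← h₂s] at hzero₂
    refine (Ensures.stepArrays hk ((hoff₂.var .order (by decide)).trans horder₁) (hcoeffs ▸ hK)
      hzero₂).mono fun h₃ _ h₃s => ?_
    rw [h₃s, hcoeffs, h₂s]
    exact (Function.iterate_succ_apply' ..).symm
  · refine ⟨congrArg Prod.fst h₂s, fun a j hj => ?_⟩
    have hzero₂ := iterate_recurStep_eq_zero (e := h.coeffs) (hzero .cur) k j hj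
    rw [← h₂s] at hzero₂
    cases a with
    | moments =>
      rw [hoff₂.arr .moments (by decide), hoff₁.arr .moments (by decide)]
      exact hzero .moments j hj
    | cur => exact hzero₂.1
    | prev => exact hzero₂.2

theorem Ensures.rep_runRecur {k n : ℕ} {e : Expr} {h : Store V} (hn : e.eval h = n) (hnK : n ≤ K)
    (hk : 8 * k + 1 ≤ K) (horder : h.var .order = k) (hK : ∀ i, |h.coeffs i| ≤ K)
    (hzero : h.Supported (8 * k)) :
    Ensures G K 0 (.rep e GraphSpectrum.runRecur) h fun h' =>
      h'.Supported (8 * k) ∧ h'.arr .cur = (recur h.coeffs k)^[n] (h.arr .cur) := by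
  refine Ensures.rep_zero (fun t h' => h'.Supported (8 * k) ∧
    h'.arr .cur = (recur h.coeffs k)^[t] (h.arr .cur)) hn hnK ⟨hzero, rfl⟩ ?_
  rintro t - h₁ hoff ⟨hs, hcur⟩
  have hcoeffs : h₁.coeffs = h.coeffs := hoff.coeffs (by decide)
  refine (Ensures.runRecur hk ((hoff.var .order (by decide)).trans horder)
    (hcoeffs ▸ hK) hs).mono fun h₂ _ ⟨hcur₂, hs₂⟩ => ⟨hs₂, ?_⟩
  rw [hcur₂, hcoeffs, hcur, ← Function.iterate_succ_apply' (recur _ k)]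

end Output

section Atoms

variable {V : Type*}

/-- The state contains the parameters and the moments from which the output is computed. -/
structure Store.Ready (k B : ℕ) (f : ℕ → ℤ) (h : Store V) : Prop where
  order : h.var .order = k
  block : h.var .block = B
  scale : h.var .scale = (B * k : ℕ)
  moments : h.arr .moments = f
  supported : h.Supported (8 * k)

theorem Store.Ready.of_eqOff {k B : ℕ} {f : ℕ → ℤ} {l : List Loc} {h h' : Store V}
    (hh : h.Ready k B f) (hoff : h.EqOff l h') (hs : h'.Supported (8 * k))
    (hl : ∀ p ∈ [.var .order, .var .block, .var .scale, Loc.arr .moments], p ∉ l) :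
    h'.Ready k B f := by
  simp only [List.forall_mem_cons] at hl
  exact ⟨(hoff.var _ hl.1).trans hh.order, (hoff.var _ hl.2.1).trans hh.block,
    (hoff.var _ hl.2.2.1).trans hh.scale, (hoff.arr _ hl.2.2.2.1).trans hh.moments, hs⟩

variable [Fintype V] [DecidableEq V] [Nonempty V] {G : SimpleGraph V} [DecidableRel G.Adj]
  {K k B : ℕ} {f : ℕ → ℤ} {h : Store V}

/-- Computes the integral of the kernel centred at the current grid point, adds it to `mass`, and
moves on to the next grid point. -/
def addKernel : Cmd :=
  setCoeffs ;; fill .cur (.read .moments Var.pos) ;; .rep 4 runRecur ;;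
    .mass ::= Var.mass + .read .cur 0 ;; .grid ::= Var.grid + 1

theorem abs_coeff_natCast_le {M A : ℕ} (hM : 0 < M) (hA : A ≤ 4 * M) (i : Fin 4) :
    |coeff (M : ℤ) A i| ≤ 16 * M ^ 4 := by
  have hA' : (A : ℤ) ≤ 4 * M := by exact_mod_cast hA
  have hpow : (M : ℤ) ^ 2 ≤ M ^ 4 := pow_le_pow_right₀ (by exact_mod_cast hM) (by norm_num)
  refine (abs_coeff_le A.cast_nonneg hA' i).trans ?_
  fin_cases i <;> simp <;> nlinarith [sq_nonneg (M : ℤ)]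

theorem Ensures.addKernel {A : ℕ} (hBk : 0 < B * k) (hK : 32 * (B * k) ^ 4 ≤ K)
    (hA : A ≤ 4 * (B * k)) (hh : h.Ready k B f) (hgrid : h.var .grid = A) :
    Ensures G K 0 addKernel h fun h' => h'.Ready k B f ∧ h'.var .grid = A + 1 ∧
      h'.var .mass = h.var .mass + kernelValue k ((B * k : ℕ) : ℤ) A f := by
  set M := B * k
  have hkM : k ≤ M := Nat.le_mul_of_pos_left k (Nat.pos_of_mul_pos_right hBk)
  have hM₁ : M ≤ M ^ 4 := Nat.le_self_pow (by norm_num) M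
  have hM₂ : M ^ 2 ≤ M ^ 4 := Nat.pow_le_pow_right hBk (by norm_num)
  have hk : 8 * k + 1 ≤ K := by omega
  have hcoeff (i : Fin 4) : |coeff (M : ℤ) A i| ≤ K :=
    (abs_coeff_natCast_le hBk hA i).trans (by exact_mod_cast (by omega : 16 * M ^ 4 ≤ K))
  refine (Ensures.setCoeffs hA (by omega) (by omega) hh.scale hgrid).seq_zero
    fun h₁ hoff₁ hcoeffs₁ => ?_
  have hh₁ : h₁.Ready k B f := hh.of_eqOff hoff₁
    (fun a => by rw [hoff₁.arr a (by cases a <;> decide)]; exact hh.supported a) (by decide)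
  refine (Ensures.fill (e := .read .moments Var.pos) hk hh₁.order
    (hh₁.moments ▸ hh₁.supported .moments)
    (hh₁.supported .cur) fun h' j hoff' hj => ?_).seq_zero fun h₂ hoff₂ hcur₂ => ?_
  · change h'.arr .moments (h'.var .pos).toNat = f j
    rw [hj, hoff'.arr .moments (by decide), hh₁.moments, Int.toNat_natCast]
  have hh₂ : h₂.Ready k B f := hh₁.of_eqOff hoff₂ (fun a => by
    cases a with
    | cur => rw [hcur₂]; exact hh₁.moments ▸ hh₁.supported .moments
    | moments => rw [hoff₂.arr .moments (by decide)]; exact hh₁.supported .moments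
    | prev => rw [hoff₂.arr .prev (by decide)]; exact hh₁.supported .prev) (by decide)
  have hcoeffs₂ : h₂.coeffs = coeff (M : ℤ) A := (hoff₂.coeffs (by decide)).trans hcoeffs₁
  refine (Ensures.rep_runRecur (n := 4) (e := 4) rfl (by omega) hk hh₂.order
    (hcoeffs₂ ▸ hcoeff) hh₂.supported).seq_zero fun h₃ hoff₃ ⟨hs, hcur⟩ => ?_
  have hh₃ : h₃.Ready k B f := hh₂.of_eqOff hoff₃ hs (by decide)
  refine .assign_seq <| .assign
    ⟨⟨hh₃.order, hh₃.block, hh₃.scale, hh₃.moments, hh₃.supported⟩, ?_, ?_⟩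
  · have hgrid₃ : h₃.var .grid = A := (hoff₃.var .grid (by decide)).trans
      ((hoff₂.var .grid (by decide)).trans ((hoff₁.var .grid (by decide)).trans hgrid))
    simp [Store.setVar, hgrid₃]
  · have hmass₃ : h₃.var .mass = h.var .mass := (hoff₃.var .mass (by decide)).trans
      ((hoff₂.var .mass (by decide)).trans (hoff₁.var .mass (by decide)))
    change h₃.var .mass + h₃.arr .cur 0 = _
    rw [hmass₃, hcur, hcoeffs₂, hcur₂]
    rfl

/-- Computes the next atom, and emits it. -/
def emitAtom : Cmd :=
  .mass ::= 0 ;; .rep Var.block addKernel ;;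
    .emit (2 • Expr.var .order - .pos (3 • Expr.var .order - Var.index)) Var.order Var.mass ;;
    .index ::= Var.index + 1

theorem Ensures.emitAtom {i : ℕ} (hBk : 0 < B * k) (hK : 32 * (B * k) ^ 4 ≤ K)
    (hi : i < 4 * k) (hh : h.Ready k B f) (hgrid : h.var .grid = (i * B : ℕ))
    (hindex : h.var .index = i) :
    Ensures G K 0 emitAtom h fun h' => h'.Ready k B f ∧ h'.var .grid = ((i + 1) * B : ℕ) ∧
      h'.var .index = (i + 1 : ℕ) ∧ h'.out = h.out ++ [outputAtom k B f i] := by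
  set M := B * k
  have hM₁ : M ≤ M ^ 4 := Nat.le_self_pow (by norm_num) M
  have hBM : B ≤ M := Nat.le_mul_of_pos_right B (Nat.pos_of_mul_pos_left hBk)
  let I (b : ℕ) (h' : Store V) : Prop := h'.Ready k B f ∧ h'.var .grid = (i * B + b : ℕ) ∧
    h'.var .mass = ∑ b ∈ Finset.range b, kernelValue k (M : ℤ) ((i * B + b : ℕ) : ℤ) f
  have hhm : (h.setVar .mass 0).Ready k B f :=
    ⟨hh.order, hh.block, hh.scale, hh.moments, hh.supported⟩
  refine .assign_seq <| (Ensures.rep_zero (e := Var.block) I hhm.block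
    (by omega) ⟨hhm, hgrid, rfl⟩ ?_).seq_zero ?_
  · rintro b hb h₁ - ⟨hh₁, hgrid₁, hmass₁⟩
    have hA : i * B + b ≤ 4 * M := calc
      i * B + b ≤ (i + 1) * B := by
        rw [add_one_mul]
        omega
      _ ≤ 4 * k * B := Nat.mul_le_mul_right B hi
      _ = 4 * M := by ring
    refine (Ensures.addKernel hBk hK hA hh₁ hgrid₁).mono ?_
    rintro h₂ - ⟨hh₂, hgrid₂, hmass₂⟩
    refine ⟨hh₂, by rw [hgrid₂]; push_cast; ring, ?_⟩
    rw [hmass₂, hmass₁, Finset.sum_range_succ]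
  · rintro h₁ hoff₁ ⟨hh₁, hgrid₁, hmass₁⟩
    have hindex₁ : h₁.var .index = i := (hoff₁.var .index (by decide)).trans hindex
    have hout₁ : h₁.out = h.out := hoff₁.out (by decide)
    refine .emit_seq <| .assign ⟨⟨hh₁.order, hh₁.block, hh₁.scale, hh₁.moments, hh₁.supported⟩,
      ?_, ?_, ?_⟩
    · rw [add_one_mul]
      exact hgrid₁
    · simp [Store.setVar, hindex₁]
    · change h₁.out ++ [h₁.atom ..] = _
      rw [hout₁, Store.atom, eval_var, eval_var, hh₁.order, hmass₁, outputAtom, atomMass]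
      have hnum : (Expr.eval h₁ (2 • Expr.var .order - .pos (3 • Expr.var .order -
          Var.index))).toNat = min (i - k) (2 * k) := by
        simp only [eval_sub, eval_nsmul, eval_pos, eval_var, hh₁.order, hindex₁]
        omega
      rw [hnum]
      rfl

/-- Emits all atoms. -/
def emitAtoms : Cmd := .grid ::= 0 ;; .index ::= 0 ;; .rep (4 • Expr.var .order) emitAtom

theorem Ensures.emitAtoms (hBk : 0 < B * k) (hK : 32 * (B * k) ^ 4 ≤ K) (hh : h.Ready k B f)
    (hout : h.out = []) :
    Ensures G K 0 emitAtoms h fun h' => h'.out = (List.range (4 * k)).map (outputAtom k B f) := by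
  let I (i : ℕ) (h' : Store V) : Prop := h'.Ready k B f ∧ h'.var .grid = (i * B : ℕ) ∧
    h'.var .index = i ∧ h'.out = (List.range i).map (outputAtom k B f)
  refine .assign_seq <| .assign_seq <| (Ensures.rep_zero (n := 4 * k) I ?_ ?_ ?_
    fun i hi h₁ _ hI => ?_).mono fun _ _ hI => hI.2.2.2
  · simp [Store.setVar, hh.order]
  · have hkM : k ≤ B * k := Nat.le_mul_of_pos_left k (Nat.pos_of_mul_pos_right hBk)
    have hM₁ : B * k ≤ (B * k) ^ 4 := Nat.le_self_pow (by norm_num) _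
    omega
  · exact ⟨⟨hh.order, hh.block, hh.scale, hh.moments, hh.supported⟩, by simp [Store.setVar],
      rfl, hout⟩
  · obtain ⟨hh₁, hgrid, hindex, hout₁⟩ := hI
    refine (Ensures.emitAtom hBk hK hi hh₁ hgrid hindex).mono ?_
    rintro h₂ - ⟨hh₂, hgrid₂, hindex₂, hout₂⟩
    refine ⟨hh₂, hgrid₂, hindex₂, ?_⟩
    rw [hout₂, hout₁, List.range_succ, List.map_append]
    rfl

end Atoms

section Estimation

/-- The algorithm: chooses the order of the kernel and the number of samples, and estimates the
moments and then the spectrum. -/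
def estimateSpectrum : Cmd :=
  .order ::= 8192 • Expr.var .input ;; .block ::= 1 ;;
    .rep (32 • Expr.var .order) (.block ::= Var.block + Var.block) ;;
    Var.setMul .scale Var.block Var.order ;; estimateMoments ;; emitAtoms

/-- The initial state of the source language. -/
def Store.init (V : Type*) (n : ℕ) : Store V where
  var := Function.update 0 .input n
  arr := 0
  start := none
  current := none
  out := []

theorem State.init_represents (V : Type*) (n : ℕ) :
    (State.init V n).Represents (Store.init V n) where
  var x := by cases x <;> simp [State.init, Store.init, Var.reg, Var.ctorIdx]
  arr _ _ := rfl
  start := rfl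
  current := rfl
  out := rfl

variable {V : Type*} [Fintype V] [DecidableEq V] [Nonempty V] {G : SimpleGraph V}
  [DecidableRel G.Adj] {K : ℕ}

theorem Ensures.double {n : ℕ} (hn : n ≤ K) {e : Expr} {h : Store V} (he : e.eval h = n)
    (hblock : h.var .block = 1) :
    Ensures G K 0 (.rep e (.block ::= Var.block + Var.block)) h
      fun h' => h'.var .block = (2 ^ n : ℕ) := by
  refine .rep_zero (fun i h' => h'.var .block = (2 ^ i : ℕ)) he hn hblock fun i _ h' _ hi =>
    .assign ?_
  rw [Store.var_setVar_self, eval_add, eval_var, hi, pow_succ]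
  push_cast
  ring

theorem Ensures.estimateSpectrum {n k B : ℕ} (hn : 0 < n) (hk : k = 8192 * n)
    (hB : B = 2 ^ (32 * k)) (hK : 32 * (B * k) ^ 4 ≤ K) {δ : ℝ≥0∞} {Close : ℕ → ℤ → Prop}
    (hsample : ∀ t ≤ 8 * k, ∀ h : Store V, h.var .block = B → h.var .len = t → h.var .hits = 0 →
      Ensures G K δ (.rep Var.block sampleReturn) h fun h' => Close t (h'.var .hits)) :
    Ensures G K ((8 * k + 1 : ℕ) * δ) estimateSpectrum (.init V n) fun h' =>
      ∃ f : ℕ → ℤ, (∀ t ≤ 8 * k, Close t (f t)) ∧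
        h'.out = (List.range (4 * k)).map (outputAtom k B f) := by
  have hB₀ : 0 < B := hB ▸ by positivity
  have hBk : 0 < B * k := Nat.mul_pos hB₀ (by omega)
  have hkK : 32 * k ≤ K := by
    have := Nat.le_mul_of_pos_left k hB₀
    have := Nat.le_self_pow (n := 4) (by norm_num) (B * k)
    omega
  refine .assign_seq <| .assign_seq <| (Ensures.double (n := 32 * k) hkK ?_ rfl).seq_zero
    fun h₁ hoff₁ hblock₁ => ?_
  · simp [Store.setVar, Store.init, hk]
  rw [← hB] at hblock₁
  have horder₁ : h₁.var .order = k := (hoff₁.var .order (by decide)).trans <| by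
    simp [Store.setVar, Store.init, hk]
  have harr₁ (a : Arr) : h₁.arr a = 0 := hoff₁.arr a (by cases a <;> decide)
  refine .setMul_seq B k (fun _ => hblock₁) (fun _ => horder₁)
    (by rw [Nat.abs_cast]; exact_mod_cast (by omega)) ?_
  set h₂ := h₁.setVar .scale (B * k)
  rw [← add_zero (_ * δ)]
  refine (Ensures.estimateMoments (h := h₂) (by omega) horder₁ hblock₁ (harr₁ .moments)
    hsample).seq fun h₃ hoff₃ ⟨hclose, hzero⟩ => ?_
  refine (Ensures.emitAtoms hBk hK (f := h₃.arr .moments) ?_ ?_).mono fun h₄ _ hout =>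
    ⟨_, hclose, hout⟩
  · refine ⟨(hoff₃.var .order (by decide)).trans horder₁,
      (hoff₃.var .block (by decide)).trans hblock₁, (hoff₃.var .scale (by decide)).trans ?_, rfl,
      fun a => ?_⟩
    · rw [Nat.cast_mul]
      exact Store.var_setVar_self ..
    · cases a with
      | moments => exact hzero
      | cur =>
        rw [hoff₃.arr .cur (by decide), show h₂.arr .cur = 0 from harr₁ .cur]
        exact fun _ _ => rfl
      | prev =>
        rw [hoff₃.arr .prev (by decide), show h₂.arr .prev = 0 from harr₁ .prev]
        exact fun _ _ => rfl
  · exact (hoff₃.out (by decide)).trans (hoff₁.out (by decide))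

theorem le_iteration_bound {k B : ℕ} (hk : 0 < k) (hB : B = 2 ^ (32 * k))
    (hK : 32 * (B * k) ^ 4 ≤ K) : 8 * k ≤ K ∧ B ≤ K := by
  have hBk : B * k ≤ (B * k) ^ 4 := Nat.le_self_pow (by norm_num) _
  have hB₀ : 0 < B := hB ▸ by positivity
  have hkB : k ≤ B * k := Nat.le_mul_of_pos_left k hB₀
  have hBB : B ≤ B * k := Nat.le_mul_of_pos_right B hk
  omega

theorem Ensures.estimateSpectrum_trivial {n k B : ℕ} (hn : 0 < n) (hk : k = 8192 * n)
    (hB : B = 2 ^ (32 * k)) (hK : 32 * (B * k) ^ 4 ≤ K) :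
    Ensures G K 0 GraphSpectrum.estimateSpectrum (.init V n) fun _ => True := by
  obtain ⟨hkK, hBK⟩ := le_iteration_bound (by omega) hB hK
  have := Ensures.estimateSpectrum (G := G) hn hk hB hK (δ := 0) (Close := fun _ _ => True)
    fun t ht h hblock hlen _ =>
      Ensures.rep_sampleReturn_zero (e := Var.block) (by omega) hBK hblock hlen
  rw [mul_zero] at this
  exact this.mono fun _ _ _ => trivial

end Estimation

/-! ### Return probabilities and eigenvalues -/

section Spectral

variable {V : Type*} [Fintype V] {G : SimpleGraph V} [DecidableRel G.Adj]

theorem neighborDist_of_degree_pos {v : V} (hv : 0 < G.degree v) :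
    ∃ h, neighborDist G (some v) = (PMF.uniformOfFinset (G.neighborFinset v) h).map some :=
  have h : (G.neighborFinset v).Nonempty := by
    rwa [← Finset.card_pos, SimpleGraph.card_neighborFinset_eq_degree]
  ⟨h, dif_pos h⟩

theorem neighborDist_none {v : V} (hv : 0 < G.degree v) : neighborDist G (some v) none = 0 := by
  obtain ⟨h, hdist⟩ := neighborDist_of_degree_pos hv
  simp [hdist, PMF.map_apply]

variable [DecidableEq V]

variable (G)

/-- The transition matrix `D⁻¹ A` of the random walk. -/
noncomputable def transition : Matrix V V ℝ :=
  Matrix.diagonal (fun v => (G.degree v : ℝ)⁻¹) * G.adjMatrix ℝ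

theorem transition_apply (v w : V) :
    transition G v w = if G.Adj v w then (G.degree v : ℝ)⁻¹ else 0 := by
  rw [transition, Matrix.diagonal_mul, SimpleGraph.adjMatrix_apply, mul_ite, mul_one, mul_zero]

theorem transition_nonneg (v w : V) : 0 ≤ transition G v w := by
  rw [transition_apply]
  split_ifs <;> positivity

theorem transition_pow_nonneg (t : ℕ) (v w : V) : 0 ≤ (transition G ^ t) v w := by
  induction t generalizing v with
  | zero =>
    rw [pow_zero, Matrix.one_apply]
    split_ifs <;> norm_num
  | succ t ih =>
    rw [pow_succ', Matrix.mul_apply]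
    exact Finset.sum_nonneg fun i _ => mul_nonneg (transition_nonneg G v i) (ih i)

variable {G}

theorem neighborDist_some {v : V} (hv : 0 < G.degree v) (w : V) :
    neighborDist G (some v) (some w) = ENNReal.ofReal (transition G v w) := by
  obtain ⟨h, hdist⟩ := neighborDist_of_degree_pos hv
  rw [hdist, PMF.map_apply, tsum_eq_single w (by simp +contextual [eq_comm]), if_pos rfl,
    PMF.uniformOfFinset_apply, transition_apply, SimpleGraph.card_neighborFinset_eq_degree]
  simp only [SimpleGraph.mem_neighborFinset]
  split_ifs
  · rw [ENNReal.ofReal_inv_of_pos (by exact_mod_cast hv), ENNReal.ofReal_natCast]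
  · rw [ENNReal.ofReal_zero]

theorem walkDist_some (hG : ∀ v, 0 < G.degree v) (t : ℕ) (v w : V) :
    walkDist G t (some v) (some w) = ENNReal.ofReal ((transition G ^ t) v w) := by
  induction t generalizing v with
  | zero =>
    rw [walkDist, pow_zero, Matrix.one_apply, PMF.pure_apply]
    by_cases h : v = w
    · simp [h]
    · simp [h, Ne.symm h]
  | succ t ih =>
    rw [walkDist, PMF.bind_apply, tsum_fintype, Fintype.sum_option, neighborDist_none (hG v),
      zero_mul, zero_add, pow_succ', Matrix.mul_apply, ENNReal.ofReal_sum_of_nonneg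
        fun i _ => mul_nonneg (transition_nonneg G v i) (transition_pow_nonneg G t i w)]
    refine Finset.sum_congr rfl fun i _ => ?_
    rw [neighborDist_some (hG v), ih, ENNReal.ofReal_mul (transition_nonneg G v i)]

theorem exists_transition_eq_conj (hG : ∀ v, 0 < G.degree v) :
    ∃ U : (Matrix V V ℝ)ˣ, transition G = U * (1 - normLaplacian G) * (U⁻¹ : (Matrix V V ℝ)ˣ) := by
  have hsqrt (v : V) : Real.sqrt (G.degree v) ≠ 0 :=
    (Real.sqrt_pos.2 (by exact_mod_cast hG v)).ne'
  let S : Matrix V V ℝ := Matrix.diagonal fun v => Real.sqrt (G.degree v)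
  have hinv : invSqrtDegree G * S = 1 := by
    simp [invSqrtDegree, S, Matrix.diagonal_mul_diagonal, inv_mul_cancel₀ (hsqrt _)]
  refine ⟨⟨invSqrtDegree G, S, hinv, mul_eq_one_comm.1 hinv⟩, ?_⟩
  change _ = invSqrtDegree G * _ * S
  rw [normLaplacian, sub_sub_cancel, ← mul_assoc, mul_assoc _ _ S, hinv, mul_one, ← mul_assoc,
    transition, invSqrtDegree, Matrix.diagonal_mul_diagonal]
  congr 2
  funext v
  rw [← mul_inv, Real.mul_self_sqrt (Nat.cast_nonneg _)]

theorem trace_transition_pow (hG : ∀ v, 0 < G.degree v) (t : ℕ) :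
    (transition G ^ t).trace = ((1 - normLaplacian G) ^ t).trace := by
  obtain ⟨U, hU⟩ := exists_transition_eq_conj hG
  rw [hU, Units.conj_pow, Matrix.trace_units_conj]

theorem trace_one_sub_normLaplacian_pow (t : ℕ) : ((1 - normLaplacian G) ^ t).trace =
    ∑ i, (1 - (normLaplacian_isHermitian G).eigenvalues i) ^ t := by
  set hL := normLaplacian_isHermitian G
  have hdiag : 1 - normLaplacian G = Unitary.conjStarAlgAut ℝ _ hL.eigenvectorUnitary
      (Matrix.diagonal fun i => 1 - hL.eigenvalues i) := by
    conv_lhs => rw [hL.spectral_theorem,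
      ← map_one (Unitary.conjStarAlgAut ℝ _ hL.eigenvectorUnitary), ← map_sub]
    rw [← Matrix.diagonal_one, Matrix.diagonal_sub]
    rfl
  rw [hdiag, ← map_pow, Matrix.diagonal_pow, Unitary.conjStarAlgAut_apply, Matrix.trace_mul_comm,
    ← mul_assoc, Unitary.coe_star_mul_self, one_mul, Matrix.trace_diagonal]
  rfl

variable [Nonempty V]

theorem returnDist_true (t : ℕ) : returnDist G t true =
    ∑ v, (Fintype.card V : ℝ≥0∞)⁻¹ * walkDist G t (some v) (some v) := by
  rw [returnDist, PMF.bind_apply, tsum_fintype]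
  refine Finset.sum_congr rfl fun v _ => ?_
  rw [PMF.uniformOfFintype_apply, PMF.map_apply,
    tsum_eq_single (some v) (by simp +contextual), if_pos (by simp)]

theorem returnProb_eq_sum_eigenvalues (hG : ∀ v, 0 < G.degree v) (t : ℕ) :
    returnProb G t = (Fintype.card V : ℝ)⁻¹ *
      ∑ i, (1 - (normLaplacian_isHermitian G).eigenvalues i) ^ t := by
  rw [← trace_one_sub_normLaplacian_pow, ← trace_transition_pow hG, returnProb, returnDist_true,
    ← Finset.mul_sum, ENNReal.toReal_mul, ENNReal.toReal_inv, ENNReal.toReal_natCast]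
  simp only [walkDist_some hG]
  rw [← ENNReal.ofReal_sum_of_nonneg fun i _ => transition_pow_nonneg G t i i,
    ENNReal.toReal_ofReal (Finset.sum_nonneg fun i _ => transition_pow_nonneg G t i i)]
  rfl

/-- A larger eigenvalue would make the even return probabilities grow exponentially. -/
theorem abs_one_sub_eigenvalue_le (hG : ∀ v, 0 < G.degree v) (i : V) :
    |1 - (normLaplacian_isHermitian G).eigenvalues i| ≤ 1 := by
  by_contra! hlt
  let y (i : V) : ℝ := 1 - (normLaplacian_isHermitian G).eigenvalues i
  have hbound (t : ℕ) : (y i ^ 2) ^ t ≤ Fintype.card V := by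
    have hprob := returnProb_le_one (G := G) (2 * t)
    rw [returnProb_eq_sum_eigenvalues hG, inv_mul_le_iff₀ (by exact_mod_cast Fintype.card_pos),
      mul_one] at hprob
    rw [← pow_mul]
    exact (Finset.single_le_sum (f := fun i => y i ^ (2 * t))
      (fun i _ => (even_two_mul t).pow_nonneg _) (Finset.mem_univ i)).trans hprob
  have hgrow : 1 < y i ^ 2 := by
    rw [← sq_abs]
    exact one_lt_pow₀ hlt two_ne_zero
  obtain ⟨t, ht⟩ := pow_unbounded_of_one_lt (Fintype.card V : ℝ) hgrow
  exact (hbound t).not_gt ht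

end Spectral

/-! ### The smoothing kernel -/

section Chebyshev

open Polynomial.Chebyshev

theorem eval_U_add_one {R : Type*} [CommRing R] (n : ℤ) (c : R) :
    (U R (n + 1)).eval c = 2 * c * (U R n).eval c - (U R (n - 1)).eval c := by
  simp [U_add_one]

variable {c c' : ℝ}

theorem abs_eval_U_le (k : ℕ) (hc : |c| ≤ 1) : |(U ℝ k).eval c| ≤ k + 1 := by
  induction k with
  | zero => simp
  | succ k ih =>
    have hrec : (U ℝ (k + 1)).eval c = c * (U ℝ k).eval c + (T ℝ (k + 1)).eval c := by
      simp [U_eq_X_mul_U_add_T]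
    push_cast
    calc |(U ℝ (k + 1)).eval c| ≤ |c| * |(U ℝ k).eval c| + |(T ℝ (k + 1)).eval c| := by
          rw [hrec, ← abs_mul]
          exact abs_add_le _ _
      _ ≤ 1 * (k + 1) + 1 := by
          gcongr
          exact abs_eval_T_real_le_one _ hc
      _ = k + 1 + 1 := by rw [one_mul]

theorem one_sub_sq_mul_eval_U_sq_le (k : ℕ) (hc : |c| ≤ 1) :
    (1 - c ^ 2) * (U ℝ k).eval c ^ 2 ≤ 1 := by
  obtain ⟨h₁, h₂⟩ := abs_le.1 hc
  have hU := U_real_cos (Real.arccos c) k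
  have hsin := Real.sin_sq (Real.arccos c)
  rw [Real.cos_arccos h₁ h₂] at hU hsin
  rw [← hsin, ← mul_pow, mul_comm, hU]
  exact Real.sin_sq_le_one _

theorem le_eval_U_sub_eval_U (k : ℕ) (hc : |c| ≤ 1) :
    1 - (1 - c) * (k * (k + 1)) ≤ (U ℝ k).eval c - (U ℝ (k - 1)).eval c := by
  induction k with
  | zero => simp
  | succ k ih =>
    have hstep : (1 - c) * (U ℝ k).eval c ≤ (1 - c) * (k + 1) :=
      mul_le_mul_of_nonneg_left (abs_le.1 (abs_eval_U_le k hc)).2 (sub_nonneg.2 (abs_le.1 hc).2)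
    push_cast
    rw [eval_U_add_one, add_sub_cancel_right]
    linarith

theorem le_eval_U (k : ℕ) (hc : |c| ≤ 1) :
    (k + 1) * (1 - (1 - c) * (k + 1) ^ 2) ≤ (U ℝ k).eval c := by
  have hc₁ := sub_nonneg.2 (abs_le.1 hc).2
  induction k with
  | zero => simpa using (abs_le.1 hc).2
  | succ k ih =>
    have hdiff := le_eval_U_sub_eval_U (k + 1) hc
    push_cast at hdiff ⊢
    rw [add_sub_cancel_right] at hdiff
    have hcube : (1 - c) * (((k : ℝ) + 1) ^ 3 + (k + 1) * (k + 1 + 1)) ≤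
        (1 - c) * (k + 1 + 1) ^ 3 := by
      gcongr
      nlinarith
    linarith

theorem abs_eval_U_sub_le (k : ℕ) (hc : |c| ≤ 1) (hc' : |c'| ≤ 1) :
    |(U ℝ k).eval c - (U ℝ k).eval c'| ≤ 8 ^ k * |c - c'| := by
  induction k using Nat.twoStepInduction with
  | zero => simp
  | one =>
    simp only [Nat.cast_one, U_one, Polynomial.eval_mul, Polynomial.eval_ofNat, Polynomial.eval_X,
      ← mul_sub, abs_mul, Nat.abs_ofNat, pow_one]
    gcongr
    norm_num
  | more k ih₀ ih₁ =>
    have hk : ((k : ℝ) + 2) ≤ 2 * 8 ^ k := by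
      have : k + 1 ≤ 8 ^ k := k.lt_pow_self (by norm_num)
      have hone : (1 : ℝ) ≤ 8 ^ k := one_le_pow₀ (by norm_num)
      have : (k : ℝ) + 1 ≤ 8 ^ k := by exact_mod_cast this
      linarith
    have hU : |(U ℝ (k + 1)).eval c'| ≤ k + 2 := (abs_eval_U_le (k + 1) hc').trans_eq (by
      push_cast
      ring)
    push_cast at ih₁ ⊢
    rw [show (k : ℤ) + 2 = k + 1 + 1 by ring, eval_U_add_one (k + 1) c,
      eval_U_add_one (k + 1) c', add_sub_cancel_right]
    set u := (U ℝ (k + 1)).eval c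
    set u' := (U ℝ (k + 1)).eval c'
    set w := (U ℝ k).eval c
    set w' := (U ℝ k).eval c'
    calc |2 * c * u - w - (2 * c' * u' - w')|
        = |2 * (c * (u - u')) + 2 * ((c - c') * u') - (w - w')| := by ring_nf
      _ ≤ 2 * (|c| * |u - u'|) + 2 * (|c - c'| * |u'|) + |w - w'| := by
          have hadd := abs_add_le (2 * (c * (u - u'))) (2 * ((c - c') * u'))
          simp only [abs_mul, Nat.abs_ofNat] at hadd
          exact (abs_sub _ _).trans (add_le_add_left hadd _)
      _ ≤ 2 * (1 * (8 ^ (k + 1) * |c - c'|)) + 2 * (|c - c'| * (2 * 8 ^ k)) + 8 ^ k * |c - c'| := by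
          gcongr
          exact hU.trans hk
      _ ≤ 8 ^ (k + 2) * |c - c'| := by
          have : 0 ≤ 8 ^ k * |c - c'| := by positivity
          rw [pow_succ, pow_add]
          linarith

end Chebyshev

section Kernel

open Polynomial.Chebyshev

/-- The kernel by which the spectral distribution is smoothed: a polynomial of degree `8 * k`, which
is concentrated in an interval of length about `1 / k`. Like the Jackson kernel, it is a fourth
power of `sin ((k + 1) θ) / sin θ`, here with `cos θ = 1 - v ^ 2 / 8`. -/
noncomputable def kernel (k : ℕ) (v : ℝ) : ℝ := (U ℝ k).eval (1 - v ^ 2 / 8) ^ 4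

variable (k : ℕ) {v v' : ℝ}

theorem kernel_nonneg (v : ℝ) : 0 ≤ kernel k v := (show Even 4 by decide).pow_nonneg _

theorem sq_le_nine (hv : |v| ≤ 3) : v ^ 2 ≤ 9 := by
  rw [← sq_abs]
  nlinarith [abs_nonneg v]

theorem abs_one_sub_sq_div_le (hv : |v| ≤ 3) : |1 - v ^ 2 / 8| ≤ 1 := by
  have := sq_le_nine hv
  exact abs_le.2 ⟨by linarith, by linarith [sq_nonneg v]⟩

theorem sq_mul_eval_U_sq_le (hv : |v| ≤ 3) : v ^ 2 * (U ℝ k).eval (1 - v ^ 2 / 8) ^ 2 ≤ 10 := by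
  have hU := one_sub_sq_mul_eval_U_sq_le k (abs_one_sub_sq_div_le hv)
  have hle : v ^ 2 * (7 / 64) ≤ 1 - (1 - v ^ 2 / 8) ^ 2 := by
    nlinarith [sq_nonneg v, sq_le_nine hv]
  nlinarith [mul_le_mul_of_nonneg_right hle (sq_nonneg ((U ℝ k).eval (1 - v ^ 2 / 8)))]

theorem kernel_le_of_one_le_abs (hv : |v| ≤ 3) (hv' : 1 ≤ |v|) : kernel k v ≤ 100 := by
  have hU : (U ℝ k).eval (1 - v ^ 2 / 8) ^ 2 ≤ 10 :=
    (le_mul_of_one_le_left (sq_nonneg _) ((one_le_sq_iff_one_le_abs v).2 hv')).trans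
      (sq_mul_eval_U_sq_le k hv)
  calc kernel k v = ((U ℝ k).eval (1 - v ^ 2 / 8) ^ 2) ^ 2 := by rw [kernel, ← pow_mul]
    _ ≤ 10 ^ 2 := by gcongr
    _ = 100 := by norm_num

theorem eval_U_sq_mul_le (hv : |v| ≤ 3) :
    (U ℝ k).eval (1 - v ^ 2 / 8) ^ 2 * (1 + (k + 1) ^ 2 * v ^ 2) ≤ 11 * (k + 1) ^ 2 := by
  have hU : (U ℝ k).eval (1 - v ^ 2 / 8) ^ 2 ≤ (k + 1) ^ 2 :=
    sq_le_sq.2 ((abs_eval_U_le k (abs_one_sub_sq_div_le hv)).trans (le_abs_self _))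
  nlinarith [mul_le_mul_of_nonneg_left (sq_mul_eval_U_sq_le k hv) (sq_nonneg ((k : ℝ) + 1))]

theorem abs_mul_kernel_le (hv : |v| ≤ 3) :
    |v| * kernel k v ≤ 61 * (k + 1) ^ 3 / (1 + (k + 1) ^ 2 * v ^ 2) := by
  have hκ : 0 < (k : ℝ) + 1 := by positivity
  have hq := eval_U_sq_mul_le k hv
  rw [kernel, show 4 = 2 * 2 from rfl, pow_mul]
  set κ : ℝ := k + 1
  set q := (U ℝ k).eval (1 - v ^ 2 / 8) ^ 2
  have hamgm : 2 * κ * |v| ≤ 1 + κ ^ 2 * v ^ 2 := by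
    rw [← sq_abs v]
    nlinarith [sq_nonneg (κ * |v| - 1)]
  set s := 1 + κ ^ 2 * v ^ 2
  have hs : 0 < s := by positivity
  rw [le_div_iff₀ hs]
  refine le_of_mul_le_mul_left ?_ (by positivity : 0 < 2 * κ)
  calc 2 * κ * (|v| * q ^ 2 * s) = 2 * κ * |v| * (q ^ 2 * s) := by ring
    _ ≤ s * (q ^ 2 * s) := by gcongr
    _ = (q * s) ^ 2 := by ring
    _ ≤ (11 * κ ^ 2) ^ 2 := by gcongr
    _ ≤ 2 * κ * (61 * κ ^ 3) := by nlinarith [pow_pos hκ 4]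

theorem le_kernel (hv : |v| ≤ 2 / (k + 1)) : ((k : ℝ) + 1) ^ 4 / 16 ≤ kernel k v := by
  have hk : (1 : ℝ) ≤ k + 1 := by simp
  have hvk : v ^ 2 * (k + 1) ^ 2 ≤ 4 := by
    rw [le_div_iff₀ (by positivity)] at hv
    calc v ^ 2 * (k + 1) ^ 2 = (|v| * (k + 1)) ^ 2 := by rw [mul_pow, sq_abs]
      _ ≤ 2 ^ 2 := by gcongr
      _ = 4 := by norm_num
  have hv₃ : |v| ≤ 3 := hv.trans <| (div_le_self zero_le_two hk).trans (by norm_num)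
  have hU := le_eval_U k (abs_one_sub_sq_div_le hv₃)
  have hhalf : ((k : ℝ) + 1) / 2 ≤ (U ℝ k).eval (1 - v ^ 2 / 8) := by
    refine le_trans ?_ hU
    rw [div_eq_mul_inv]
    gcongr
    linarith
  calc ((k : ℝ) + 1) ^ 4 / 16 = ((k + 1) / 2) ^ 4 := by ring
    _ ≤ kernel k v := by
      rw [kernel]
      gcongr

theorem abs_kernel_sub_le (hv : |v| ≤ 3) (hv' : |v'| ≤ 3) :
    |kernel k v - kernel k v'| ≤ 3 * (k + 1) ^ 3 * 8 ^ k * |v - v'| := by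
  have hc := abs_one_sub_sq_div_le hv
  have hc' := abs_one_sub_sq_div_le hv'
  have hmax : max |(U ℝ k).eval (1 - v ^ 2 / 8)| |(U ℝ k).eval (1 - v' ^ 2 / 8)| ≤ k + 1 :=
    max_le (abs_eval_U_le k hc) (abs_eval_U_le k hc')
  have harg : |(1 - v ^ 2 / 8) - (1 - v' ^ 2 / 8)| ≤ 3 / 4 * |v - v'| := calc
    _ = |v + v'| / 8 * |v - v'| := by
        rw [← abs_of_pos (by norm_num : (0 : ℝ) < 8), ← abs_div, ← abs_mul, ← abs_neg]
        simp only [abs_of_pos (by norm_num : (0 : ℝ) < 8)]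
        ring_nf
    _ ≤ 3 / 4 * |v - v'| := by
        refine mul_le_mul_of_nonneg_right ?_ (abs_nonneg _)
        linarith [abs_add_le v v']
  calc |kernel k v - kernel k v'|
      ≤ |(U ℝ k).eval (1 - v ^ 2 / 8) - (U ℝ k).eval (1 - v' ^ 2 / 8)| * (4 : ℕ) *
          max |(U ℝ k).eval (1 - v ^ 2 / 8)| |(U ℝ k).eval (1 - v' ^ 2 / 8)| ^ 3 :=
        abs_pow_sub_pow_le _ _ _
    _ ≤ 8 ^ k * (3 / 4 * |v - v'|) * (4 : ℕ) * (k + 1) ^ 3 := by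
        gcongr
        exact (abs_eval_U_sub_le k hc hc').trans (by gcongr)
    _ = 3 * (k + 1) ^ 3 * 8 ^ k * |v - v'| := by
        push_cast
        ring

end Kernel

section RecurrenceLinear

variable {R S : Type*} [CommRing R] [CommRing S]

theorem isLinearMap_iterate_recurStep (e : Fin 4 → R) (k : ℕ) :
    IsLinearMap R (recurStep e)^[k] := by
  have hstep : IsLinearMap R (recurStep e) :=
    ⟨fun s s' => Prod.ext (funext fun j => by simp [recurStep]; ring) rfl,
      fun c s => Prod.ext (funext fun j => by simp [recurStep]; ring) rfl⟩
  have hpow := (hstep.mk' _ ^ k).isLinear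
  rw [Module.End.coe_pow] at hpow
  exact hpow

theorem isLinearMap_recur (e : Fin 4 → R) (k : ℕ) : IsLinearMap R (recur e k) :=
  ((LinearMap.fst R _ _).comp
    (((isLinearMap_iterate_recurStep e k).mk' _).comp (LinearMap.inl R _ _))).isLinear

theorem isLinearMap_kernelValue (k : ℕ) (M A : R) : IsLinearMap R (kernelValue k M A) :=
  ((LinearMap.proj 0).comp (((isLinearMap_recur (coeff M A) k).mk' _) ^ 4)).isLinear

theorem map_recur (φ : R →+* S) (e : Fin 4 → R) (k : ℕ) (f : ℕ → R) :
    φ ∘ recur e k f = recur (φ ∘ e) k (φ ∘ f) := by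
  let Φ (s : (ℕ → R) × (ℕ → R)) : (ℕ → S) × (ℕ → S) := (φ ∘ s.1, φ ∘ s.2)
  have hΦ : Function.Semiconj Φ (recurStep e) (recurStep (φ ∘ e)) := fun s =>
    Prod.ext (funext fun j => by simp [Φ, recurStep]) rfl
  have h := congrArg Prod.fst (hΦ.iterate_right k (f, 0))
  simpa [Φ, recur, show φ ∘ (0 : ℕ → R) = 0 from funext fun _ => map_zero φ] using h

theorem map_coeff (φ : R →+* S) (M A : R) : φ ∘ coeff M A = coeff (φ M) (φ A) := by
  funext i
  fin_cases i <;> simp [coeff, map_ofNat]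

theorem map_kernelValue (φ : R →+* S) (k : ℕ) (M A : R) (f : ℕ → R) :
    φ (kernelValue k M A f) = kernelValue k (φ M) (φ A) (φ ∘ f) := by
  have h : Function.Semiconj (φ ∘ ·) (recur (coeff M A) k) (recur (coeff (φ M) (φ A)) k) :=
    fun f => map_coeff φ M A ▸ map_recur φ _ k f
  exact congrFun (h.iterate_right 4 f) 0

end RecurrenceLinear

section Moments

open Polynomial.Chebyshev

variable {M A : ℝ}

theorem iterate_recurStep_coeff_pow (hM : M ≠ 0) (y : ℝ) (t : ℕ) :
    (recurStep (coeff M A))^[t] (fun j => y ^ j, 0) =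
      (fun j => (4 * M ^ 2) ^ t * (U ℝ t).eval (1 - (A / M - 2 + y) ^ 2 / 8) * y ^ j,
        fun j => (4 * M ^ 2) ^ t / (4 * M ^ 2) *
          (U ℝ (t - 1)).eval (1 - (A / M - 2 + y) ^ 2 / 8) * y ^ j) := by
  induction t with
  | zero => simp [Pi.zero_def]
  | succ t ih =>
    rw [Function.iterate_succ_apply', ih]
    refine Prod.ext (funext fun j => ?_) (funext fun j => ?_)
    · push_cast
      rw [eval_U_add_one]
      simp only [recurStep, coeff, Matrix.cons_val]
      field_simp
      ring
    · simp [recurStep, pow_succ, hM]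

theorem recur_coeff_pow (hM : M ≠ 0) (k : ℕ) (y : ℝ) :
    recur (coeff M A) k (fun j => y ^ j) =
      ((4 * M ^ 2) ^ k * (U ℝ k).eval (1 - (A / M - 2 + y) ^ 2 / 8)) • fun j => y ^ j :=
  congrArg Prod.fst (iterate_recurStep_coeff_pow hM y k)

theorem kernelValue_pow (hM : M ≠ 0) (k : ℕ) (y : ℝ) :
    kernelValue k M A (fun j => y ^ j) = (4 * M ^ 2) ^ (4 * k) * kernel k (A / M - 2 + y) := by
  have hiterate (s : ℕ) : (recur (coeff M A) k)^[s] (fun j => y ^ j) =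
      ((4 * M ^ 2) ^ k * (U ℝ k).eval (1 - (A / M - 2 + y) ^ 2 / 8)) ^ s • fun j => y ^ j := by
    induction s with
    | zero => simp
    | succ s ih =>
      rw [Function.iterate_succ_apply', ih, (isLinearMap_recur _ k).map_smul,
        recur_coeff_pow hM, smul_smul, ← pow_succ]
  rw [kernelValue, hiterate, kernel, mul_comm 4 k, pow_mul]
  simp [mul_pow]

theorem kernelValue_sum_mul_pow {ι : Type*} [Fintype ι] (hM : M ≠ 0) (k : ℕ) (g y : ι → ℝ) :
    kernelValue k M A (fun j => ∑ i, g i * y i ^ j) =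
      (4 * M ^ 2) ^ (4 * k) * ∑ i, g i * kernel k (A / M - 2 + y i) := by
  have hsum : (fun j => ∑ i, g i * y i ^ j) = ∑ i, g i • fun j => y i ^ j := by
    funext j
    simp
  rw [hsum, Finset.mul_sum]
  refine (map_sum ((isLinearMap_kernelValue k M A).mk' _) _ _).trans ?_
  refine Finset.sum_congr rfl fun i _ => ((isLinearMap_kernelValue k M A).map_smul _ _).trans ?_
  rw [kernelValue_pow hM, smul_eq_mul, mul_left_comm]

theorem abs_iterate_recurStep_coeff_le (hA : 0 ≤ A) (hAM : A ≤ 4 * M) {f : ℕ → ℝ} {η : ℝ}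
    (hη : 0 ≤ η) (t : ℕ) : ∀ L, (∀ j ≤ L + 2 * t, |f j| ≤ η) → ∀ j ≤ L,
      |((recurStep (coeff M A))^[t] (f, 0)).1 j| ≤ (20 * M ^ 2) ^ t * η ∧
        4 * M ^ 2 * |((recurStep (coeff M A))^[t] (f, 0)).2 j| ≤ (20 * M ^ 2) ^ t * η := by
  induction t with
  | zero => exact fun L hf j hj => ⟨by simpa using hf j (by omega), by simpa using hη⟩
  | succ t ih =>
    intro L hf j hj
    have ih := ih (L + 2) fun j hj => hf j (by omega)
    rw [Function.iterate_succ_apply']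
    set s := (recurStep (coeff M A))^[t] (f, 0)
    set E := (20 * M ^ 2) ^ t * η
    have hE : (20 * M ^ 2) ^ (t + 1) * η = 20 * (M ^ 2 * E) := by ring
    have hME : 0 ≤ M ^ 2 * E := by positivity
    have hterm (i : Fin 4) {b : ℝ} : |coeff M A i * b| ≤
        ![8 * M ^ 2, 4 * M ^ 2, M ^ 2, 16 * M ^ 4] i * |b| :=
      (abs_mul _ _).trans_le (mul_le_mul_of_nonneg_right (abs_coeff_le hA hAM i) (abs_nonneg b))
    rw [hE]
    constructor
    · calc |(recurStep (coeff M A) s).1 j|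
          ≤ |coeff M A 0 * s.1 j| + |coeff M A 1 * s.1 (j + 1)| + |coeff M A 2 * s.1 (j + 2)| +
            |coeff M A 3 * s.2 j| :=
            (abs_add_le _ _).trans (by gcongr; exact abs_add_three _ _ _)
        _ ≤ 8 * M ^ 2 * |s.1 j| + 4 * M ^ 2 * |s.1 (j + 1)| + M ^ 2 * |s.1 (j + 2)| +
            16 * M ^ 4 * |s.2 j| := by
            gcongr <;> apply hterm
        _ = 8 * M ^ 2 * |s.1 j| + 4 * M ^ 2 * |s.1 (j + 1)| + M ^ 2 * |s.1 (j + 2)| +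
            4 * M ^ 2 * (4 * M ^ 2 * |s.2 j|) := by ring
        _ ≤ 8 * M ^ 2 * E + 4 * M ^ 2 * E + M ^ 2 * E + 4 * M ^ 2 * E := by
            gcongr
            · exact (ih j (by omega)).1
            · exact (ih (j + 1) (by omega)).1
            · exact (ih (j + 2) (by omega)).1
            · exact (ih j (by omega)).2
        _ ≤ 20 * (M ^ 2 * E) := by linarith
    · calc 4 * M ^ 2 * |s.1 j| ≤ 4 * M ^ 2 * E := by
            gcongr
            exact (ih j (by omega)).1
        _ ≤ 20 * (M ^ 2 * E) := by linarith

theorem abs_recur_coeff_le (hA : 0 ≤ A) (hAM : A ≤ 4 * M) {f : ℕ → ℝ} {η : ℝ} (hη : 0 ≤ η)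
    {k L : ℕ} (hf : ∀ j ≤ L + 2 * k, |f j| ≤ η) :
    ∀ j ≤ L, |recur (coeff M A) k f j| ≤ (20 * M ^ 2) ^ k * η := fun j hj =>
  (abs_iterate_recurStep_coeff_le hA hAM hη k L hf j hj).1

theorem abs_iterate_recur_coeff_le (hA : 0 ≤ A) (hAM : A ≤ 4 * M) {f : ℕ → ℝ} {η : ℝ}
    (hη : 0 ≤ η) (k s : ℕ) : ∀ L, (∀ j ≤ L + 2 * k * s, |f j| ≤ η) →
      ∀ j ≤ L, |(recur (coeff M A) k)^[s] f j| ≤ (20 * M ^ 2) ^ (k * s) * η := by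
  induction s with
  | zero => exact fun L hf j hj => by simpa using hf j (by omega)
  | succ s ih =>
    intro L hf j hj
    rw [Function.iterate_succ_apply', mul_add_one, pow_add, mul_right_comm, mul_comm]
    refine abs_recur_coeff_le hA hAM (by positivity) (ih (L + 2 * k) fun j hj => hf j ?_) j hj
    linarith

theorem abs_kernelValue_le (hA : 0 ≤ A) (hAM : A ≤ 4 * M) {f : ℕ → ℝ} {η : ℝ} (hη : 0 ≤ η)
    {k : ℕ} (hf : ∀ j ≤ 8 * k, |f j| ≤ η) :
    |kernelValue k M A f| ≤ (4 * M ^ 2) ^ (4 * k) * (625 ^ k * η) :=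
  calc |kernelValue k M A f| ≤ (20 * M ^ 2) ^ (k * 4) * η :=
        abs_iterate_recur_coeff_le hA hAM hη k 4 0 (fun j hj => hf j (by omega)) 0 le_rfl
    _ = (4 * M ^ 2) ^ (4 * k) * (625 ^ k * η) := by
        rw [show 20 * M ^ 2 = 4 * M ^ 2 * 5 by ring, mul_pow, mul_comm k 4, pow_mul 5]
        norm_num [mul_assoc]

theorem abs_kernelValue_sub_le {ι : Type*} [Fintype ι] (hM : 0 < M) (hA : 0 ≤ A)
    (hAM : A ≤ 4 * M) {f : ℕ → ℝ} {g y : ι → ℝ} {η : ℝ} (hη : 0 ≤ η) {k : ℕ}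
    (hf : ∀ j ≤ 8 * k, |f j - ∑ i, g i * y i ^ j| ≤ η) :
    |kernelValue k M A f - (4 * M ^ 2) ^ (4 * k) * ∑ i, g i * kernel k (A / M - 2 + y i)| ≤
      (4 * M ^ 2) ^ (4 * k) * (625 ^ k * η) := by
  rw [← kernelValue_sum_mul_pow hM.ne' k g y, ← (isLinearMap_kernelValue k M A).map_sub]
  exact abs_kernelValue_le hA hAM hη hf

end Moments

section GridSums

theorem sum_antitoneOn_abs_sub_le {φ : ℝ → ℝ} (hφ₀ : ∀ x, 0 ≤ φ x)
    (hφ : AntitoneOn φ (Set.Ici 0)) {n : ℕ} {θ : ℝ} (hθ : 0 ≤ θ) (hθn : θ ≤ n) :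
    ∑ a ∈ Finset.range n, φ |a - θ| ≤ 2 * ∑ a ∈ Finset.range n, φ a := by
  set c := ⌈θ⌉₊
  have hθc : θ ≤ c := Nat.le_ceil θ
  have hcθ : (c : ℝ) < θ + 1 := Nat.ceil_lt_add_one hθ
  have hcn : c ≤ n := Nat.ceil_le.mpr hθn
  have hle {x y : ℝ} (hx : 0 ≤ x) (hxy : x ≤ y) : φ y ≤ φ x := hφ hx (hx.trans hxy) hxy
  have hmono {m : ℕ} (hm : m ≤ n) : ∑ a ∈ Finset.range m, φ a ≤ ∑ a ∈ Finset.range n, φ a :=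
    Finset.sum_le_sum_of_subset_of_nonneg (Finset.range_mono hm) fun _ _ _ => hφ₀ _
  rw [← Finset.sum_range_add_sum_Ico _ hcn, two_mul, Finset.sum_Ico_eq_sum_range]
  refine add_le_add ?_ ?_
  · calc ∑ a ∈ Finset.range c, φ |a - θ|
        ≤ ∑ a ∈ Finset.range c, φ ((c - 1 - a : ℕ) : ℝ) := by
          refine Finset.sum_le_sum fun a ha => hle (Nat.cast_nonneg _) ?_
          have ha' : a + 1 ≤ c := Finset.mem_range.mp ha
          rw [Nat.sub_sub, Nat.cast_sub (by omega), abs_sub_comm]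
          push_cast
          exact le_trans (by linarith) (le_abs_self _)
      _ = ∑ a ∈ Finset.range c, φ a := Finset.sum_range_reflect (fun a : ℕ => φ a) c
      _ ≤ ∑ a ∈ Finset.range n, φ a := hmono hcn
  · refine (Finset.sum_le_sum fun a _ => hle (Nat.cast_nonneg a) ?_).trans (hmono (n.sub_le c))
    push_cast
    exact le_trans (by linarith) (le_abs_self _)

theorem antitoneOn_inv_one_add_div_sq {s : ℝ} (hs : 0 < s) :
    AntitoneOn (fun x : ℝ => (1 + (x / s) ^ 2)⁻¹) (Set.Ici 0) := fun x (hx : 0 ≤ x) y _ hxy => by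
  dsimp only
  gcongr

theorem sum_inv_one_add_div_sq_le {s : ℝ} (hs : 2 ≤ s) (n : ℕ) :
    ∑ a ∈ Finset.range n, (1 + (a / s) ^ 2)⁻¹ ≤ 4 * s := by
  have hs₀ : 0 < s := by linarith
  have hintegral : ∑ a ∈ Finset.range n, (1 + (((a + 1 : ℕ) : ℝ) / s) ^ 2)⁻¹ ≤ s * (Real.pi / 2) :=
    calc _ ≤ ∫ x in (0 : ℝ)..n, (1 + (x / s) ^ 2)⁻¹ := by
          simpa using ((antitoneOn_inv_one_add_div_sq hs₀).mono
            (fun x hx => hx.1 : Set.Icc 0 (0 + (n : ℝ)) ⊆ _)).sum_le_integral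
      _ = s * Real.arctan (n / s) := by
          rw [intervalIntegral.integral_comp_div (fun x => (1 + x ^ 2)⁻¹) hs₀.ne',
            integral_inv_one_add_sq]
          simp
      _ ≤ s * (Real.pi / 2) := by
          gcongr
          exact (Real.arctan_lt_pi_div_two _).le
  calc ∑ a ∈ Finset.range n, (1 + (a / s) ^ 2)⁻¹
      ≤ ∑ a ∈ Finset.range (n + 1), (1 + (a / s) ^ 2)⁻¹ :=
        Finset.sum_le_sum_of_subset_of_nonneg (Finset.range_mono n.le_succ)
          fun _ _ _ => by positivity
    _ ≤ s * (Real.pi / 2) + 1 := by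
        rw [Finset.sum_range_succ']
        simpa using hintegral
    _ ≤ 4 * s := by nlinarith [Real.pi_le_four]

variable {k M : ℕ} {l : ℝ}

theorem abs_div_sub_one_sub_le {a : ℕ} (ha : a < 4 * M) (hl₀ : 0 ≤ l) (hl₂ : l ≤ 2) :
    |(a : ℝ) / M - 1 - l| ≤ 3 := by
  have hM : (0 : ℝ) < M := by
    have : 0 < M := by omega
    exact_mod_cast this
  have ha₀ : 0 ≤ (a : ℝ) / M := by positivity
  have ha₄ : (a : ℝ) / M ≤ 4 := (div_le_iff₀ hM).2 (by exact_mod_cast ha.le)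
  exact abs_le.2 ⟨by linarith, by linarith⟩

theorem sum_abs_mul_kernel_le (hM : 2 * (k + 1) ≤ M) (hl₀ : 0 ≤ l) (hl₂ : l ≤ 2) :
    ∑ a ∈ Finset.range (4 * M), |(a : ℝ) / M - 1 - l| * kernel k (a / M - 1 - l) ≤
      488 * M * (k + 1) ^ 2 := by
  have hk : (0 : ℝ) < k + 1 := by positivity
  have hM' : 2 * ((k : ℝ) + 1) ≤ M := by exact_mod_cast hM
  have hM₀ : (0 : ℝ) < M := by linarith
  set s : ℝ := M / (k + 1) with hs
  have hs₂ : 2 ≤ s := (le_div_iff₀ hk).2 hM'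
  have hs₀ : 0 < s := by linarith
  calc ∑ a ∈ Finset.range (4 * M), |(a : ℝ) / M - 1 - l| * kernel k (a / M - 1 - l)
      ≤ ∑ a ∈ Finset.range (4 * M),
          61 * ((k : ℝ) + 1) ^ 3 * (1 + (|a - M * (1 + l)| / s) ^ 2)⁻¹ := by
        refine Finset.sum_le_sum fun a ha => ?_
        refine (abs_mul_kernel_le k
          (abs_div_sub_one_sub_le (Finset.mem_range.mp ha) hl₀ hl₂)).trans_eq ?_
        rw [div_pow |_|, sq_abs, div_eq_mul_inv, hs]
        congr 3
        field_simp
        ring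
    _ ≤ 61 * (k + 1) ^ 3 * (2 * (4 * s)) := by
        rw [← Finset.mul_sum]
        gcongr
        refine (sum_antitoneOn_abs_sub_le (fun x => by positivity)
          (antitoneOn_inv_one_add_div_sq hs₀) (by positivity) ?_).trans ?_
        · push_cast
          nlinarith
        · gcongr
          exact sum_inv_one_add_div_sq_le hs₂ _
    _ = 488 * M * (k + 1) ^ 2 := by
        rw [hs]
        field_simp
        ring

/-- The sum of the kernel over the points of the grid of mesh `1 / M` in `[-1, 1]`, which carry most
of its mass. -/
noncomputable def centralSum (k M : ℕ) : ℝ :=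
  ∑ j ∈ Finset.range (2 * M), kernel k ((j - M) / M)

theorem le_centralSum (hk : 3 ≤ k) (hM : 4 ≤ M) :
    (M : ℝ) * (k + 1) ^ 3 / 8 ≤ centralSum k M := by
  have hk₀ : (0 : ℝ) < k + 1 := by positivity
  have hM₀ : (0 : ℝ) < M := by positivity
  set c := ⌊2 * (M : ℝ) / (k + 1)⌋₊
  have hc : (c : ℝ) ≤ 2 * M / (k + 1) := Nat.floor_le (by positivity)
  have hcM : M + (c + 1) ≤ 2 * M := by
    have hhalf : 2 * (M : ℝ) / (k + 1) ≤ M / 2 := by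
      rw [div_le_div_iff₀ hk₀ (by norm_num)]
      have : (3 : ℝ) ≤ k := by exact_mod_cast hk
      nlinarith
    have : (4 : ℝ) ≤ M := by exact_mod_cast hM
    have : (M : ℝ) + (c + 1) ≤ 2 * M := by linarith
    exact_mod_cast this
  calc (M : ℝ) * (k + 1) ^ 3 / 8 = 2 * M / (k + 1) * ((k + 1) ^ 4 / 16) := by
        field_simp
        ring
    _ ≤ (c + 1 : ℕ) * (((k : ℝ) + 1) ^ 4 / 16) := by
        push_cast
        gcongr
        exact (Nat.lt_floor_add_one _).le
    _ = (Finset.range (c + 1)).card • (((k : ℝ) + 1) ^ 4 / 16) := by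
        rw [Finset.card_range, nsmul_eq_mul]
    _ ≤ ∑ j ∈ Finset.range (c + 1), kernel k (((M + j : ℕ) - M) / M) := by
        refine Finset.card_nsmul_le_sum _ _ _ fun j hj => le_kernel k ?_
        have hj : (j : ℝ) ≤ c := by exact_mod_cast Finset.mem_range_succ_iff.1 hj
        rw [Nat.cast_add, add_sub_cancel_left, abs_of_nonneg (by positivity), div_le_iff₀ hM₀]
        exact (hj.trans hc).trans_eq (by ring)
    _ ≤ centralSum k M := by
        obtain ⟨r, hr⟩ := Nat.exists_eq_add_of_le hcM
        rw [centralSum, hr, Finset.sum_range_add _ _ r, Finset.sum_range_add _ M (c + 1)]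
        refine le_add_of_le_of_nonneg (le_add_of_nonneg_left ?_) ?_
        all_goals exact Finset.sum_nonneg fun _ _ => kernel_nonneg _ _

theorem abs_sum_kernel_sub_centralSum_le (hM : 12 * (k + 1) ^ 3 * 8 ^ k ≤ M) (hl₀ : 0 ≤ l)
    (hl₂ : l ≤ 2) :
    |∑ j ∈ Finset.range (2 * M), kernel k ((⌈l * M⌉₊ + j : ℕ) / M - 1 - l) - centralSum k M| ≤
      M := by
  have hM₀ : (0 : ℝ) < M := by
    have : 0 < M := lt_of_lt_of_le (by positivity) hM
    exact_mod_cast this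
  have hc₁ : l * M ≤ ⌈l * M⌉₊ := Nat.le_ceil _
  have hc₂ : (⌈l * M⌉₊ : ℝ) < l * M + 1 := Nat.ceil_lt_add_one (by positivity)
  have hcM : ⌈l * M⌉₊ ≤ 2 * M := Nat.ceil_le.2 (by push_cast; gcongr)
  rw [centralSum, ← Finset.sum_sub_distrib]
  calc _ ≤ ∑ j ∈ Finset.range (2 * M), 3 * ((k : ℝ) + 1) ^ 3 * 8 ^ k * (1 / M) := by
        refine (Finset.abs_sum_le_sum_abs _ _).trans (Finset.sum_le_sum fun j hj => ?_)
        have hj := Finset.mem_range.1 hj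
        have hj' : (j : ℝ) < 2 * M := by exact_mod_cast hj
        have hjM : |((j : ℝ) - M) / M| ≤ 3 := by
          rw [abs_div, abs_of_pos hM₀, div_le_iff₀ hM₀]
          exact abs_le.2 ⟨by linarith [j.cast_nonneg (α := ℝ)], by linarith⟩
        refine (abs_kernel_sub_le k (abs_div_sub_one_sub_le (by omega) hl₀ hl₂) hjM).trans ?_
        gcongr
        rw [show ((⌈l * M⌉₊ + j : ℕ) : ℝ) / M - 1 - l - (j - M) / M = (⌈l * M⌉₊ - l * M) / M by
          push_cast; field_simp; ring, abs_of_nonneg (div_nonneg (by linarith) hM₀.le)]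
        gcongr
        linarith
    _ ≤ 12 * ((k : ℝ) + 1) ^ 3 * 8 ^ k := by
        rw [Finset.sum_const, Finset.card_range, nsmul_eq_mul]
        push_cast
        field_simp
        norm_num
    _ ≤ M := by exact_mod_cast hM

theorem sum_kernel_mem_Icc (hM : 12 * (k + 1) ^ 3 * 8 ^ k ≤ M) (hl₀ : 0 ≤ l) (hl₂ : l ≤ 2) :
    ∑ a ∈ Finset.range (4 * M), kernel k (a / M - 1 - l) ∈
      Set.Icc (centralSum k M - M) (centralSum k M + 201 * M) := by
  have hM₀ : (0 : ℝ) < M := by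
    have : 0 < M := lt_of_lt_of_le (by positivity) hM
    exact_mod_cast this
  set c := ⌈l * M⌉₊
  have hcM : c ≤ 2 * M := Nat.ceil_le.2 (by push_cast; gcongr)
  have hcentral := abs_le.1 (abs_sum_kernel_sub_centralSum_le hM hl₀ hl₂)
  have hsplit : ∑ a ∈ Finset.range (4 * M), kernel k (a / M - 1 - l) =
      ∑ a ∈ Finset.range c, kernel k (a / M - 1 - l) +
        ∑ j ∈ Finset.range (2 * M), kernel k ((c + j : ℕ) / M - 1 - l) +
        ∑ a ∈ Finset.Ico (c + 2 * M) (4 * M), kernel k (a / M - 1 - l) := by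
    rw [← Finset.sum_range_add_sum_Ico _ (by omega : c + 2 * M ≤ 4 * M), Finset.sum_range_add]
  have hleft : ∑ a ∈ Finset.range c, kernel k (a / M - 1 - l) ≤ c * 100 := by
    refine (Finset.sum_le_card_nsmul _ _ 100 fun a ha => ?_).trans_eq (by simp)
    rw [Finset.mem_range] at ha
    refine kernel_le_of_one_le_abs k (abs_div_sub_one_sub_le (by omega) hl₀ hl₂) ?_
    have : (a : ℝ) / M ≤ l := (div_le_iff₀ hM₀).2 (Nat.lt_ceil.1 ha).le
    exact le_abs.2 (.inr (by linarith))
  have hright : ∑ a ∈ Finset.Ico (c + 2 * M) (4 * M), kernel k (a / M - 1 - l) ≤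
      (2 * M - c) * 100 := by
    have hcard : ((2 * M - c : ℝ)) = (Finset.Ico (c + 2 * M) (4 * M)).card := by
      rw [Nat.card_Ico, Nat.cast_sub (by omega)]
      push_cast
      ring
    rw [hcard, ← nsmul_eq_mul]
    refine Finset.sum_le_card_nsmul _ _ _ fun a ha => ?_
    obtain ⟨hca, haM⟩ := Finset.mem_Ico.1 ha
    refine kernel_le_of_one_le_abs k (abs_div_sub_one_sub_le haM hl₀ hl₂) ?_
    have : (c : ℝ) + 2 * M ≤ a := by exact_mod_cast hca
    have : l + 2 ≤ a / M := (le_div_iff₀ hM₀).2 (by linarith [Nat.le_ceil (l * M)])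
    exact le_abs.2 (.inl (by linarith))
  have hnonneg (s : Finset ℕ) : 0 ≤ ∑ a ∈ s, kernel k (a / M - 1 - l) :=
    Finset.sum_nonneg fun _ _ => kernel_nonneg _ _
  rw [hsplit]
  exact ⟨by linarith [hnonneg (.range c), hnonneg (.Ico (c + 2 * M) (4 * M))], by linarith⟩

end GridSums

/-! ### Transport between finitely supported distributions -/

section Transport

variable {ι κ : Type*} [Fintype ι] [Fintype κ]

/-- The finitely supported measure with mass `p i` at the point `x i`. -/
noncomputable def discreteMeasure (p x : ι → ℝ) : Measure ℝ :=
  ∑ i, ENNReal.ofReal (p i) • Measure.dirac (x i)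

theorem W1_discreteMeasure_le_of_plan (x : ι → ℝ) (y : κ → ℝ) {p : ι → ℝ} {q : κ → ℝ}
    {π : ι → κ → ℝ} (hπ : ∀ i j, 0 ≤ π i j) (hrow : ∀ i, ∑ j, π i j = p i)
    (hcol : ∀ j, ∑ i, π i j = q j) :
    W1 (discreteMeasure p x) (discreteMeasure q y) ≤
      ENNReal.ofReal (∑ i, ∑ j, π i j * |x i - y j|) := by
  have hmap {f : ℝ × ℝ → ℝ} (hf : Measurable f) :
      (∑ i, ∑ j, ENNReal.ofReal (π i j) • Measure.dirac (x i, y j)).map f =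
        ∑ i, ∑ j, ENNReal.ofReal (π i j) • Measure.dirac (f (x i, y j)) := by
    simp only [Measure.map_finset_sum hf.aemeasurable, Measure.map_smul, Measure.map_dirac' hf]
  refine (iInf_le _ (∑ i, ∑ j, ENNReal.ofReal (π i j) • Measure.dirac (x i, y j))).trans <|
    (iInf_le _ ?_).trans <| (iInf_le _ ?_).trans_eq ?_
  · simp only [hmap measurable_fst, ← Finset.sum_smul, discreteMeasure, ← hrow,
      ENNReal.ofReal_sum_of_nonneg fun j _ => hπ _ j]
  · rw [hmap measurable_snd, Finset.sum_comm]
    simp only [← Finset.sum_smul, discreteMeasure, ← hcol,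
      ENNReal.ofReal_sum_of_nonneg fun i _ => hπ i _]
  · have hcost i j : 0 ≤ π i j * |x i - y j| := mul_nonneg (hπ i j) (abs_nonneg _)
    simp only [lintegral_finsetSum_measure, lintegral_smul_measure, lintegral_dirac, smul_eq_mul,
      ENNReal.ofReal_sum_of_nonneg fun i _ => Finset.sum_nonneg fun j _ => hcost i j,
      ENNReal.ofReal_sum_of_nonneg fun j _ => hcost _ j, ENNReal.ofReal_mul (hπ _ _)]

theorem mul_sum_div_sum {c : κ → ℝ} (hc : ∀ j, 0 ≤ c j) (j : κ) :
    c j * (∑ j, c j) / ∑ j, c j = c j :=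
  mul_div_cancel_of_imp fun h₀ =>
    (Finset.sum_eq_zero_iff_of_nonneg fun j _ => hc j).1 h₀ j (Finset.mem_univ j)

theorem exists_plan {r : ι → ℝ} {c : κ → ℝ} (hr : ∀ i, 0 ≤ r i) (hc : ∀ j, 0 ≤ c j)
    (h : ∑ i, r i = ∑ j, c j) :
    ∃ t : ι → κ → ℝ, (∀ i j, 0 ≤ t i j) ∧ (∀ i, ∑ j, t i j = r i) ∧ ∀ j, ∑ i, t i j = c j := by
  refine ⟨fun i j => r i * c j / ∑ j, c j, fun i j => ?_, fun i => ?_, fun j => ?_⟩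
  · exact div_nonneg (mul_nonneg (hr i) (hc j)) (Finset.sum_nonneg fun j _ => hc j)
  · rw [← Finset.sum_div, ← Finset.mul_sum, ← h, mul_sum_div_sum hr]
  · rw [← Finset.sum_div, ← Finset.sum_mul, h, mul_comm, mul_sum_div_sum hc]

theorem W1_discreteMeasure_le_of_subplan (x : ι → ℝ) (y : κ → ℝ) {p : ι → ℝ} {q : κ → ℝ}
    {a : ι → κ → ℝ} {d : ℝ} (hd : ∀ i j, |x i - y j| ≤ d) (hpq : ∑ i, p i = ∑ j, q j)
    (ha : ∀ i j, 0 ≤ a i j) (hrow : ∀ i, ∑ j, a i j ≤ p i) (hcol : ∀ j, ∑ i, a i j ≤ q j) :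
    W1 (discreteMeasure p x) (discreteMeasure q y) ≤
      ENNReal.ofReal (∑ i, ∑ j, a i j * |x i - y j| + d * (∑ j, q j - ∑ j, ∑ i, a i j)) := by
  obtain ⟨t, ht, htrow, htcol⟩ := exists_plan (fun i => sub_nonneg.2 (hrow i))
    (fun j => sub_nonneg.2 (hcol j)) (by
      rw [Finset.sum_sub_distrib, Finset.sum_sub_distrib, hpq, Finset.sum_comm])
  refine (W1_discreteMeasure_le_of_plan x y (π := fun i j => a i j + t i j)
    (fun i j => add_nonneg (ha i j) (ht i j)) (fun i => ?_) fun j => ?_).trans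
    (ENNReal.ofReal_le_ofReal ?_)
  · rw [Finset.sum_add_distrib, htrow, add_sub_cancel]
  · rw [Finset.sum_add_distrib, htcol, add_sub_cancel]
  · simp only [add_mul, Finset.sum_add_distrib]
    gcongr
    calc ∑ i, ∑ j, t i j * |x i - y j| ≤ ∑ i, ∑ j, t i j * d := by
          gcongr with i _ j _
          · exact ht i j
          · exact hd i j
      _ = d * (∑ j, q j - ∑ j, ∑ i, a i j) := by
          simp only [← Finset.sum_mul]
          rw [Finset.sum_comm]
          simp only [htcol, Finset.sum_sub_distrib, mul_comm]

theorem exists_le_sum_eq_min {b : ι → ℝ} {w : ℝ} (hb : ∀ i, 0 ≤ b i) (hw : 0 ≤ w) :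
    ∃ a : ι → ℝ, (∀ i, 0 ≤ a i) ∧ (∀ i, a i ≤ b i) ∧ ∑ i, a i = min (∑ i, b i) w := by
  have hb₀ : 0 ≤ ∑ i, b i := Finset.sum_nonneg fun i _ => hb i
  refine ⟨fun i => b i * min 1 (w / ∑ i, b i), fun i => ?_, fun i => ?_, ?_⟩
  · exact mul_nonneg (hb i) (le_min zero_le_one (div_nonneg hw hb₀))
  · exact mul_le_of_le_one_right (hb i) (min_le_left _ _)
  · rw [← Finset.sum_mul]
    rcases hb₀.eq_or_lt with h | h
    · rw [← h, zero_mul, min_eq_left hw]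
    · rw [mul_min_of_nonneg _ _ h.le, mul_one, mul_div_cancel₀ _ h.ne']

theorem one_sub_sum_min_div_le {β w : κ → ℝ} {Z e E : ℝ} (hZ : 0 < Z) (htot : Z - e ≤ ∑ j, β j)
    (hβZ : ∑ j, β j ≤ Z) (hE : ∑ j, |w j - β j| ≤ E) :
    1 - (∑ j, min (β j) (w j)) / max Z (∑ j, w j) ≤ (e + 2 * E) / Z := by
  set T := max Z (∑ j, w j)
  have hZT : Z ≤ T := le_max_left _ _
  have hE₀ : 0 ≤ E := (Finset.sum_nonneg fun j _ => abs_nonneg _).trans hE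
  have hT : T ≤ Z + E := by
    have : ∑ j, w j - ∑ j, β j ≤ E := by
      rw [← Finset.sum_sub_distrib]
      exact (Finset.sum_le_sum fun j _ => le_abs_self _).trans hE
    exact max_le (by linarith) (by linarith)
  have hmin : ∑ j, β j - ∑ j, min (β j) (w j) ≤ E := by
    rw [← Finset.sum_sub_distrib]
    refine (Finset.sum_le_sum fun j _ => ?_).trans hE
    rcases min_cases (β j) (w j) with ⟨h, -⟩ | ⟨h, -⟩ <;> rw [h]
    · rw [sub_self]
      exact abs_nonneg _
    · rw [abs_sub_comm]
      exact le_abs_self _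
  have hminT : ∑ j, min (β j) (w j) ≤ T :=
    (Finset.sum_le_sum fun j _ => min_le_right _ _).trans (le_max_right _ _)
  calc 1 - (∑ j, min (β j) (w j)) / T = (T - ∑ j, min (β j) (w j)) / T := by
        rw [sub_div, div_self (hZ.trans_le hZT).ne']
    _ ≤ (T - ∑ j, min (β j) (w j)) / Z :=
        div_le_div_of_nonneg_left (sub_nonneg.2 hminT) hZ hZT
    _ ≤ (e + 2 * E) / Z := by
        gcongr
        linarith

/-- Spreading each `p i` along a nearly stochastic kernel `b / Z`, and then perturbing the resulting
weights, moves the distribution only by the mean displacement of the kernel and the defects. -/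
theorem W1_discreteMeasure_le_of_kernel (x : ι → ℝ) (y : κ → ℝ) {p : ι → ℝ} {w : κ → ℝ}
    {b : ι → κ → ℝ} {d Z e E : ℝ} (hd : ∀ i j, |x i - y j| ≤ d) (hd₀ : 0 ≤ d)
    (hp : ∑ i, p i = 1) (hb : ∀ i j, 0 ≤ b i j) (hw : ∀ j, 0 ≤ w j) (hW : 0 < ∑ j, w j)
    (hZ : 0 < Z) (hrow : ∀ i, ∑ j, b i j ≤ p i * Z) (htot : Z - e ≤ ∑ j, ∑ i, b i j)
    (hE : ∑ j, |w j - ∑ i, b i j| ≤ E) :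
    W1 (discreteMeasure p x) (discreteMeasure (fun j => w j / ∑ j, w j) y) ≤
      ENNReal.ofReal ((∑ i, ∑ j, b i j * |x i - y j| + d * (e + 2 * E)) / Z) := by
  -- The plan is `b` cut down to the weights `w`, and normalized by the larger of the two masses.
  choose a ha₀ hab hsum using fun j => exists_le_sum_eq_min (fun i => hb i j) (hw j)
  set T := max Z (∑ j, w j)
  have hZT : Z ≤ T := le_max_left _ _
  have hT : 0 < T := hZ.trans_le hZT
  have haZ i j : a j i / T ≤ b i j / Z := div_le_div₀ (hb i j) (hab j i) hZ hZT
  have hcol j : ∑ i, a j i / T = min (∑ i, b i j) (w j) / T := by rw [← Finset.sum_div, hsum]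
  have hw_one : ∑ j, w j / ∑ j, w j = 1 := by rw [← Finset.sum_div, div_self hW.ne']
  have hβZ : ∑ j, ∑ i, b i j ≤ Z := by
    rw [Finset.sum_comm, ← one_mul Z, ← hp, Finset.sum_mul]
    exact Finset.sum_le_sum fun i _ => hrow i
  refine (W1_discreteMeasure_le_of_subplan x y (a := fun i j => a j i / T) hd (hp.trans hw_one.symm)
    (fun i j => div_nonneg (ha₀ j i) hT.le) (fun i => ?_) fun j => ?_).trans
    (ENNReal.ofReal_le_ofReal ?_)
  · calc ∑ j, a j i / T ≤ ∑ j, b i j / Z := Finset.sum_le_sum fun j _ => haZ i j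
      _ ≤ p i := by
          rw [← Finset.sum_div]
          exact (div_le_iff₀ hZ).2 (hrow i)
  · rw [hcol]
    exact div_le_div₀ (hw j) (min_le_right _ _) hW (le_max_right _ _)
  · rw [add_div, mul_div_assoc, Finset.sum_div]
    refine add_le_add (Finset.sum_le_sum fun i _ => ?_) (mul_le_mul_of_nonneg_left ?_ hd₀)
    · rw [Finset.sum_div]
      refine Finset.sum_le_sum fun j _ => ?_
      rw [mul_div_right_comm]
      exact mul_le_mul_of_nonneg_right (haZ i j) (abs_nonneg _)
    · simp only [hw_one, hcol]
      rw [← Finset.sum_div]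
      exact one_sub_sum_min_div_le hZ htot hβZ hE

end Transport

/-! ### Accuracy of the output -/

section Blocks

variable {k B : ℕ} {l : ℝ}

/-- The mass of the kernel centred at `l` on the `i`-th block of `B` consecutive points of the grid
of mesh `1 / (B * k)` starting at `-1`. It is concentrated on the blocks near `l`. -/
noncomputable def blockMass (k B : ℕ) (l : ℝ) (i : ℕ) : ℝ :=
  ∑ b ∈ Finset.range B, kernel k ((i * B + b : ℕ) / (B * k : ℕ) - 1 - l)

theorem blockMass_nonneg (k B : ℕ) (l : ℝ) (i : ℕ) : 0 ≤ blockMass k B l i :=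
  Finset.sum_nonneg fun _ _ => kernel_nonneg _ _

theorem sum_range_sum_range_block {R : Type*} [AddCommMonoid R] (F : ℕ → R) (n B : ℕ) :
    ∑ i ∈ Finset.range n, ∑ b ∈ Finset.range B, F (i * B + b) =
      ∑ a ∈ Finset.range (n * B), F a := by
  induction n with
  | zero => simp
  | succ n ih => rw [Finset.sum_range_succ, ih, Nat.succ_mul, Finset.sum_range_add]

theorem sum_blockMass_mem_Icc (hk : 0 < k) (hB : 12 * (k + 1) ^ 3 * 8 ^ k ≤ B) (hl₀ : 0 ≤ l)
    (hl₂ : l ≤ 2) :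
    ∑ i ∈ Finset.range (4 * k), blockMass k B l i ∈
      Set.Icc (centralSum k (B * k) - (B * k : ℕ)) (centralSum k (B * k) + 201 * (B * k : ℕ)) := by
  simp only [blockMass]
  rw [sum_range_sum_range_block fun a : ℕ => kernel k (a / (B * k : ℕ) - 1 - l), mul_assoc,
    mul_comm k B]
  exact sum_kernel_mem_Icc (hB.trans (Nat.le_mul_of_pos_right B hk)) hl₀ hl₂

theorem outputAtom_loc (hk : 0 < k) (B : ℕ) (f : ℕ → ℤ) (i : ℕ) :
    (outputAtom k B f i).loc = min (max ((i : ℝ) / k - 1) 0) 2 := by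
  have hk' : (0 : ℝ) < k := by exact_mod_cast hk
  have hsub : ((i - k : ℕ) : ℝ) = max ((i : ℝ) - k) 0 := by
    rw [← Int.toNat_sub, ← Int.cast_natCast, Int.toNat_eq_max]
    push_cast
    rfl
  rw [Atom.loc, outputAtom]
  push_cast
  rw [hsub, ← min_div_div_right hk'.le, ← max_div_div_right hk'.le, sub_div, div_self hk'.ne',
    zero_div, mul_div_cancel_right₀ _ hk'.ne']

theorem outputAtom_loc_mem_Icc (hk : 0 < k) (B : ℕ) (f : ℕ → ℤ) (i : ℕ) :
    (outputAtom k B f i).loc ∈ Set.Icc (0 : ℝ) 2 := by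
  rw [outputAtom_loc hk]
  exact ⟨le_min (le_max_right _ _) zero_le_two, min_le_right _ _⟩

theorem abs_sub_outputAtom_loc_le (hk : 0 < k) (f : ℕ → ℤ) {i b : ℕ} (hb : b < B)
    (hl₀ : 0 ≤ l) (hl₂ : l ≤ 2) :
    |l - (outputAtom k B f i).loc| ≤ |((i * B + b : ℕ) : ℝ) / (B * k : ℕ) - 1 - l| + 1 / k := by
  have hB : (0 : ℝ) < B := by exact_mod_cast b.zero_le.trans_lt hb
  have hclip : |l - (outputAtom k B f i).loc| ≤ |i / k - 1 - l| := by
    rw [outputAtom_loc hk, abs_sub_comm]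
    calc |min (max ((i : ℝ) / k - 1) 0) 2 - l|
        = |min (max ((i : ℝ) / k - 1) 0) 2 - min (max l 0) 2| := by
          rw [max_eq_left hl₀, min_eq_left hl₂]
      _ ≤ |max ((i : ℝ) / k - 1) 0 - max l 0| := abs_inf_sub_inf_le_abs _ _ _
      _ ≤ |i / k - 1 - l| := abs_max_sub_max_le_abs _ _ _
  have hpoint : ((i * B + b : ℕ) : ℝ) / (B * k : ℕ) = i / k + b / B * (1 / k) := by
    push_cast
    field_simp
  have hoffset : (b : ℝ) / B * (1 / k) ≤ 1 / k :=
    mul_le_of_le_one_left (by positivity) ((div_le_one hB).2 (by exact_mod_cast hb.le))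
  calc |l - (outputAtom k B f i).loc|
      ≤ |((i : ℝ) / k + b / B * (1 / k) - 1 - l) - b / B * (1 / k)| :=
        hclip.trans_eq (by ring_nf)
    _ ≤ |(i : ℝ) / k + b / B * (1 / k) - 1 - l| + |(b : ℝ) / B * (1 / k)| := abs_sub _ _
    _ ≤ _ := by
        rw [hpoint, abs_of_nonneg (a := (b : ℝ) / B * (1 / k)) (by positivity)]
        gcongr

theorem sum_blockMass_mul_abs_sub_loc_le (hk : 0 < k) (hB : 12 * (k + 1) ^ 3 * 8 ^ k ≤ B)
    (hl₀ : 0 ≤ l) (hl₂ : l ≤ 2) (f : ℕ → ℤ) :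
    ∑ i ∈ Finset.range (4 * k), blockMass k B l i * |l - (outputAtom k B f i).loc| ≤
      488 * (B * k : ℕ) * (k + 1) ^ 2 + (centralSum k (B * k) + 201 * (B * k : ℕ)) / k := by
  set v : ℕ → ℝ := fun a => a / (B * k : ℕ) - 1 - l
  have hM : 2 * (k + 1) ≤ B * k := by
    have hpow : k + 1 ≤ (k + 1) ^ 3 := Nat.le_self_pow (by norm_num) _
    have hpow' : 1 ≤ 8 ^ k := Nat.one_le_pow _ _ (by norm_num)
    nlinarith [Nat.le_mul_of_pos_right B hk]
  calc _ ≤ ∑ i ∈ Finset.range (4 * k), ∑ b ∈ Finset.range B,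
          (|v (i * B + b)| * kernel k (v (i * B + b)) + kernel k (v (i * B + b)) * (1 / k)) := by
        gcongr with i _
        rw [blockMass, Finset.sum_mul]
        refine Finset.sum_le_sum fun b hb => ?_
        rw [mul_comm |_|, ← mul_add]
        exact mul_le_mul_of_nonneg_left (abs_sub_outputAtom_loc_le hk f (Finset.mem_range.1 hb)
          hl₀ hl₂) (kernel_nonneg _ _)
    _ = ∑ a ∈ Finset.range (4 * (B * k)), |v a| * kernel k (v a) +
          (∑ i ∈ Finset.range (4 * k), blockMass k B l i) * (1 / k) := by
        simp only [Finset.sum_add_distrib, ← Finset.sum_mul]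
        rw [sum_range_sum_range_block fun a => |v a| * kernel k (v a), mul_assoc, mul_comm k B]
        rfl
    _ ≤ _ := by
        rw [mul_one_div]
        gcongr
        · exact sum_abs_mul_kernel_le hM hl₀ hl₂
        · exact (sum_blockMass_mem_Icc hk hB hl₀ hl₂).2

theorem cast_atomMass (k B : ℕ) (f : ℕ → ℤ) (i : ℕ) :
    (atomMass k B f i : ℝ) = ∑ b ∈ Finset.range B,
      kernelValue k ((B * k : ℕ) : ℝ) ((i * B + b : ℕ) : ℝ) fun j => (f j : ℝ) := by
  rw [atomMass, Int.cast_sum]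
  refine Finset.sum_congr rfl fun b _ => (map_kernelValue (Int.castRingHom ℝ) _ _ _ _).trans ?_
  simp only [map_natCast]
  rfl

theorem abs_atomMass_sub_le {ι : Type*} [Fintype ι] {g l : ι → ℝ} {f : ℕ → ℤ} {η : ℝ}
    (hη : 0 ≤ η) (hf : ∀ j ≤ 8 * k, |(f j : ℝ) - ∑ v, g v * (1 - l v) ^ j| ≤ η) {i : ℕ}
    (hi : i < 4 * k) :
    |(atomMass k B f i : ℝ) -
        (4 * (B * k : ℕ) ^ 2) ^ (4 * k) * ∑ v, g v * blockMass k B (l v) i| ≤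
      B * ((4 * (B * k : ℕ) ^ 2) ^ (4 * k) * (625 ^ k * η)) := by
  simp only [cast_atomMass, blockMass, Finset.mul_sum]
  rw [Finset.sum_comm, ← Finset.sum_sub_distrib]
  refine (Finset.abs_sum_le_sum_abs _ _).trans <|
    (Finset.sum_le_card_nsmul _ _ _ fun b hb => ?_).trans_eq
      (by rw [Finset.card_range, nsmul_eq_mul])
  have hbB := Finset.mem_range.1 hb
  have hM : 0 < B * k := Nat.mul_pos (by omega) (by omega)
  have hA : i * B + b ≤ 4 * (B * k) := by nlinarith
  refine le_of_eq_of_le ?_ (abs_kernelValue_sub_le (M := (B * k : ℕ)) (A := (i * B + b : ℕ))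
    (by exact_mod_cast hM) (Nat.cast_nonneg _) (by exact_mod_cast hA) hη hf)
  rw [Finset.mul_sum]
  congr! 6
  ring

end Blocks

theorem abs_toNat_div_sub_le {a : ℤ} {S β η : ℝ} (hS : 0 < S) (hβ : 0 ≤ β)
    (h : |a - S * β| ≤ S * η) : |(a.toNat : ℝ) / S - β| ≤ η := by
  have hcast : (a.toNat : ℝ) = max (a : ℝ) 0 := by
    rw [← Int.cast_natCast, Int.toNat_eq_max]
    push_cast
    rfl
  have hmax : |(a.toNat : ℝ) - S * β| ≤ S * η := by
    have hSβ : S * β = max (S * β) 0 := (max_eq_left (by positivity)).symm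
    rw [hcast, hSβ]
    exact (abs_max_sub_max_le_abs _ _ _).trans h
  rwa [div_sub' hS.ne', abs_div, abs_of_pos hS, div_le_iff₀' hS]

section Recovery

variable {ι : Type*} [Fintype ι] {p l : ι → ℝ} {k B : ℕ} {f : ℕ → ℤ}

/-- The factor by which the integers `outputAtom` exceed the averaged block masses that they
approximate. -/
noncomputable def massScale (k B : ℕ) : ℝ :=
  (4 * (B * k : ℕ) ^ 2) ^ (4 * k) * B

theorem massScale_pos (hk : 0 < k) (hB : 0 < B) : 0 < massScale k B := by
  have : 0 < B * k := Nat.mul_pos hB hk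
  rw [massScale]
  positivity

theorem abs_mass_div_massScale_sub_le (hk : 0 < k) (hB : 0 < B) (hp : ∀ v, 0 ≤ p v)
    (hf : ∀ j ≤ 8 * k, |(f j : ℝ) - B * ∑ v, p v * (1 - l v) ^ j| ≤ B / 4096 ^ k)
    {i : ℕ} (hi : i < 4 * k) :
    |(outputAtom k B f i).mass / massScale k B - ∑ v, p v * blockMass k B (l v) i| ≤ B := by
  refine abs_toNat_div_sub_le (massScale_pos hk hB)
    (Finset.sum_nonneg fun v _ => mul_nonneg (hp v) (blockMass_nonneg _ _ _ _)) ?_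
  have h := abs_atomMass_sub_le (B := B) (g := fun v => B * p v) (l := l) (f := f)
    (η := B / 4096 ^ k) (by positivity)
    (fun j hj => by simpa only [Finset.mul_sum, mul_assoc] using hf j hj) hi
  simp only [mul_assoc (B : ℝ), ← Finset.mul_sum] at h
  rw [massScale, mul_assoc _ (B : ℝ)]
  refine h.trans ?_
  have hpow : (625 : ℝ) ^ k * (B / 4096 ^ k) ≤ B := by
    rw [mul_div_left_comm, ← div_pow]
    exact mul_le_of_le_one_right (by positivity) (pow_le_one₀ (by norm_num) (by norm_num))
  calc (B : ℝ) * ((4 * (B * k : ℕ) ^ 2) ^ (4 * k) * (625 ^ k * (B / 4096 ^ k)))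
      ≤ B * ((4 * (B * k : ℕ) ^ 2) ^ (4 * k) * B) := by gcongr
    _ = _ := by ring

theorem totalMass_map_range (a : ℕ → Atom) (n : ℕ) :
    totalMass ((List.range n).map a) = ∑ i : Fin n, (a i).mass := by
  rw [← Finset.sum_range fun i => (a i).mass, totalMass, List.map_map]
  rfl

theorem outputMeasure_map_range (a : ℕ → Atom) {n : ℕ} {S : ℝ} (hS : 0 < S)
    (h : 0 < totalMass ((List.range n).map a)) :
    outputMeasure ((List.range n).map a) =
      discreteMeasure (fun i : Fin n => (a i).mass / S / ∑ j : Fin n, ((a j).mass : ℝ) / S)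
        fun i => (a i).loc := by
  have hsum : outputMeasure ((List.range n).map a) = ∑ i ∈ Finset.range n,
      (((a i).mass : ℝ≥0∞) / (totalMass ((List.range n).map a) : ℝ≥0∞)) •
        Measure.dirac (a i).loc := by
    rw [outputMeasure, List.map_map]
    rfl
  rw [hsum, Finset.sum_range, discreteMeasure]
  refine Finset.sum_congr rfl fun i _ => ?_
  rw [← Finset.sum_div, div_div_div_cancel_right₀ hS.ne', ← Nat.cast_sum, ← totalMass_map_range,
    ENNReal.ofReal_div_of_pos (by exact_mod_cast h), ENNReal.ofReal_natCast,
    ENNReal.ofReal_natCast]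

theorem cost_div_le {M : ℕ} (hk : 8192 ≤ k) (hM : 4 ≤ M) :
    (488 * M * (k + 1) ^ 2 + (centralSum k M + 201 * M) / k + 2 * (202 * M + 2 * (4 * M))) /
      (centralSum k M + 201 * M) ≤ 8192 / (k : ℝ) := by
  have hk' : (8192 : ℝ) ≤ k := by exact_mod_cast hk
  have hk₀ : (0 : ℝ) < k := by linarith
  have hM₀ : (0 : ℝ) < M := by
    have : 0 < M := by omega
    exact_mod_cast this
  have hcentral := le_centralSum (by omega : 3 ≤ k) hM
  have hmain : (k : ℝ) * (k + 1) ^ 2 ≤ (k + 1) ^ 3 := by nlinarith [sq_nonneg ((k : ℝ) + 1)]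
  have hlower : (420 : ℝ) * k ≤ (k + 1) ^ 3 := by nlinarith [mul_pos hk₀ hk₀]
  have hZ : 0 < centralSum k M + 201 * M := by
    have : 0 ≤ (M : ℝ) * (k + 1) ^ 3 / 8 := by positivity
    linarith
  rw [div_le_div_iff₀ hZ hk₀]
  calc _ = 488 * M * (k * (k + 1) ^ 2) + M * (420 * k) + (centralSum k M + 201 * M) := by
        field_simp
        ring
    _ ≤ 488 * M * (k + 1) ^ 3 + M * (k + 1) ^ 3 + (centralSum k M + 201 * M) := by gcongr
    _ ≤ 8192 * (centralSum k M + 201 * M) := by linarith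

theorem sum_abs_mass_div_massScale_sub_le (hk : 0 < k) (hB : 0 < B) (hp : ∀ v, 0 ≤ p v)
    (hf : ∀ j ≤ 8 * k, |(f j : ℝ) - B * ∑ v, p v * (1 - l v) ^ j| ≤ B / 4096 ^ k) :
    ∑ i : Fin (4 * k), |(outputAtom k B f i).mass / massScale k B -
      ∑ v, p v * blockMass k B (l v) i| ≤ 4 * (B * k : ℕ) := by
  refine (Finset.sum_le_sum fun i _ => abs_mass_div_massScale_sub_le hk hB hp hf i.2).trans_eq ?_
  rw [Finset.sum_const, Finset.card_univ, Fintype.card_fin, nsmul_eq_mul]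
  push_cast
  ring

theorem le_sum_sum_mul_blockMass (hk : 0 < k) (hB : 12 * (k + 1) ^ 3 * 8 ^ k ≤ B)
    (hp₀ : ∀ v, 0 ≤ p v) (hp : ∑ v, p v = 1) (hl : ∀ v, l v ∈ Set.Icc 0 2) :
    centralSum k (B * k) - (B * k : ℕ) ≤
      ∑ i : Fin (4 * k), ∑ v, p v * blockMass k B (l v) i := by
  rw [Finset.sum_comm, ← one_mul (_ - _), ← hp, Finset.sum_mul]
  refine Finset.sum_le_sum fun v _ => ?_
  rw [← Finset.mul_sum, Fin.sum_univ_eq_sum_range (blockMass k B (l v))]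
  exact mul_le_mul_of_nonneg_left (sum_blockMass_mem_Icc hk hB (hl v).1 (hl v).2).1 (hp₀ v)

theorem sum_sum_mul_blockMass_mul_abs_le (hk : 0 < k) (hB : 12 * (k + 1) ^ 3 * 8 ^ k ≤ B)
    (hp₀ : ∀ v, 0 ≤ p v) (hp : ∑ v, p v = 1) (hl : ∀ v, l v ∈ Set.Icc 0 2) (f : ℕ → ℤ) :
    ∑ v, ∑ i : Fin (4 * k),
        p v * blockMass k B (l v) i * |l v - (outputAtom k B f i).loc| ≤
      488 * (B * k : ℕ) * (k + 1) ^ 2 + (centralSum k (B * k) + 201 * (B * k : ℕ)) / k := by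
  refine (Finset.sum_le_sum fun v _ => ?_).trans_eq (by rw [← Finset.sum_mul, hp, one_mul])
  simp only [mul_assoc (p v), ← Finset.mul_sum]
  rw [Fin.sum_univ_eq_sum_range fun i =>
    blockMass k B (l v) i * |l v - (outputAtom k B f i).loc|]
  exact mul_le_mul_of_nonneg_left
    (sum_blockMass_mul_abs_sub_loc_le hk hB (hl v).1 (hl v).2 f) (hp₀ v)

theorem sum_mass_div_massScale_pos (hk : 3 ≤ k) (hB : 12 * (k + 1) ^ 3 * 8 ^ k ≤ B)
    (hp₀ : ∀ v, 0 ≤ p v) (hp : ∑ v, p v = 1) (hl : ∀ v, l v ∈ Set.Icc 0 2)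
    (hf : ∀ j ≤ 8 * k, |(f j : ℝ) - B * ∑ v, p v * (1 - l v) ^ j| ≤ B / 4096 ^ k) :
    0 < ∑ i : Fin (4 * k), (outputAtom k B f i).mass / massScale k B := by
  have hB₀ : 0 < B := lt_of_lt_of_le (by positivity) hB
  have hM : 4 ≤ B * k := by nlinarith [pow_pos k.succ_pos 3, pow_pos (by norm_num : 0 < 8) k]
  have hM₀ : (0 : ℝ) < (B * k : ℕ) := by exact_mod_cast (by omega : 0 < B * k)
  have herror := sum_abs_mass_div_massScale_sub_le (by omega) hB₀ hp₀ hf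
  have hdiff := (Finset.abs_sum_le_sum_abs _ _).trans herror
  rw [Finset.sum_sub_distrib] at hdiff
  have hlower := le_sum_sum_mul_blockMass (by omega) hB hp₀ hp hl
  have hcentral := le_centralSum hk hM
  have hcube : (4 : ℝ) ^ 3 ≤ (k + 1) ^ 3 := by
    gcongr
    exact_mod_cast Nat.succ_le_succ hk
  nlinarith [(abs_le.1 hdiff).1]

theorem isDistribution_and_W1_le (hk : 8192 ≤ k) (hB : 12 * (k + 1) ^ 3 * 8 ^ k ≤ B)
    (hp₀ : ∀ v, 0 ≤ p v) (hp : ∑ v, p v = 1) (hl : ∀ v, l v ∈ Set.Icc 0 2)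
    (hf : ∀ j ≤ 8 * k, |(f j : ℝ) - B * ∑ v, p v * (1 - l v) ^ j| ≤ B / 4096 ^ k) :
    IsDistribution ((List.range (4 * k)).map (outputAtom k B f)) ∧
      W1 (discreteMeasure p l) (outputMeasure ((List.range (4 * k)).map (outputAtom k B f))) ≤
        ENNReal.ofReal (8192 / k) := by
  have hk₀ : 0 < k := by omega
  have hB₀ : 0 < B := lt_of_lt_of_le (by positivity) hB
  have hM : 4 ≤ B * k := by nlinarith
  have hS := massScale_pos hk₀ hB₀
  have hloc := outputAtom_loc_mem_Icc hk₀ B f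
  have hsum := sum_mass_div_massScale_pos (by omega) hB hp₀ hp hl hf
  have hmass : 0 < totalMass ((List.range (4 * k)).map (outputAtom k B f)) := by
    rw [← Finset.sum_div, div_pos_iff_of_pos_right hS, ← Nat.cast_sum,
      ← totalMass_map_range] at hsum
    exact_mod_cast hsum
  refine ⟨⟨hmass, List.forall_mem_map.2 fun i _ => ⟨hk₀, (hloc i).2⟩⟩, ?_⟩
  have hZ : 0 < centralSum k (B * k) + 201 * (B * k : ℕ) :=
    lt_of_lt_of_le (by positivity) (add_le_add_left (le_centralSum (by omega) hM) _)
  rw [outputMeasure_map_range _ hS hmass]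
  refine (W1_discreteMeasure_le_of_kernel l (fun i : Fin (4 * k) => (outputAtom k B f i).loc)
    (b := fun v i => p v * blockMass k B (l v) i) (d := 2) (e := 202 * (B * k : ℕ))
    (fun v i => ?_) zero_le_two hp
    (fun v i => mul_nonneg (hp₀ v) (blockMass_nonneg k B (l v) i))
    (fun i => div_nonneg (Nat.cast_nonneg _) hS.le) hsum hZ (fun v => ?_) ?_
    (sum_abs_mass_div_massScale_sub_le hk₀ hB₀ hp₀ hf)).trans
    (ENNReal.ofReal_le_ofReal ?_)
  · exact abs_le.2 ⟨by linarith [(hl v).1, (hloc i).2], by linarith [(hl v).2, (hloc i).1]⟩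
  · rw [← Finset.mul_sum, Fin.sum_univ_eq_sum_range (blockMass k B (l v))]
    exact mul_le_mul_of_nonneg_left (sum_blockMass_mem_Icc hk₀ hB (hl v).1 (hl v).2).2 (hp₀ v)
  · linarith [le_sum_sum_mul_blockMass hk₀ hB hp₀ hp hl]
  · refine le_trans ?_ (cost_div_le hk hM)
    gcongr
    exact sum_sum_mul_blockMass_mul_abs_le hk₀ hB hp₀ hp hl f

end Recovery

/-! ### The compiled algorithm -/

section Runs

variable {V : Type*} [Fintype V] [DecidableEq V] [Nonempty V] {G : SimpleGraph V}
  [DecidableRel G.Adj]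

theorem step_queries_le {c c' : Config V} (h : c' ∈ (step G c).support) :
    c'.state.queries ≤ c.state.queries + 1 := by
  rcases c with ⟨_ | ⟨p, k⟩, s⟩
  · obtain rfl : c' = _ := by simpa [step] using h
    simp
  · cases p
    case randVertex a =>
      rw [step, PMF.mem_support_map_iff] at h
      obtain ⟨v, -, rfl⟩ := h
      rfl
    case randNeighbor a b =>
      rw [step, PMF.mem_support_map_iff] at h
      obtain ⟨v, -, rfl⟩ := h
      rfl
    all_goals
      obtain rfl : c' = _ := by simpa [step] using h
      simp

theorem runFrom_queries_le {c c' : Config V} {T : ℕ} (h : c' ∈ (runFrom G c T).support) :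
    c'.state.queries ≤ c.state.queries + T := by
  induction T generalizing c' with
  | zero =>
    obtain rfl : c' = c := by simpa [runFrom] using h
    rfl
  | succ T ih =>
    rw [runFrom, PMF.mem_support_bind_iff] at h
    obtain ⟨c₁, h₁, h₂⟩ := h
    linarith [ih h₁, step_queries_le h₂]

open Classical in
theorem Ensures.one_le_toOuterMeasure_add {K : ℕ} {δ : ℝ≥0∞} {c : Cmd} {h : Store V}
    {Q : Store V → Prop} (hc : Ensures G K δ c h Q) {s : State V} (hs : s.Represents h) {T : ℕ}
    (hT : c.cost K ≤ T) :
    1 ≤ (runFrom G ⟨[c.prog 32], s⟩ T).toOuterMeasure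
      {c' | c'.Halted ∧ ∃ h', c'.state.Represents h' ∧ Q h'} + δ := by
  set g : State V → ℝ≥0∞ := fun s' => if ∃ h', s'.Represents h' ∧ Q h' then 1 else 0 with hg
  set Φ : Store V → ℝ≥0∞ := fun h' => ⨅ (s' : State V) (_ : s'.Represents h'), g s'
  have hwp : 1 ≤ wp G K c Φ h + δ := hc.le_wp_add Φ 1 le_rfl fun h' hQ =>
    le_iInf₂ fun s' hs' => (if_pos ⟨h', hs', hQ⟩).ge
  have hsim : wp G K c Φ h ≤ haltValue G g ⟨[c.prog 32], s⟩ (0 + c.cost K) :=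
    (c.simulates K le_rfl).le_haltValue g [] 0 Φ h s hs fun h' s' hs' _ => by
      rw [haltValue_zero]
      exact iInf₂_le s' hs'
  refine hwp.trans (add_le_add_left (hsim.trans ?_) δ)
  refine (haltValue_mono G g _ ((zero_add _).trans_le hT)).trans ?_
  rw [haltValue, toOuterMeasure_eq_expect]
  refine expect_mono fun c' _ => ?_
  rcases c' with ⟨_ | ⟨p, k⟩, s'⟩
  · simp [haltWeight, hg, Config.Halted]
  · exact zero_le

theorem Ensures.halted {K : ℕ} {c : Cmd} {h : Store V} {Q : Store V → Prop}
    (hc : Ensures G K 0 c h Q) {s : State V} (hs : s.Represents h) {T : ℕ} (hT : c.cost K ≤ T)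
    {c' : Config V} (hc' : c' ∈ (runFrom G ⟨[c.prog 32], s⟩ T).support) : c'.Halted := by
  have hone := hc.one_le_toOuterMeasure_add hs hT
  rw [add_zero] at hone
  exact ((PMF.toOuterMeasure_apply_eq_one_iff _ _).1
    (le_antisymm ((measure_mono (Set.subset_univ _)).trans_eq
      ((PMF.toOuterMeasure_apply_eq_one_iff _ _).2 (Set.subset_univ _))) hone) hc').1

end Runs

section Parameters

theorem kernel_scale_le {k : ℕ} (hk : 0 < k) : 12 * (k + 1) ^ 3 * 8 ^ k ≤ 2 ^ (32 * k) := by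
  have hk₂ : k + 1 ≤ 2 ^ k := Nat.lt_two_pow_self
  calc 12 * (k + 1) ^ 3 * 8 ^ k ≤ 2 ^ 4 * (2 ^ k) ^ 3 * (2 ^ 3) ^ k := by gcongr <;> norm_num
    _ = 2 ^ (4 + 6 * k) := by rw [← pow_mul, ← pow_mul, ← pow_add, ← pow_add]; congr 1; ring
    _ ≤ 2 ^ (32 * k) := Nat.pow_le_pow_right (by norm_num) (by omega)

theorem failure_bound {k : ℕ} (hk : 0 < k) :
    ((8 * k + 1 : ℕ) : ℝ) * (((2 ^ (32 * k) : ℕ) : ℝ) / (((2 ^ (32 * k) : ℕ) : ℝ) / 4096 ^ k) ^ 2) ≤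
      1 / 3 := by
  have hscale : ((2 ^ (32 * k) : ℕ) : ℝ) = 256 ^ k * (4096 ^ k) ^ 2 := by
    push_cast
    rw [← pow_mul, mul_comm k 2, pow_mul, pow_mul, ← mul_pow]
    norm_num
  have hbound : (8 * k + 1) * 3 ≤ 256 ^ k := by
    have hk₂ : k < 2 ^ k := Nat.lt_two_pow_self
    have h128 : (128 : ℕ) ≤ 128 ^ k := Nat.le_self_pow hk.ne' _
    calc (8 * k + 1) * 3 ≤ 2 ^ k * 128 := by omega
      _ ≤ 2 ^ k * 128 ^ k := by gcongr
      _ = 256 ^ k := by rw [← mul_pow]; norm_num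
  calc _ = ((8 * k + 1 : ℕ) : ℝ) / 256 ^ k := by rw [hscale]; field_simp
    _ ≤ 1 / 3 := by
      rw [div_le_div_iff₀ (by positivity) (by norm_num), one_mul]
      exact_mod_cast hbound

theorem Cmd.exists_cost_le_two_pow (c : Cmd) :
    ∃ D : ℕ, ∀ k, 0 < k → c.cost (32 * (2 ^ (32 * k) * k) ^ 4) ≤ 2 ^ (D * k) := by
  obtain ⟨a, m, hcost⟩ := c.exists_cost_le
  refine ⟨a + 138 * m, fun k hk => (hcost _).trans ?_⟩
  have ha : a ≤ 2 ^ (a * k) :=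
    Nat.lt_two_pow_self.le.trans (Nat.pow_le_pow_right two_pos (Nat.le_mul_of_pos_right a hk))
  have hK : 32 * (2 ^ (32 * k) * k) ^ 4 + 1 ≤ 2 ^ (138 * k) := by
    calc 32 * (2 ^ (32 * k) * k) ^ 4 + 1 ≤ 32 * (2 ^ (32 * k) * 2 ^ k) ^ 4 + 1 := by
          gcongr
          exact Nat.lt_two_pow_self.le
      _ = 2 ^ (132 * k + 5) + 1 := by ring
      _ ≤ 2 ^ (132 * k + 5 + 1) := Nat.pow_lt_pow_right (by norm_num) (Nat.lt_succ_self _)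
      _ ≤ 2 ^ (138 * k) := Nat.pow_le_pow_right two_pos (by omega)
  calc a * (32 * (2 ^ (32 * k) * k) ^ 4 + 1) ^ m ≤ 2 ^ (a * k) * (2 ^ (138 * k)) ^ m := by gcongr
    _ = 2 ^ ((a + 138 * m) * k) := by ring

end Parameters

section Main

variable {V : Type*} [Fintype V] [DecidableEq V] [Nonempty V] {G : SimpleGraph V}
  [DecidableRel G.Adj]

theorem spectralMeasure_eq_discreteMeasure (G : SimpleGraph V) [DecidableRel G.Adj] :
    spectralMeasure G = discreteMeasure (fun _ => (Fintype.card V : ℝ)⁻¹)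
      (normLaplacian_isHermitian G).eigenvalues := by
  rw [spectralMeasure, discreteMeasure, ENNReal.ofReal_inv_of_pos (by positivity),
    ENNReal.ofReal_natCast]

theorem isDistribution_and_W1_spectralMeasure_le (hG : ∀ v, 0 < G.degree v) {k B : ℕ} {f : ℕ → ℤ}
    (hk : 8192 ≤ k) (hB : 12 * (k + 1) ^ 3 * 8 ^ k ≤ B)
    (hf : ∀ j ≤ 8 * k, |(f j : ℝ) - B * returnProb G j| ≤ B / 4096 ^ k) :
    IsDistribution ((List.range (4 * k)).map (outputAtom k B f)) ∧
      W1 (spectralMeasure G) (outputMeasure ((List.range (4 * k)).map (outputAtom k B f))) ≤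
        ENNReal.ofReal (8192 / k) := by
  rw [spectralMeasure_eq_discreteMeasure]
  refine isDistribution_and_W1_le hk hB (fun _ => by positivity) (by simp) (fun i => ?_)
    fun j hj => ?_
  · have := abs_le.1 (abs_one_sub_eigenvalue_le hG i)
    constructor <;> linarith
  · rw [← Finset.mul_sum, ← returnProb_eq_sum_eigenvalues hG]
    exact hf j hj

/-- The list `l` is an admissible output for the accuracy `1 / n`. -/
def SpectralEstimate (G : SimpleGraph V) [DecidableRel G.Adj] (n : ℕ) (l : List Atom) : Prop :=
  IsDistribution l ∧ l.length = 4 * (8192 * n) ∧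
    W1 (spectralMeasure G) (outputMeasure l) ≤ ENNReal.ofReal (1 / n)

theorem Ensures.spectralEstimate (hG : ∀ v, 0 < G.degree v) {n k B K : ℕ} (hn : 0 < n)
    (hk : k = 8192 * n) (hB : B = 2 ^ (32 * k)) (hK : 32 * (B * k) ^ 4 ≤ K) :
    Ensures G K (1 / 3) GraphSpectrum.estimateSpectrum (.init V n) fun h =>
      SpectralEstimate G n h.out := by
  have hk₀ : 0 < k := by omega
  have hB₀ : (0 : ℝ) < B := by rw [hB]; positivity
  have hδ : ((8 * k + 1 : ℕ) : ℝ≥0∞) * ENNReal.ofReal (B / (B / 4096 ^ k) ^ 2) ≤ 1 / 3 := by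
    rw [← ENNReal.ofReal_natCast, ← ENNReal.ofReal_mul (by positivity), hB]
    exact (ENNReal.ofReal_le_ofReal (failure_bound hk₀)).trans_eq
      (by rw [ENNReal.ofReal_div_of_pos (by norm_num)]; simp)
  obtain ⟨hkK, hBK⟩ := le_iteration_bound hk₀ hB hK
  have hsample := Ensures.estimateSpectrum (G := G) hn hk hB hK
    (Close := fun j v => |(v : ℝ) - B * returnProb G j| ≤ B / 4096 ^ k) fun t ht h hblock hlen =>
      Ensures.rep_sampleReturn (e := Var.block) (by omega) hBK (by positivity) hblock hlen
  refine (hsample.mono_error hδ).mono fun h _ ⟨f, hf, hout⟩ => ?_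
  obtain ⟨hdist, hW⟩ := isDistribution_and_W1_spectralMeasure_le hG (by omega)
    (hB ▸ kernel_scale_le hk₀) hf
  have hratio : (8192 : ℝ) / k = 1 / n := by
    rw [hk, Nat.cast_mul, Nat.cast_ofNat, one_div, div_mul_cancel_left₀ (by norm_num)]
  rw [SpectralEstimate, hout, ← hratio]
  exact ⟨hdist, by simp [hk], hW⟩

/-- The program of the machine for `estimateSpectrum`. -/
def spectrumProg : Prog := estimateSpectrum.prog 32

theorem run_spectrumProg_halted {n k B T : ℕ} (hn : 0 < n) (hk : k = 8192 * n)
    (hB : B = 2 ^ (32 * k)) (hT : estimateSpectrum.cost (32 * (B * k) ^ 4) ≤ T) {c : Config V}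
    (hc : c ∈ (run G spectrumProg n T).support) : c.Halted :=
  (Ensures.estimateSpectrum_trivial hn hk hB le_rfl).halted (State.init_represents V n) hT hc

theorem le_run_spectrumProg (hG : ∀ v, 0 < G.degree v) {n k B T : ℕ} (hn : 0 < n)
    (hk : k = 8192 * n) (hB : B = 2 ^ (32 * k))
    (hT : estimateSpectrum.cost (32 * (B * k) ^ 4) ≤ T) :
    2 / 3 ≤ (run G spectrumProg n T).toOuterMeasure
      {c | SpectralEstimate G n c.state.out} := by
  have hone := (Ensures.spectralEstimate hG hn hk hB le_rfl).one_le_toOuterMeasure_add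
    (State.init_represents V n) hT
  have hthird : (1 : ℝ≥0∞) = 2 / 3 + 1 / 3 := by
    rw [← ENNReal.add_div, two_add_one_eq_three, ENNReal.div_self (by norm_num) (by norm_num)]
  refine ((ENNReal.add_le_add_iff_right (by simp)).1 (hthird.symm.trans_le hone)).trans
    (measure_mono ?_)
  rintro c ⟨-, h, hrep, hest⟩
  change SpectralEstimate G n c.state.out
  rwa [hrep.out]

theorem ceil_one_div_le {ε : ℝ} (hε : 0 < ε) (hε₂ : ε ≤ 2) : (⌈1 / ε⌉₊ : ℝ) ≤ 3 / ε := by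
  have hceil : (⌈1 / ε⌉₊ : ℝ) < 1 / ε + 1 := Nat.ceil_lt_add_one (by positivity)
  have hone : 1 ≤ 2 / ε := by rwa [le_div_iff₀ hε, one_mul]
  linarith [show (3 : ℝ) / ε = 1 / ε + 2 / ε by ring]

theorem two_pow_le_floor_exp {N : ℕ} {x : ℝ} (h : N ≤ x) : 2 ^ N ≤ ⌊Real.exp x⌋₊ := by
  refine Nat.le_floor ?_
  calc ((2 ^ N : ℕ) : ℝ) ≤ Real.exp 1 ^ N := by
        push_cast
        gcongr
        linarith [Real.add_one_le_exp 1]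
    _ = Real.exp N := by rw [← Real.exp_nat_mul, mul_one]
    _ ≤ Real.exp x := Real.exp_le_exp.2 h

end Main

end GraphSpectrum

open GraphSpectrum

theorem theorem1 :
    ∃ (P : GraphSpectrum.Prog) (C : ℝ), 0 < C ∧
      ∀ ε : ℝ, 0 < ε → ε ≤ 2 →
        ∀ (V : Type*) [Fintype V] [DecidableEq V] [Nonempty V]
          (G : SimpleGraph V) [DecidableRel G.Adj], (∀ v, 0 < G.degree v) →
          (∀ c ∈ (GraphSpectrum.run G P ⌈1 / ε⌉₊ ⌊Real.exp (C / ε)⌋₊).support,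
            c.Halted ∧ (c.state.queries : ℝ) ≤ Real.exp (C / ε)) ∧
          2 / 3 ≤ (GraphSpectrum.run G P ⌈1 / ε⌉₊ ⌊Real.exp (C / ε)⌋₊).toOuterMeasure
            {c | GraphSpectrum.IsDistribution c.state.out ∧
              (c.state.out.length : ℝ) ≤ C / ε ∧
              GraphSpectrum.W1 (GraphSpectrum.spectralMeasure G)
                (GraphSpectrum.outputMeasure c.state.out) ≤ ENNReal.ofReal ε} := by
  obtain ⟨D, hcost⟩ := estimateSpectrum.exists_cost_le_two_pow
  refine ⟨spectrumProg, (D + 4) * 8192 * 3, by positivity, fun ε hε hε₂ V _ _ _ G _ hG => ?_⟩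
  set n := ⌈1 / ε⌉₊
  have hn : 0 < n := Nat.ceil_pos.2 (by positivity)
  have hnε : (D + 4) * 8192 * (n : ℝ) ≤ (D + 4) * 8192 * 3 / ε := by
    rw [mul_div_assoc]
    exact mul_le_mul_of_nonneg_left (ceil_one_div_le hε hε₂) (by positivity)
  have hT := (hcost (8192 * n) (by positivity)).trans (two_pow_le_floor_exp
    (x := (D + 4) * 8192 * 3 / ε) (le_trans (by push_cast; nlinarith) hnε))
  refine ⟨fun c hc => ⟨run_spectrumProg_halted hn rfl rfl hT hc, ?_⟩,
    (le_run_spectrumProg hG hn rfl rfl hT).trans (measure_mono fun c hc => ?_)⟩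
  · refine le_trans ?_ (Nat.floor_le (Real.exp_pos _).le)
    exact_mod_cast (runFrom_queries_le hc).trans_eq (Nat.zero_add _)
  · obtain ⟨hdist, hlen, hW⟩ := hc
    refine ⟨hdist, le_trans ?_ hnε, hW.trans (ENNReal.ofReal_le_ofReal ?_)⟩
    · rw [hlen]
      push_cast
      nlinarith [mul_nonneg D.cast_nonneg n.cast_nonneg (α := ℝ)]
    · exact (one_div_le (by exact_mod_cast hn) hε).2 (Nat.le_ceil _)
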